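/- Let $M$ be a smooth three-manifold (Hausdorff, second countable, without boundary; not necessarily compact or connected) with a parallelizable contact structure $\xi\subset TM$, i.e. a smooth field of tangent planes that has a smooth global frame $X,Y$ with $[X,Y]$ nowhere tangent to $\xi$. Let $S\xi$ be the four-manifold of pairs $(m,\ell)$, where $m\in M$ and $\ell$ is a ray (oriented direction) in $\xi_m$, and let $\pi:S\xi\to M$ be the projection; a global frame $X,Y$ of $\xi$ identifies $S\xi$ with $M\times S^1$, the direction of $\cos\theta\,X(m)+\sin\theta\,Y(m)$ corresponding to $(m,e^{i\theta})$. The Engel distribution $\mathcal D$ on $S\xi$ is the field of planes $\mathcal D_{(m,\ell)}=(d\pi)^{-1}(\mathbb R\,\ell)$. A Legendrian direction field is a smooth section $V:M\to S\xi$. For two Legendrian direction fields $V_0,V_1$ that are nowhere collinear ($V_0(m)\ne\pm V_1(m)$ for all $m$), the standard Engel domain is $$\Omega(V_0,V_1)=\{\text{directions of } \cos\theta\,v_0+\sin\theta\,v_1 \;:\; m\in M,\ 0\le\theta\le\tfrac{\pi}{2}\}\subset S\xi ,$$ where $v_0,v_1\in\xi_m$ are vectors in the directions $V_0(m),V_1(m)$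 (the domain does not depend on their choice). It is a four-manifold with boundary. It is oriented by the pair $(V_0,V_1)$: the fibres of $\pi$ are oriented by $\partial/\partial\theta$, i.e. by rotating directions from $V_0$ towards $V_1$; the four-manifold has the product of this orientation and the canonical orientation $\alpha\wedge d\alpha>0$ of $M$, where $\alpha$ is any local contact form; and $\mathcal D_{(m,\ell)}$ is oriented by $(\partial/\partial\theta,v)$ for any $v$ whose projection $d\pi(v)$ spans the ray $\ell$. (If $\xi$ is oriented and the frame $(V_0,V_1)$ is positive, these are the orientations that $S\xi$ and $\mathcal D$ inherit from $(M,\xi)$.) Theorem. Let $(V_0,V_1)$ and $(W_0,W_1)$ be two pairs of nowhere collinear Legendrian direction fields on $(M,\xi)$. The following are equivalent: (i) there is a diffeomorphism $f:\Omega(V_0,V_1)\to\Omega(W_0,W_1)$, smooth up to the boundary in both directions, with $df(\mathcal D)=\mathcal D$, that preserves the orientations of both the four-manifolds and the distributions; (ii) there is a contact diffeomorphism of $(M,\xi)$, i.e. a diffeomorphism $\varphi:M\to M$ with $d\varphi(\xi)=\xi$, such that $d\varphi$ takes the direction $V_0(m)$ to $W_0(\varphi(m))$ and the direction $V_1(m)$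 to $W_1(\varphi(m))$ for every $m\in M$. -/

import Mathlib

open scoped Manifold ContDiff

noncomputable section

namespace EngelDomain

/-! ### Parallelizable contact structures on three-manifolds -/

section Fields

variable {M : Type*} [TopologicalSpace M] [ChartedSpace (EuclideanSpace ℝ (Fin 3)) M]

/-- A smooth vector field on `M`. -/
def IsSmoothField [IsManifold (𝓡 3) ∞ M] (X : ∀ m : M, TangentSpace (𝓡 3) m) : Prop :=
  ContMDiff (𝓡 3) (𝓡 3).tangent ∞ (fun m => (⟨m, X m⟩ : TangentBundle (𝓡 3) M))

/-- `X, Y` is a smooth global frame of the field of planes `plane`. -/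
structure IsFrame [IsManifold (𝓡 3) ∞ M] (plane : ∀ m : M, Submodule ℝ (TangentSpace (𝓡 3) m))
    (X Y : ∀ m : M, TangentSpace (𝓡 3) m) : Prop where
  smooth_fst : IsSmoothField X
  smooth_snd : IsSmoothField Y
  linearIndependent : ∀ m, LinearIndependent ℝ ![X m, Y m]
  span_eq : ∀ m, Submodule.span ℝ {X m, Y m} = plane m

end Fields

/-- A parallelizable contact structure on a three-manifold `M`: a field of tangent planes that has
a smooth global frame `X, Y` and is maximally non-integrable, i.e. `[X, Y]` is nowhere tangent to
the planes (this condition does not depend on the frame). -/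
structure ParallelizableContactStructure (M : Type*) [TopologicalSpace M]
    [ChartedSpace (EuclideanSpace ℝ (Fin 3)) M] [IsManifold (𝓡 3) ∞ M] where
  plane : ∀ m : M, Submodule ℝ (TangentSpace (𝓡 3) m)
  exists_frame : ∃ X Y : ∀ m : M, TangentSpace (𝓡 3) m, IsFrame plane X Y ∧
    ∀ m, VectorField.mlieBracket (𝓡 3) X Y m ∉ plane m

/-- The oriented prolongation `Sξ`: pairs of a point `m` and a ray (direction) in the contact plane
`ξ m`. -/
@[ext]
structure OrientedProlongation {M : Type*} [TopologicalSpace M]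
    [ChartedSpace (EuclideanSpace ℝ (Fin 3)) M] [IsManifold (𝓡 3) ∞ M]
    (ξ : ParallelizableContactStructure M) where
  base : M
  dir : Module.Ray ℝ (ξ.plane base)

variable {M : Type*} [TopologicalSpace M] [ChartedSpace (EuclideanSpace ℝ (Fin 3)) M]
  [IsManifold (𝓡 3) ∞ M] {ξ : ParallelizableContactStructure M}

/-! ### The smooth structure of `Sξ` -/

section SmoothStructure

variable {X Y X' Y' : ∀ m : M, TangentSpace (𝓡 3) m}

/-- The frame, as a basis of the plane at `m`. -/
def IsFrame.basis {plane : ∀ m : M, Submodule ℝ (TangentSpace (𝓡 3) m)}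
    (h : IsFrame plane X Y) (m : M) : Module.Basis (Fin 2) ℝ (plane m) :=
  (Module.Basis.span (h.linearIndependent m)).map
    (LinearEquiv.ofEq _ _ (by rw [Matrix.range_cons_cons_empty, h.span_eq]))

lemma IsFrame.basis_zero {plane : ∀ m : M, Submodule ℝ (TangentSpace (𝓡 3) m)}
    (h : IsFrame plane X Y) (m : M) : (h.basis m 0 : TangentSpace (𝓡 3) m) = X m := by
  simp [IsFrame.basis, Module.Basis.span_apply]

lemma IsFrame.basis_one {plane : ∀ m : M, Submodule ℝ (TangentSpace (𝓡 3) m)}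
    (h : IsFrame plane X Y) (m : M) : (h.basis m 1 : TangentSpace (𝓡 3) m) = Y m := by
  simp [IsFrame.basis, Module.Basis.span_apply]

/-- The identification of `ℂ` with the plane at `m` that a basis of the plane gives. -/
def complexEquiv {m : M} (e : Module.Basis (Fin 2) ℝ (ξ.plane m)) : ℂ ≃ₗ[ℝ] ξ.plane m :=
  Complex.basisOneI.equiv e (Equiv.refl _)

lemma complexEquiv_apply {m : M} (e : Module.Basis (Fin 2) ℝ (ξ.plane m)) (z : ℂ) :
    complexEquiv e z = z.re • e 0 + z.im • e 1 := by
  have h := Complex.basisOneI.sum_repr z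
  rw [← h]
  simp only [complexEquiv, map_sum, map_smul, Module.Basis.equiv_apply, Equiv.refl_apply]
  simp [Fin.sum_univ_two]

/-- The direction of `cos θ • e₀ + sin θ • e₁`, with the angle given as a point of the circle. -/
def circleDir {m : M} (e : Module.Basis (Fin 2) ℝ (ξ.plane m)) (z : Circle) :
    OrientedProlongation ξ :=
  ⟨m, rayOfNeZero ℝ (complexEquiv e (z : ℂ)) ((complexEquiv e).map_ne_zero_iff.2 z.coe_ne_zero)⟩

lemma circleDir_injective {m : M} (e : Module.Basis (Fin 2) ℝ (ξ.plane m)) :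
    Function.Injective (circleDir e) := by
  intro z w h
  simp only [circleDir, OrientedProlongation.mk.injEq, heq_eq_eq, true_and] at h
  rw [ray_eq_iff, SameRay.sameRay_map_iff, sameRay_iff_of_norm_eq (by rw [Circle.norm_coe, Circle.norm_coe])] at h
  exact Circle.ext h

lemma circleDir_surjective {m : M} (e : Module.Basis (Fin 2) ℝ (ξ.plane m))
    (r : Module.Ray ℝ (ξ.plane m)) : ∃ z : Circle, circleDir e z = ⟨m, r⟩ := by
  induction r using Module.Ray.ind with
  | h v hv =>
    have hc : (complexEquiv e).symm v ≠ 0 := (complexEquiv e).symm.map_ne_zero_iff.2 hv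
    have hn : ‖(complexEquiv e).symm v‖ ≠ 0 := norm_ne_zero_iff.2 hc
    refine ⟨⟨‖(complexEquiv e).symm v‖⁻¹ • (complexEquiv e).symm v, ?_⟩, ?_⟩
    · simp [Submonoid.unitSphere, hn]
    · simp only [circleDir, OrientedProlongation.mk.injEq, heq_eq_eq, true_and]
      rw [ray_eq_iff, map_smul, LinearEquiv.apply_symm_apply]
      exact SameRay.sameRay_nonneg_smul_left _ (by positivity)

/-- The trivialization `Sξ ≃ M × S¹` given by a frame `X, Y` of `ξ`: the direction of
`cos θ • X m + sin θ • Y m` corresponds to `(m, exp (i θ))`. -/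
def trivialization (h : IsFrame ξ.plane X Y) : OrientedProlongation ξ ≃ M × Circle :=
  (Equiv.ofBijective (fun p : M × Circle => circleDir (h.basis p.1) p.2) <| by
    constructor
    · rintro ⟨m, z⟩ ⟨m', z'⟩ hz
      obtain rfl : m = m' := congrArg OrientedProlongation.base hz
      exact congrArg (Prod.mk m) (circleDir_injective _ hz)
    · rintro ⟨m, r⟩
      obtain ⟨z, hz⟩ := circleDir_surjective (h.basis m) r
      exact ⟨(m, z), hz⟩).symm

variable (ξ) in
/-- The trivialization of `Sξ` that defines its smooth structure. The choice of the frame does not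
matter: see `contMDiff_trivialization` and `contMDiff_trivialization_symm`. -/
def someTrivialization : OrientedProlongation ξ ≃ M × Circle :=
  trivialization ξ.exists_frame.choose_spec.choose_spec.1

instance : TopologicalSpace (OrientedProlongation ξ) :=
  TopologicalSpace.induced (someTrivialization ξ) inferInstance

variable (ξ) in
/-- The chosen trivialization, as a homeomorphism. -/
def someHomeomorph : OrientedProlongation ξ ≃ₜ M × Circle :=
  (someTrivialization ξ).toHomeomorphOfIsInducing ⟨rfl⟩

/-- The model space of `Sξ`. -/
abbrev ModelSpace := ModelProd (EuclideanSpace ℝ (Fin 3)) (EuclideanSpace ℝ (Fin 1))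

/-- The (boundaryless) model with corners of `Sξ`. -/
abbrev model : ModelWithCorners ℝ (EuclideanSpace ℝ (Fin 3) × EuclideanSpace ℝ (Fin 1))
    ModelSpace := (𝓡 3).prod (𝓡 1)

instance : ChartedSpace ModelSpace (OrientedProlongation ξ) where
  atlas := (fun c => (someHomeomorph ξ).toOpenPartialHomeomorph.trans c) ''
    atlas ModelSpace (M × Circle)
  chartAt q := (someHomeomorph ξ).toOpenPartialHomeomorph.trans
    (chartAt ModelSpace (someHomeomorph ξ q))
  mem_chart_source q := by simp
  chart_mem_atlas q := ⟨_, chart_mem_atlas _ _, rfl⟩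

instance : IsManifold model ∞ (OrientedProlongation ξ) where
  compatible := by
    rintro _ _ ⟨c, hc, rfl⟩ ⟨c', hc', rfl⟩
    have key : ((someHomeomorph ξ).toOpenPartialHomeomorph.trans c).symm.trans
        ((someHomeomorph ξ).toOpenPartialHomeomorph.trans c') = c.symm.trans c' := by
      rw [OpenPartialHomeomorph.trans_symm_eq_symm_trans_symm, OpenPartialHomeomorph.trans_assoc,
        ← OpenPartialHomeomorph.trans_assoc _ _ c', ← Homeomorph.symm_toOpenPartialHomeomorph,
        ← Homeomorph.trans_toOpenPartialHomeomorph]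
      simp
    change _ ∈ contDiffGroupoid ∞ model
    erw [key]
    exact HasGroupoid.compatible hc hc'

lemma contMDiff_someHomeomorph : ContMDiff model model ∞ (someHomeomorph ξ) := by
  intro q
  have h1 : ContMDiffAt model model ∞ (chartAt ModelSpace q) q :=
    contMDiffAt_of_mem_maximalAtlas (IsManifold.chart_mem_maximalAtlas q) (mem_chart_source _ q)
  have h2 : ContMDiffAt model model ∞ (chartAt ModelSpace (someHomeomorph ξ q)).symm
      (chartAt ModelSpace q q) :=
    contMDiffAt_symm_of_mem_maximalAtlas (IsManifold.chart_mem_maximalAtlas _)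
      (mem_chart_target ModelSpace (someHomeomorph ξ q))
  refine (h2.comp q h1).congr_of_eventuallyEq ?_
  filter_upwards [(chartAt ModelSpace q).open_source.mem_nhds (mem_chart_source _ q)] with x hx
  have hx' : someHomeomorph ξ x ∈ (chartAt ModelSpace (someHomeomorph ξ q)).source := by
    change x ∈ ((someHomeomorph ξ).toOpenPartialHomeomorph.trans
      (chartAt ModelSpace (someHomeomorph ξ q))).source at hx
    rw [OpenPartialHomeomorph.trans_source] at hx
    exact hx.2
  exact ((chartAt ModelSpace (someHomeomorph ξ q)).left_inv hx').symm

lemma contMDiff_someHomeomorph_symm : ContMDiff model model ∞ (someHomeomorph ξ).symm := by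
  intro p
  obtain ⟨q, rfl⟩ := (someHomeomorph ξ).surjective p
  have h1 : ContMDiffAt model model ∞ (chartAt ModelSpace (someHomeomorph ξ q))
      (someHomeomorph ξ q) :=
    contMDiffAt_of_mem_maximalAtlas (IsManifold.chart_mem_maximalAtlas _) (mem_chart_source _ _)
  have h2 : ContMDiffAt model model ∞ (chartAt ModelSpace q).symm (chartAt ModelSpace q q) :=
    contMDiffAt_symm_of_mem_maximalAtlas (IsManifold.chart_mem_maximalAtlas _) (mem_chart_target _ q)
  refine (ContMDiffAt.comp (someHomeomorph ξ q) (g := (chartAt ModelSpace q).symm)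
    (f := chartAt ModelSpace (someHomeomorph ξ q)) h2 h1).congr_of_eventuallyEq ?_
  filter_upwards [(chartAt ModelSpace (someHomeomorph ξ q)).open_source.mem_nhds
    (mem_chart_source _ _)] with x hx
  exact congrArg (someHomeomorph ξ).symm
    ((chartAt ModelSpace (someHomeomorph ξ q)).left_inv hx).symm

lemma contMDiffAt_coeff {plane : ∀ m : M, Submodule ℝ (TangentSpace (𝓡 3) m)}
    (h : IsFrame plane X Y) {V : ∀ m : M, TangentSpace (𝓡 3) m} (hV : IsSmoothField V)
    {a b : M → ℝ} (hab : ∀ m, V m = a m • X m + b m • Y m) (m₀ : M) :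
    ContMDiffAt (𝓡 3) 𝓘(ℝ, ℝ) ∞ a m₀ ∧ ContMDiffAt (𝓡 3) 𝓘(ℝ, ℝ) ∞ b m₀ := by
  let E := EuclideanSpace ℝ (Fin 3)
  let t := trivializationAt E (TangentSpace (𝓡 3) : M → Type _) m₀
  let co : (∀ m : M, TangentSpace (𝓡 3) m) → M → E := fun W m => (t ⟨m, W m⟩).2
  have sm : ∀ W, IsSmoothField W → ContMDiffAt (𝓡 3) 𝓘(ℝ, E) ∞ (co W) m₀ := fun W hW =>
    (Bundle.contMDiffAt_section m₀).1 (hW m₀)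
  have ip : ∀ {f g : M → E}, ContMDiffAt (𝓡 3) 𝓘(ℝ, E) ∞ f m₀ →
      ContMDiffAt (𝓡 3) 𝓘(ℝ, E) ∞ g m₀ →
      ContMDiffAt (𝓡 3) 𝓘(ℝ, ℝ) ∞ (fun m => inner ℝ (f m) (g m)) m₀ := fun hf hg =>
    (ContDiff.contDiffAt (contDiff_inner (𝕜 := ℝ) (E := E))).contMDiffAt.comp m₀
      (hf.prodMk_space hg)
  have hX := sm X h.smooth_fst
  have hY := sm Y h.smooth_snd
  have hW := sm V hV
  have lin : ∀ m ∈ t.baseSet, co V m = a m • co X m + b m • co Y m ∧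
      LinearIndependent ℝ ![co X m, co Y m] := by
    intro m hm
    have e : ∀ W, co W m = t.continuousLinearEquivAt ℝ m hm (W m) := fun W => rfl
    refine ⟨by simp only [e, hab m, map_add, map_smul], ?_⟩
    have := (h.linearIndependent m).map' (t.continuousLinearEquivAt ℝ m hm).toLinearEquiv.toLinearMap
      (LinearEquiv.ker _)
    have e2 : (t.continuousLinearEquivAt ℝ m hm).toLinearEquiv.toLinearMap ∘ ![X m, Y m] =
        ![co X m, co Y m] := by
      funext i
      fin_cases i <;> rfl
    rw [e2] at this
    exact this
  let G : M → ℝ := fun m => inner ℝ (co X m) (co X m) * inner ℝ (co Y m) (co Y m) -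
    inner ℝ (co X m) (co Y m) * inner ℝ (co X m) (co Y m)
  have hG : ContMDiffAt (𝓡 3) 𝓘(ℝ, ℝ) ∞ G m₀ :=
    ((ip hX hX).mul (ip hY hY)).sub ((ip hX hY).mul (ip hX hY))
  have nz : ∀ m ∈ t.baseSet, G m ≠ 0 := by
    intro m hm h0
    have h1 := (lin m hm).2
    have hx : co X m ≠ 0 := h1.ne_zero 0
    have key := abs_real_inner_div_norm_mul_norm_eq_one_iff (co X m) (co Y m)
    have hy : co Y m ≠ 0 := h1.ne_zero 1
    have : |inner ℝ (co X m) (co Y m) / (‖co X m‖ * ‖co Y m‖)| = 1 := by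
      have nx := norm_pos_iff.2 hx
      have ny := norm_pos_iff.2 hy
      rw [← sq_eq_sq₀ (abs_nonneg _) zero_le_one, sq_abs, div_pow, one_pow,
        div_eq_one_iff_eq (by positivity)]
      simp only [G, real_inner_self_eq_norm_sq] at h0
      nlinarith
    obtain ⟨-, r, -, hr⟩ := key.1 this
    have := LinearIndependent.pair_iff.1 h1 r (-1) (by rw [hr]; simp)
    norm_num at this
  have m₀t : m₀ ∈ t.baseSet := FiberBundle.mem_baseSet_trivializationAt' m₀
  have nhds := t.open_baseSet.mem_nhds m₀t
  have hGi : ContMDiffAt (𝓡 3) 𝓘(ℝ, ℝ) ∞ (fun m => (G m)⁻¹) m₀ := hG.inv₀ (nz m₀ m₀t)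
  constructor
  · refine ((((ip hX hW).mul (ip hY hY)).sub ((ip hY hW).mul (ip hX hY))).mul
      hGi).congr_of_eventuallyEq ?_
    filter_upwards [nhds] with m hm
    have := nz m hm
    simp only [Pi.mul_apply]
    rw [eq_mul_inv_iff_mul_eq₀ this, (lin m hm).1]
    simp only [G, inner_add_right, inner_smul_right, real_inner_comm (co X m) (co Y m)]
    ring
  · refine ((((ip hY hW).mul (ip hX hX)).sub ((ip hX hW).mul (ip hX hY))).mul
      hGi).congr_of_eventuallyEq ?_
    filter_upwards [nhds] with m hm
    have := nz m hm
    simp only [Pi.mul_apply]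
    rw [eq_mul_inv_iff_mul_eq₀ this, (lin m hm).1]
    simp only [G, inner_add_right, inner_smul_right, real_inner_comm (co X m) (co Y m)]
    ring

lemma trivialization_symm_apply (h : IsFrame ξ.plane X Y) (p : M × Circle) :
    (trivialization h).symm p = circleDir (h.basis p.1) p.2 := rfl

/-- Any two trivializations differ by a smooth map. -/
lemma contMDiff_transition (h : IsFrame ξ.plane X Y) (h' : IsFrame ξ.plane X' Y') :
    ContMDiff model model ∞ (fun p => trivialization h ((trivialization h').symm p)) := by
  have repr : ∀ (V : ∀ m : M, TangentSpace (𝓡 3) m) (m : M) (hm : V m ∈ ξ.plane m),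
      V m = (h.basis m).repr ⟨V m, hm⟩ 0 • X m + (h.basis m).repr ⟨V m, hm⟩ 1 • Y m := by
    intro V m hm
    have := congrArg Subtype.val ((h.basis m).sum_repr ⟨V m, hm⟩)
    rw [Fin.sum_univ_two, Submodule.coe_add, Submodule.coe_smul, Submodule.coe_smul,
      h.basis_zero, h.basis_one] at this
    exact this.symm
  have mX : ∀ m, X' m ∈ ξ.plane m := fun m => by
    rw [← h'.span_eq]; exact Submodule.subset_span (by simp)
  have mY : ∀ m, Y' m ∈ ξ.plane m := fun m => by
    rw [← h'.span_eq]; exact Submodule.subset_span (by simp)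
  obtain ⟨sa, sb⟩ := forall_and.1 (contMDiffAt_coeff h h'.smooth_fst fun m => repr X' m (mX m))
  obtain ⟨sc, sd⟩ := forall_and.1 (contMDiffAt_coeff h h'.smooth_snd fun m => repr Y' m (mY m))
  let w : M × Circle → ℂ := fun p =>
    (complexEquiv (h.basis p.1)).symm (complexEquiv (h'.basis p.1) (p.2 : ℂ))
  have w0 : ∀ p, w p ≠ 0 := fun p => by simp [w]
  have wre : ∀ p, w p = ((p.2 : ℂ).re * (h.basis p.1).repr ⟨X' p.1, mX p.1⟩ 0 +
      (p.2 : ℂ).im * (h.basis p.1).repr ⟨Y' p.1, mY p.1⟩ 0 : ℝ) +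
      ((p.2 : ℂ).re * (h.basis p.1).repr ⟨X' p.1, mX p.1⟩ 1 +
      (p.2 : ℂ).im * (h.basis p.1).repr ⟨Y' p.1, mY p.1⟩ 1 : ℝ) * Complex.I := by
    intro p
    rw [LinearEquiv.symm_apply_eq, complexEquiv_apply, complexEquiv_apply]
    apply Subtype.ext
    simp only [Submodule.coe_add, Submodule.coe_smul, h.basis_zero, h.basis_one, h'.basis_zero,
      h'.basis_one]
    conv_lhs => rw [repr X' p.1 (mX p.1), repr Y' p.1 (mY p.1)]
    simp
    module
  have sw : ContMDiff model 𝓘(ℝ, ℂ) ∞ w := by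
    have c0 : ContMDiff (𝓡 1) 𝓘(ℝ, ℂ) ∞ (fun z : Circle => (z : ℂ)) := by
      have := finrank_real_complex_fact'
      exact contMDiff_coe_sphere
    have c1 : ContMDiff model 𝓘(ℝ, ℂ) ∞ (fun p : M × Circle => (p.2 : ℂ)) := c0.comp contMDiff_snd
    have re : ContMDiff model 𝓘(ℝ, ℝ) ∞ (fun p : M × Circle => (p.2 : ℂ).re) :=
      Complex.reCLM.contDiff.contMDiff.comp c1
    have im : ContMDiff model 𝓘(ℝ, ℝ) ∞ (fun p : M × Circle => (p.2 : ℂ).im) :=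
      Complex.imCLM.contDiff.contMDiff.comp c1
    have of : ContMDiff 𝓘(ℝ, ℝ) 𝓘(ℝ, ℂ) ∞ (fun x : ℝ => (x : ℂ)) :=
      Complex.ofRealCLM.contDiff.contMDiff
    have fst : ∀ {f : M → ℝ}, (∀ m, ContMDiffAt (𝓡 3) 𝓘(ℝ, ℝ) ∞ f m) →
        ContMDiff model 𝓘(ℝ, ℝ) ∞ (fun p : M × Circle => f p.1) := fun hf =>
      ContMDiff.comp (I' := 𝓡 3) (fun m => hf m) contMDiff_fst
    have mulI : ContMDiff 𝓘(ℝ, ℂ) 𝓘(ℝ, ℂ) ∞ (fun z : ℂ => z * Complex.I) :=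
      (contDiff_id.mul contDiff_const).contMDiff
    rw [funext wre]
    exact (of.comp ((re.mul (fst sa)).add (im.mul (fst sc)))).add
      (mulI.comp (of.comp ((re.mul (fst sb)).add (im.mul (fst sd)))))
  have sn : ContMDiff model 𝓘(ℝ, ℂ) ∞ (fun p => (‖w p‖⁻¹ : ℝ) • w p) := by
    intro p
    have : ContDiffAt ℝ ∞ (fun z : ℂ => (‖z‖⁻¹ : ℝ) • z) (w p) :=
      ((contDiffAt_norm ℝ (w0 p)).inv (norm_ne_zero_iff.2 (w0 p))).smul contDiffAt_id
    exact this.contMDiffAt.comp p (sw p)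
  have hn : ∀ p, (‖w p‖⁻¹ : ℝ) • w p ∈ Submonoid.unitSphere ℂ := fun p => by
    simp [Submonoid.unitSphere, w0 p]
  let u : M × Circle → Circle := fun p => ⟨(‖w p‖⁻¹ : ℝ) • w p, hn p⟩
  have eq : (fun p => trivialization h ((trivialization h').symm p)) = fun p => (p.1, u p) := by
    funext p
    refine (Equiv.eq_symm_apply _).1 ?_
    rw [trivialization_symm_apply, trivialization_symm_apply]
    simp only [circleDir, OrientedProlongation.mk.injEq, heq_eq_eq, true_and]
    rw [ray_eq_iff]
    have : complexEquiv (h.basis p.1) (u p : ℂ) =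
        (‖w p‖⁻¹ : ℝ) • complexEquiv (h'.basis p.1) (p.2 : ℂ) := by
      change complexEquiv (h.basis p.1) ((‖w p‖⁻¹ : ℝ) • w p) = _
      rw [map_smul, LinearEquiv.apply_symm_apply]
    rw [this]
    exact SameRay.sameRay_nonneg_smul_right _ (by positivity)
  rw [eq]
  refine contMDiff_fst.prodMk ?_
  have := finrank_real_complex_fact'
  exact ContMDiff.codRestrict_sphere sn _

/-- Every trivialization of `Sξ` by a frame of `ξ` is smooth. -/
lemma contMDiff_trivialization (h : IsFrame ξ.plane X Y) :
    ContMDiff model model ∞ (trivialization h) := by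
  refine ((contMDiff_transition h ξ.exists_frame.choose_spec.choose_spec.1).comp
    (contMDiff_someHomeomorph (ξ := ξ))).congr fun q => ?_
  exact congrArg (trivialization h) ((someTrivialization ξ).symm_apply_apply q).symm

/-- Every trivialization of `Sξ` by a frame of `ξ` has a smooth inverse. -/
lemma contMDiff_trivialization_symm (h : IsFrame ξ.plane X Y) :
    ContMDiff model model ∞ (trivialization h).symm := by
  refine ((contMDiff_someHomeomorph_symm (ξ := ξ)).comp
    (contMDiff_transition ξ.exists_frame.choose_spec.choose_spec.1 h)).congr fun q => ?_
  exact ((someTrivialization ξ).symm_apply_apply _).symm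

end SmoothStructure

/-! ### The Engel distribution of `Sξ` -/

/-- The tangent vector `v` points in the direction of the ray `r` of `ξ m`: it is a non-zero vector
of `ξ m` whose positive span is `r`. -/
def PointsAlong {m : M} (r : Module.Ray ℝ (ξ.plane m)) (v : TangentSpace (𝓡 3) m) : Prop :=
  ∃ (hv : v ∈ ξ.plane m) (h0 : (⟨v, hv⟩ : ξ.plane m) ≠ 0), rayOfNeZero ℝ ⟨v, hv⟩ h0 = r

/-- The differential at `q` of the projection `π : Sξ → M`. -/
def projDeriv (q : OrientedProlongation ξ) :
    TangentSpace model q →L[ℝ] TangentSpace (𝓡 3) q.base :=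
  mfderiv model (𝓡 3) (OrientedProlongation.base : OrientedProlongation ξ → M) q

/-- The Engel distribution of `Sξ`: the plane at `q = (m, ℓ)` is the preimage under `dπ` of the line
spanned by the ray `ℓ`. -/
def engelPlane (q : OrientedProlongation ξ) : Submodule ℝ (TangentSpace model q) :=
  (Submodule.span ℝ {v | PointsAlong q.dir v}).comap (projDeriv q).toLinearMap

/-! ### Legendrian direction fields and standard Engel domains -/

/-- A smooth Legendrian direction field: a smooth section of `Sξ → M`. -/
structure LegendrianField (ξ : ParallelizableContactStructure M) where
  dir : ∀ m : M, Module.Ray ℝ (ξ.plane m)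
  smooth : ContMDiff (𝓡 3) model ∞ (fun m => (⟨m, dir m⟩ : OrientedProlongation ξ))

/-- The direction of `cos θ • e₀ + sin θ • e₁`. -/
def angleDir {m : M} (e : Module.Basis (Fin 2) ℝ (ξ.plane m)) (θ : ℝ) : OrientedProlongation ξ :=
  circleDir e (Circle.exp θ)

namespace LegendrianField

variable (V₀ V₁ : LegendrianField ξ)

/-- The two direction fields are nowhere collinear. -/
def NeverCollinear : Prop :=
  ∀ m, V₀.dir m ≠ V₁.dir m ∧ V₀.dir m ≠ -V₁.dir m

/-- `e` is a pair of vectors of `ξ m` that represents the pair of directions `V₀ m, V₁ m`. -/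
def Represented {m : M} (e : Module.Basis (Fin 2) ℝ (ξ.plane m)) : Prop :=
  rayOfNeZero ℝ (e 0) (e.ne_zero 0) = V₀.dir m ∧ rayOfNeZero ℝ (e 1) (e.ne_zero 1) = V₁.dir m

/-- The standard Engel domain `Ω(V₀, V₁)`: all directions `cos θ V₀ + sin θ V₁`,
`0 ≤ θ ≤ π / 2`. (It does not depend on the vectors that represent `V₀` and `V₁`.) -/
def engelDomain : Set (OrientedProlongation ξ) :=
  {q | ∃ e : Module.Basis (Fin 2) ℝ (ξ.plane q.base), V₀.Represented V₁ e ∧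
    ∃ θ ∈ Set.Icc 0 (Real.pi / 2), angleDir e θ = q}

/-! ### Orientations -/

/-- `w` is a vertical tangent vector of `Sξ` of the form `∂/∂θ`, i.e. a velocity of a curve
`θ ↦ cos θ V₀ + sin θ V₁` in a fibre of `Sξ`. These vectors orient the fibres: they rotate the
direction in the sense from `V₀` to `V₁`. -/
def IsThetaVector (w : TangentBundle model (OrientedProlongation ξ)) : Prop :=
  ∃ (m : M) (e : Module.Basis (Fin 2) ℝ (ξ.plane m)) (θ : ℝ), V₀.Represented V₁ e ∧
    w = ⟨angleDir e θ, mfderiv 𝓘(ℝ, ℝ) model (angleDir e) θ (1 : ℝ)⟩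

end LegendrianField

variable (ξ) in
/-- Positive bases for the orientation of `M` by its contact structure: the one given by
`X, Y, [Y, X]` for a smooth frame `X, Y` of `ξ` (for a contact form `α`, this is the orientation by
the volume form `α ∧ dα`; it depends neither on `α` nor on `X, Y`). -/
def IsContactPositive {m : M} (c : Module.Basis (Fin 3) ℝ (TangentSpace (𝓡 3) m)) : Prop :=
  ∃ X Y : ∀ m : M, TangentSpace (𝓡 3) m, IsFrame ξ.plane X Y ∧
    ∃ c' : Module.Basis (Fin 3) ℝ (TangentSpace (𝓡 3) m), c' 0 = X m ∧ c' 1 = Y m ∧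
      c' 2 = VectorField.mlieBracket (𝓡 3) Y X m ∧ c.orientation = c'.orientation

namespace LegendrianField

variable (V₀ V₁ : LegendrianField ξ)

/-- Positive bases of `T_q Sξ`, for the product of the orientation of the fibre (from `V₀` to `V₁`)
and the contact orientation of `M`. -/
def IsPositiveBasis (q : OrientedProlongation ξ)
    (b : Module.Basis (Fin 4) ℝ (TangentSpace model q)) : Prop :=
  ∃ (b' : Module.Basis (Fin 4) ℝ (TangentSpace model q))
    (c : Module.Basis (Fin 3) ℝ (TangentSpace (𝓡 3) q.base)),
    V₀.IsThetaVector V₁ ⟨q, b' 0⟩ ∧ (∀ i : Fin 3, projDeriv q (b' i.succ) = c i) ∧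
      IsContactPositive ξ c ∧ b.orientation = b'.orientation

/-- Positive bases of the Engel plane at `q = (m, ℓ)`: those oriented like `∂/∂θ, v`, where
`∂/∂θ` rotates from `V₀` to `V₁` and `v` projects into the ray `ℓ`. -/
def IsPositiveEngelBasis (q : OrientedProlongation ξ)
    (b : Module.Basis (Fin 2) ℝ (engelPlane q)) : Prop :=
  ∃ b' : Module.Basis (Fin 2) ℝ (engelPlane q),
    V₀.IsThetaVector V₁ ⟨q, (b' 0 : TangentSpace model q)⟩ ∧
      PointsAlong q.dir (projDeriv q (b' 1 : TangentSpace model q)) ∧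
      b.orientation = b'.orientation

end LegendrianField

/-! ### Engel diffeomorphisms and contact diffeomorphisms -/

/-- `f` restricts to a diffeomorphism from `Ω` to `Ω'` (smooth up to the boundary), with inverse `g`
(the values of `f` outside `Ω` and of `g` outside `Ω'` are irrelevant). -/
structure IsDiffeoOn (f g : OrientedProlongation ξ → OrientedProlongation ξ)
    (Ω Ω' : Set (OrientedProlongation ξ)) : Prop where
  smooth : ContMDiffOn model model ∞ f Ω
  smooth_inv : ContMDiffOn model model ∞ g Ω'
  mapsTo : Set.MapsTo f Ω Ω'
  mapsTo_inv : Set.MapsTo g Ω' Ω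
  invOn : Set.InvOn g f Ω Ω'

/-- `f` restricts to an Engel diffeomorphism from `Ω(V₀, V₁)` to `Ω(W₀, W₁)` that preserves the
orientations of both the four-manifolds and the Engel distributions, where `V₀, V₁` orient the
source and `W₀, W₁` the target. -/
structure IsOrientedEngelDiffeo (V₀ V₁ W₀ W₁ : LegendrianField ξ)
    (f : OrientedProlongation ξ → OrientedProlongation ξ) : Prop where
  diffeo : ∃ g, IsDiffeoOn f g (V₀.engelDomain V₁) (W₀.engelDomain W₁)
  engel : ∀ q ∈ V₀.engelDomain V₁,
    (engelPlane q).map (mfderivWithin model model f (V₀.engelDomain V₁) q).toLinearMap =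
      engelPlane (f q)
  orientation : ∀ q ∈ V₀.engelDomain V₁, ∀ b, V₀.IsPositiveBasis V₁ q b →
    ∃ b', W₀.IsPositiveBasis W₁ (f q) b' ∧
      ∀ i, b' i = mfderivWithin model model f (V₀.engelDomain V₁) q (b i)
  engel_orientation : ∀ q ∈ V₀.engelDomain V₁, ∀ b, V₀.IsPositiveEngelBasis V₁ q b →
    ∃ b', W₀.IsPositiveEngelBasis W₁ (f q) b' ∧
      ∀ i, (b' i : TangentSpace model (f q)) =
        mfderivWithin model model f (V₀.engelDomain V₁) q (b i : TangentSpace model q)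

/-- `φ` is a contact diffeomorphism of `(M, ξ)`. -/
def IsContactDiffeo (ξ : ParallelizableContactStructure M)
    (φ : Diffeomorph (𝓡 3) (𝓡 3) M M ∞) : Prop :=
  ∀ m, (ξ.plane m).map (mfderiv (𝓡 3) (𝓡 3) φ m).toLinearMap = ξ.plane (φ m)

/-- `dφ` takes the direction field `V` to the direction field `W`. -/
def TakesField (φ : Diffeomorph (𝓡 3) (𝓡 3) M M ∞) (V W : LegendrianField ξ) : Prop :=
  ∀ m, ∀ v, PointsAlong (V.dir m) v → PointsAlong (W.dir (φ m)) (mfderiv (𝓡 3) (𝓡 3) φ m v)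

end EngelDomain

end

/-! In a frame `X, Y` of `ξ` the Engel plane at angle `θ` is spanned by the fibre direction `∂/∂θ`
and a lift of `u = cos θ X + sin θ Y`. Their bracket is the lift of `-sin θ X + cos θ Y`, so the
plane field and its brackets fill the hyperplane field `(dπ)⁻¹ ξ`. Because `ξ` is contact, the fibre
is exactly the characteristic direction of this hyperplane field. The fibres are thus determined by
the Engel distribution, and an Engel diffeomorphism `f` must permute them.

The infinitesimal form of this is `fderiv_fibre_eq_zero`, applied to `A = π ∘ f`. Let `α` be a
contact form of the target. The pullback of `α` by `A` kills `∂/∂θ` and `u`, whose images are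
collinear. Cartan's formula (`extDerivPair_add_lieBracket`) then shows that it kills `X` and `Y`,
and that the image of `∂/∂θ` is `dα`-orthogonal to the images of `X` and `Y`. Since `dA` is onto,
these images fill the contact plane up to the image of `∂/∂θ` itself, and non-degeneracy of `dα` on
that plane makes the image of `∂/∂θ` vanish. So `A` is constant along fibres (`exists_base_map`),
and the same argument for the inverse shows that `f` covers a contact diffeomorphism `φ`
(`IsDiffeoOn.exists_contactDiffeo`).

It remains to follow signs. A contact diffeomorphism always preserves the orientation `X, Y, [Y, X]`
(`det_contactBasis_pos`). The derivative of `f` scales the fibre by a factor `t`, and `dφ` scales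
the direction by a factor `r`. The orientation of the four-manifold forces `t > 0`, and then the
orientation of the Engel planes forces `r > 0` (`IsOrientedEngelDiffeo.positive`). By `t > 0` the
angle increases along each fibre, so `f` matches the boundary component of `V₀` with that of `W₀`,
and `V₁` with `W₁` (`angle_boundary`). On these components `r > 0` says that `dφ` carries the
directions to each other and not to their opposites.

Conversely, a frame adapted to `(V₀, V₁)` is pushed forward by `φ` to one adapted to `(W₀, W₁)`. The
map that covers `φ` and keeps the angle has `t = r = 1` (`exists_orientedEngelDiffeo`). -/

noncomputable section

namespace EngelDomain

open Filter Topology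

/-! ### A Cartan formula in normed spaces -/

section Flat

variable {N E : Type*} [NormedAddCommGroup N] [NormedSpace ℝ N]
  [NormedAddCommGroup E] [NormedSpace ℝ E]

/-- The exterior derivative of a one-form, as a function of two vectors. -/
def extDerivPair (α : E → E →L[ℝ] ℝ) (x u v : E) : ℝ := fderiv ℝ α x u v - fderiv ℝ α x v u

lemma extDerivPair_combination (α : E → E →L[ℝ] ℝ) (x u v : E) (a b c d : ℝ) :
    extDerivPair α x (a • u + b • v) (c • u + d • v) = (a * d - b * c) * extDerivPair α x u v := by
  simp only [extDerivPair, map_add, map_smul, add_apply,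
    smul_apply, smul_eq_mul]
  ring

/-- If the pullback by `A` of the one-form `α` vanishes on the vector fields `V` and `W`, then it
maps their bracket to the value of `-dα`. -/
lemma extDerivPair_add_lieBracket {α : E → E →L[ℝ] ℝ} {A : N → E} {V W : N → N} {p : N}
    (hα : DifferentiableAt ℝ α (A p)) (hA : ContDiffAt ℝ 2 A p)
    (hV : DifferentiableAt ℝ V p) (hW : DifferentiableAt ℝ W p)
    (h0V : ∀ᶠ q in 𝓝 p, α (A q) (fderiv ℝ A q (V q)) = 0)
    (h0W : ∀ᶠ q in 𝓝 p, α (A q) (fderiv ℝ A q (W q)) = 0) :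
    extDerivPair α (A p) (fderiv ℝ A p (V p)) (fderiv ℝ A p (W p)) +
      α (A p) (fderiv ℝ A p (VectorField.lieBracket ℝ V W p)) = 0 := by
  have hA1 : DifferentiableAt ℝ A p := hA.differentiableAt (by norm_num)
  have hA2 : DifferentiableAt ℝ (fderiv ℝ A) p :=
    (hA.fderiv_right (m := 1) (by norm_num)).differentiableAt (by norm_num)
  have hαA : HasFDerivAt (fun q => α (A q)) ((fderiv ℝ α (A p)).comp (fderiv ℝ A p)) p :=
    hα.hasFDerivAt.comp p hA1.hasFDerivAt
  -- The identity `α(dA Z) = 0` holds near `p`, so it may be differentiated in the direction `u`.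
  have key : ∀ {Z : N → N}, DifferentiableAt ℝ Z p →
      (∀ᶠ q in 𝓝 p, α (A q) (fderiv ℝ A q (Z q)) = 0) → ∀ u : N,
      fderiv ℝ α (A p) (fderiv ℝ A p u) (fderiv ℝ A p (Z p)) +
        α (A p) (fderiv ℝ (fderiv ℝ A) p u (Z p) + fderiv ℝ A p (fderiv ℝ Z p u)) = 0 := by
    intro Z hZ h0 u
    have h1 := hαA.clm_apply (hA2.hasFDerivAt.clm_apply hZ.hasFDerivAt)
    have h2 := h1.unique ((hasFDerivAt_const (0 : ℝ) p).congr_of_eventuallyEq h0)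
    have h3 := congrArg (fun T : N →L[ℝ] ℝ => T u) h2
    simp only [add_apply, ContinuousLinearMap.comp_apply,
      ContinuousLinearMap.flip_apply, zero_apply] at h3
    rw [add_comm (fderiv ℝ (fderiv ℝ A) p u (Z p))]
    linarith
  -- The second derivatives of `A` cancel in the difference of the two instances of `key`; only `dα`
  -- and the bracket remain.
  have sym : fderiv ℝ (fderiv ℝ A) p (V p) (W p) = fderiv ℝ (fderiv ℝ A) p (W p) (V p) :=
    (hA.isSymmSndFDerivAt (by simp)) _ _
  have h1 := key hW h0W (V p)
  have h2 := key hV h0V (W p)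
  rw [← sym] at h2
  simp only [VectorField.lieBracket, extDerivPair, map_sub, map_add] at *
  linarith

/-- Dimension count. It is used for the contact form in dimension three and for its pullback in
dimension four. -/
lemma ker_eq_span_of_linearIndependent [FiniteDimensional ℝ N] {n : ℕ}
    (hn : Module.finrank ℝ N = n + 1) {β : N →ₗ[ℝ] ℝ} (hβ : β ≠ 0) {v : Fin n → N}
    (hv : LinearIndependent ℝ v) (h0 : ∀ i, β (v i) = 0) :
    LinearMap.ker β = Submodule.span ℝ (Set.range v) := by
  refine (Submodule.eq_of_le_of_finrank_eq ?_ ?_).symm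
  · rw [Submodule.span_le]
    rintro _ ⟨i, rfl⟩
    exact h0 i
  · have h1 := Module.Dual.finrank_ker_add_one_of_ne_zero (f := β) hβ
    rw [finrank_span_eq_card hv, Fintype.card_fin]
    omega

/-- The one-form `det (X, Y, ·)`. -/
def detForm (X Y : EuclideanSpace ℝ (Fin 3)) : EuclideanSpace ℝ (Fin 3) →L[ℝ] ℝ :=
  (X 1 * Y 2 - X 2 * Y 1) • EuclideanSpace.proj 0 +
    (X 2 * Y 0 - X 0 * Y 2) • EuclideanSpace.proj 1 +
    (X 0 * Y 1 - X 1 * Y 0) • EuclideanSpace.proj 2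

lemma detForm_apply (X Y v : EuclideanSpace ℝ (Fin 3)) :
    detForm X Y v = (X 1 * Y 2 - X 2 * Y 1) * v 0 + (X 2 * Y 0 - X 0 * Y 2) * v 1 +
      (X 0 * Y 1 - X 1 * Y 0) * v 2 := rfl

lemma detForm_left (X Y : EuclideanSpace ℝ (Fin 3)) : detForm X Y X = 0 := by
  rw [detForm_apply]; ring

lemma detForm_right (X Y : EuclideanSpace ℝ (Fin 3)) : detForm X Y Y = 0 := by
  rw [detForm_apply]; ring

/-- The coefficients are the `2 × 2` minors of `X, Y`. If they all vanish, then `Y i • X = X i • Y`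
for every `i`, and independence gives `X i = 0`. -/
lemma detForm_ne_zero {X Y : EuclideanSpace ℝ (Fin 3)} (h : LinearIndependent ℝ ![X, Y]) :
    (detForm X Y).toLinearMap ≠ 0 := by
  intro h0
  have e : ∀ v, detForm X Y v = 0 := fun v => LinearMap.congr_fun h0 v
  have e0 := e (EuclideanSpace.single 0 1)
  have e1 := e (EuclideanSpace.single 1 1)
  have e2 := e (EuclideanSpace.single 2 1)
  simp [detForm_apply] at e0 e1 e2
  rw [LinearIndependent.pair_iff] at h
  have key : ∀ i, X i = 0 := by
    intro i
    have := (h (Y i) (-X i) (by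
      ext j
      fin_cases i <;> fin_cases j <;> simp <;> linarith)).2
    linarith
  have := h 1 0 (by ext j; simp [key])
  simp at this

/-- This gives an explicit form, smooth in `X` and `Y`, that turns tangency to the plane into a
scalar equation which can be differentiated. -/
lemma detForm_eq_zero_iff {X Y : EuclideanSpace ℝ (Fin 3)} (h : LinearIndependent ℝ ![X, Y])
    (v : EuclideanSpace ℝ (Fin 3)) : detForm X Y v = 0 ↔ v ∈ Submodule.span ℝ {X, Y} := by
  have h1 := ker_eq_span_of_linearIndependent (n := 2) (by simp) (detForm_ne_zero h) h
    (by intro i; fin_cases i; exacts [detForm_left X Y, detForm_right X Y])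
  rw [← Matrix.range_cons_cons_empty X Y ![], ← h1]
  rfl

lemma contDiffAt_detForm {X Y : E → EuclideanSpace ℝ (Fin 3)} {x : E} {n : WithTop ℕ∞}
    (hX : ContDiffAt ℝ n X x) (hY : ContDiffAt ℝ n Y x) :
    ContDiffAt ℝ n (fun y => detForm (X y) (Y y)) x := by
  have h1 := fun i => contDiffAt_euclidean.1 hX i
  have h2 := fun i => contDiffAt_euclidean.1 hY i
  unfold detForm
  exact (((((h1 1).mul (h2 2)).sub ((h1 2).mul (h2 1))).smul contDiffAt_const).add
    ((((h1 2).mul (h2 0)).sub ((h1 0).mul (h2 2))).smul contDiffAt_const)).add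
    ((((h1 0).mul (h2 1)).sub ((h1 1).mul (h2 0))).smul contDiffAt_const)

end Flat

/-- The local form of the fact that an Engel diffeomorphism preserves the fibres of the
prolongation. -/
theorem fderiv_fibre_eq_zero {A : EuclideanSpace ℝ (Fin 3) × ℝ → EuclideanSpace ℝ (Fin 3)}
    {X Y X' Y' : EuclideanSpace ℝ (Fin 3) → EuclideanSpace ℝ (Fin 3)}
    {p : EuclideanSpace ℝ (Fin 3) × ℝ} (hA : ContDiffAt ℝ ∞ A p) (hX : ContDiffAt ℝ ∞ X p.1)
    (hY : ContDiffAt ℝ ∞ Y p.1) (hX' : ContDiffAt ℝ ∞ X' (A p)) (hY' : ContDiffAt ℝ ∞ Y' (A p))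
    (li : LinearIndependent ℝ ![X p.1, Y p.1]) (li' : LinearIndependent ℝ ![X' (A p), Y' (A p)])
    (contact : VectorField.lieBracket ℝ X' Y' (A p) ∉ Submodule.span ℝ {X' (A p), Y' (A p)})
    (surj : Function.Surjective (fderiv ℝ A p))
    (line : ∀ᶠ q in 𝓝 p, ∃ c s l k : ℝ,
      fderiv ℝ A q (0, 1) = l • (c • X' (A q) + s • Y' (A q)) ∧
      fderiv ℝ A q (Real.cos q.2 • X q.1 + Real.sin q.2 • Y q.1, 0) =
        k • (c • X' (A q) + s • Y' (A q))) :
    fderiv ℝ A p (0, 1) = 0 ∧ fderiv ℝ A p (X p.1, 0) ∈ Submodule.span ℝ {X' (A p), Y' (A p)} ∧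
      fderiv ℝ A p (Y p.1, 0) ∈ Submodule.span ℝ {X' (A p), Y' (A p)} := by
  set α : EuclideanSpace ℝ (Fin 3) → EuclideanSpace ℝ (Fin 3) →L[ℝ] ℝ :=
    fun n => detForm (X' n) (Y' n) with hα
  have αc : ContDiffAt ℝ ∞ α (A p) := contDiffAt_detForm hX' hY'
  have αX : ∀ n, α n (X' n) = 0 := fun n => detForm_left _ _
  have αY : ∀ n, α n (Y' n) = 0 := fun n => detForm_right _ _
  have αl : ∀ n (l c s : ℝ), α n (l • (c • X' n + s • Y' n)) = 0 := fun n l c s => by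
    simp [αX, αY]
  -- smoothness near `p`
  have ev : ∀ᶠ q in 𝓝 p, ContDiffAt ℝ 2 A q ∧ DifferentiableAt ℝ α (A q) ∧
      DifferentiableAt ℝ X q.1 ∧ DifferentiableAt ℝ Y q.1 := by
    have e1 := (hA.of_le (m := 2) (WithTop.coe_le_coe.2 le_top)).eventually (by simp)
    have e2 := hA.continuousAt.eventually
      ((αc.of_le (m := 1) (WithTop.coe_le_coe.2 le_top)).eventually (by simp))
    have e3 := continuous_fst.continuousAt.eventually
      ((hX.of_le (m := 1) (WithTop.coe_le_coe.2 le_top)).eventually (by simp))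
    have e4 := continuous_fst.continuousAt.eventually
      ((hY.of_le (m := 1) (WithTop.coe_le_coe.2 le_top)).eventually (by simp))
    filter_upwards [e1, e2, e3, e4] with q h1 h2 h3 h4
    exact ⟨h1, h2.differentiableAt (by simp), h3.differentiableAt (by simp),
      h4.differentiableAt (by simp)⟩
  have z1 : ∀ᶠ q in 𝓝 p, α (A q) (fderiv ℝ A q (0, 1)) = 0 := by
    filter_upwards [line] with q ⟨c, s, l, k, h, _⟩
    rw [h, αl]
  have z2 : ∀ᶠ q in 𝓝 p, α (A q) (fderiv ℝ A q
      (Real.cos q.2 • X q.1 + Real.sin q.2 • Y q.1, 0)) = 0 := by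
    filter_upwards [line] with q ⟨c, s, l, k, _, h⟩
    rw [h, αl]
  have dfld : ∀ {q : EuclideanSpace ℝ (Fin 3) × ℝ} {Z : EuclideanSpace ℝ (Fin 3) →
      EuclideanSpace ℝ (Fin 3)}, DifferentiableAt ℝ Z q.1 →
      HasFDerivAt (fun q : EuclideanSpace ℝ (Fin 3) × ℝ => Z q.1)
        ((fderiv ℝ Z q.1).comp (ContinuousLinearMap.fst ℝ _ _)) q := fun hZ =>
    hZ.hasFDerivAt.comp _ hasFDerivAt_fst
  -- Cartan's formula for `∂/∂θ` and `u`: their images are collinear, so `dα` vanishes on them, and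
  -- the pulled back form also kills the bracket, which is the `θ`-derivative of `u`. The formula
  -- needs `z1` and `z2` near `q` and not only at `q`.
  have z3 : ∀ᶠ q in 𝓝 p, α (A q) (fderiv ℝ A q
      (-Real.sin q.2 • X q.1 + Real.cos q.2 • Y q.1, 0)) = 0 := by
    filter_upwards [ev, z1.eventually_nhds, z2.eventually_nhds, line]
      with q ⟨a1, a2, a3, a4⟩ h1 h2 ⟨c, s, l, k, l1, l2⟩
    have du : HasFDerivAt (fun q : EuclideanSpace ℝ (Fin 3) × ℝ =>
        ((Real.cos q.2 • X q.1 + Real.sin q.2 • Y q.1, (0 : ℝ)) : EuclideanSpace ℝ (Fin 3) × ℝ)) _ q :=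
      (((((Real.hasDerivAt_cos q.2).hasFDerivAt.comp q
        (hasFDerivAt_snd (p := q))).smul (dfld a3)).add
        (((Real.hasDerivAt_sin q.2).hasFDerivAt.comp q
        (hasFDerivAt_snd (p := q))).smul (dfld a4))).prodMk (hasFDerivAt_const (0 : ℝ) q))
    have := extDerivPair_add_lieBracket (V := fun _ => ((0, 1) : EuclideanSpace ℝ (Fin 3) × ℝ)) a2 a1
      (differentiableAt_const _) du.differentiableAt h1 h2
    rw [l1, l2, smul_add, smul_smul, smul_smul, smul_add, smul_smul, smul_smul,
      extDerivPair_combination, VectorField.lieBracket, du.fderiv] at this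
    simp at this
    rw [show l * c * (k * s) - l * s * (k * c) = 0 by ring, zero_mul, zero_add] at this
    simpa using this
  -- `X` and `Y` are recovered from `u` and its `θ`-derivative by the inverse rotation.
  have zXY : ∀ᶠ q in 𝓝 p, α (A q) (fderiv ℝ A q (X q.1, 0)) = 0 ∧
      α (A q) (fderiv ℝ A q (Y q.1, 0)) = 0 := by
    filter_upwards [z2, z3] with q h2 h3
    have t := Real.cos_sq_add_sin_sq q.2
    constructor
    · have : ((X q.1, 0) : EuclideanSpace ℝ (Fin 3) × ℝ) =
          Real.cos q.2 • (Real.cos q.2 • X q.1 + Real.sin q.2 • Y q.1, 0) -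
          Real.sin q.2 • (-Real.sin q.2 • X q.1 + Real.cos q.2 • Y q.1, 0) := by
        ext1
        · simp only [Prod.fst_sub, Prod.smul_fst]
          linear_combination (norm := module) (-t) • X q.1
        · simp
      rw [this, map_sub, map_smul, map_smul, map_sub, map_smul, map_smul, h2, h3]
      simp
    · have : ((Y q.1, 0) : EuclideanSpace ℝ (Fin 3) × ℝ) =
          Real.sin q.2 • (Real.cos q.2 • X q.1 + Real.sin q.2 • Y q.1, 0) +
          Real.cos q.2 • (-Real.sin q.2 • X q.1 + Real.cos q.2 • Y q.1, 0) := by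
        ext1
        · simp only [Prod.fst_add, Prod.smul_fst]
          linear_combination (norm := module) (-t) • Y q.1
        · simp
      rw [this, map_add, map_smul, map_smul, map_add, map_smul, map_smul, h2, h3]
      simp
  have zX := zXY.mono fun q h => h.1
  have zY := zXY.mono fun q h => h.2
  obtain ⟨a1, a2, a3, a4⟩ := ev.self_of_nhds
  -- Fields lifted from the base commute with `∂/∂θ`, so Cartan's formula leaves only the term with
  -- `dα`.
  have dθ : ∀ {Z : EuclideanSpace ℝ (Fin 3) → EuclideanSpace ℝ (Fin 3)},
      DifferentiableAt ℝ Z p.1 → (∀ᶠ q in 𝓝 p, α (A q) (fderiv ℝ A q (Z q.1, 0)) = 0) →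
      extDerivPair α (A p) (fderiv ℝ A p (0, 1)) (fderiv ℝ A p (Z p.1, 0)) = 0 := by
    intro Z hZ h0
    have dz := (dfld hZ).prodMk (hasFDerivAt_const (0 : ℝ) p)
    have := extDerivPair_add_lieBracket (V := fun _ => ((0, 1) : EuclideanSpace ℝ (Fin 3) × ℝ)) a2 a1
      (differentiableAt_const _) dz.differentiableAt z1 h0
    rw [VectorField.lieBracket, dz.fderiv] at this
    simpa [Prod.mk_zero_zero] using this
  have dX := dθ a3 zX
  have dY := dθ a4 zY
  -- Non-degeneracy of `dα` on the contact plane: Cartan's formula for the identity map relates it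
  -- to `α [X', Y']`, which is non-zero.
  have d0 : extDerivPair α (A p) (X' (A p)) (Y' (A p)) ≠ 0 := by
    intro h0
    have := extDerivPair_add_lieBracket (A := fun x : EuclideanSpace ℝ (Fin 3) => x) a2
      contDiffAt_id (hX'.differentiableAt (by simp)) (hY'.differentiableAt (by simp))
      (by simp [αX]) (by simp [αY])
    simp only [fderiv_fun_id, ContinuousLinearMap.coe_id', id_eq, h0, zero_add] at this
    exact contact ((detForm_eq_zero_iff li' _).1 this)
  have mX := (detForm_eq_zero_iff li' _).1 zX.self_of_nhds
  have mY := (detForm_eq_zero_iff li' _).1 zY.self_of_nhds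
  refine ⟨?_, mX, mY⟩
  obtain ⟨c, s, l, k, h1, -⟩ := line.self_of_nhds
  rw [Submodule.mem_span_pair] at mX mY
  obtain ⟨x, y, hxy⟩ := mX
  obtain ⟨z, w, hzw⟩ := mY
  rw [h1, ← hxy, smul_add, smul_smul, smul_smul, extDerivPair_combination] at dX
  rw [h1, ← hzw, smul_add, smul_smul, smul_smul, extDerivPair_combination] at dY
  have eX := (mul_eq_zero.1 dX).resolve_right d0
  have eY := (mul_eq_zero.1 dY).resolve_right d0
  by_contra hne
  have l0 : l ≠ 0 := by rintro rfl; simp [h1] at hne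
  have fX : c * y = s * x := mul_left_cancel₀ l0 (by linarith)
  have fY : c * w = s * z := mul_left_cancel₀ l0 (by linarith)
  -- A vector of the contact plane transverse to the line of `c X' + s Y'`. Any preimage `t` lies in
  -- the kernel of the pulled back form, hence in the span of `∂/∂θ, X, Y`. If `dA ∂/∂θ` is
  -- non-zero, then by `fX` and `fY` all three map into that line, which is impossible.
  obtain ⟨t, ht⟩ := surj (-s • X' (A p) + c • Y' (A p))
  let β : EuclideanSpace ℝ (Fin 3) × ℝ →ₗ[ℝ] ℝ := ((α (A p)).comp (fderiv ℝ A p)).toLinearMap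
  have hβ : β ≠ 0 := by
    intro h0
    refine detForm_ne_zero li' (LinearMap.ext fun v => ?_)
    obtain ⟨u, rfl⟩ := surj v
    exact LinearMap.congr_fun h0 u
  have li3 : LinearIndependent ℝ ![((0, 1) : EuclideanSpace ℝ (Fin 3) × ℝ), (X p.1, 0), (Y p.1, 0)] := by
    rw [LinearIndependent.pair_iff] at li
    rw [Fintype.linearIndependent_iff]
    intro g hg
    simp only [Fin.sum_univ_three, Matrix.cons_val] at hg
    have g1 := congrArg Prod.fst hg
    have g2 := congrArg Prod.snd hg
    simp at g1 g2
    have := li _ _ g1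
    intro i
    fin_cases i
    exacts [g2, this.1, this.2]
  have ker := ker_eq_span_of_linearIndependent (n := 3) (by simp) hβ li3 (by
    intro i
    fin_cases i
    exacts [z1.self_of_nhds, zX.self_of_nhds, zY.self_of_nhds])
  have tm : t ∈ LinearMap.ker β := by
    change α (A p) (fderiv ℝ A p t) = 0
    rw [ht]
    simp [αX, αY]
  rw [ker, Submodule.mem_span_range_iff_exists_fun] at tm
  obtain ⟨g, hg⟩ := tm
  simp only [Fin.sum_univ_three, Matrix.cons_val] at hg
  rw [← hg, map_add, map_add, map_smul, map_smul, map_smul, h1, ← hxy, ← hzw] at ht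
  have ht2 : (g 0 * l * c + g 1 * x + g 2 * z + s) • X' (A p) +
      (g 0 * l * s + g 1 * y + g 2 * w - c) • Y' (A p) = 0 := by
    linear_combination (norm := module) ht
  rw [LinearIndependent.pair_iff] at li'
  obtain ⟨q1, q2⟩ := li' _ _ ht2
  have : c ^ 2 + s ^ 2 = 0 := by
    linear_combination (-c) * q2 + s * q1 + g 1 * fX + g 2 * fY
  have c0 : c = 0 := by nlinarith
  have s0 : s = 0 := by nlinarith
  simp [h1, c0, s0] at hne

/-! ### Brackets under a change of frame, and the fibre argument on manifolds -/

section Bracket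

variable {M : Type*} [TopologicalSpace M] [ChartedSpace (EuclideanSpace ℝ (Fin 3)) M]
  [IsManifold (𝓡 3) ∞ M] {plane : ∀ m : M, Submodule ℝ (TangentSpace (𝓡 3) m)}
  {X Y X' Y' : ∀ m : M, TangentSpace (𝓡 3) m}

lemma IsSmoothField.mdifferentiableAt (hX : IsSmoothField X) (m : M) :
    MDifferentiableAt (𝓡 3) (𝓡 3).tangent (fun m => (⟨m, X m⟩ : TangentBundle (𝓡 3) M)) m :=
  (hX m).mdifferentiableAt (by simp)

lemma IsFrame.fst_mem (h : IsFrame plane X Y) (m : M) : X m ∈ plane m := by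
  rw [← h.span_eq]; exact Submodule.subset_span (by simp)

lemma IsFrame.snd_mem (h : IsFrame plane X Y) (m : M) : Y m ∈ plane m := by
  rw [← h.span_eq]; exact Submodule.subset_span (by simp)

lemma IsFrame.mem_iff (h : IsFrame plane X Y) {m : M} {v : TangentSpace (𝓡 3) m} :
    v ∈ plane m ↔ ∃ a b : ℝ, a • X m + b • Y m = v := by
  rw [← h.span_eq, Submodule.mem_span_pair]

lemma IsFrame.combination_mem (h : IsFrame plane X Y) (m : M) (a b : ℝ) :
    a • X m + b • Y m ∈ plane m := h.mem_iff.2 ⟨a, b, rfl⟩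

lemma IsFrame.exists_coeff (h : IsFrame plane X Y) {V : ∀ m : M, TangentSpace (𝓡 3) m}
    (hV : ∀ m, V m ∈ plane m) : ∃ a b : M → ℝ, ∀ m, V m = a m • X m + b m • Y m := by
  choose a b hab using fun m => h.mem_iff.1 (hV m)
  exact ⟨a, b, fun m => (hab m).symm⟩

/-- Modulo the plane, the bracket of the frame changes by the determinant of the change of frame. -/
lemma IsFrame.mlieBracket_combination (h : IsFrame plane X Y) {m : M} {a b c d : M → ℝ}
    (ha : MDifferentiableAt (𝓡 3) 𝓘(ℝ, ℝ) a m) (hb : MDifferentiableAt (𝓡 3) 𝓘(ℝ, ℝ) b m)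
    (hc : MDifferentiableAt (𝓡 3) 𝓘(ℝ, ℝ) c m) (hd : MDifferentiableAt (𝓡 3) 𝓘(ℝ, ℝ) d m) :
    VectorField.mlieBracket (𝓡 3) (a • X + b • Y) (c • X + d • Y) m -
      (a m * d m - b m * c m) • VectorField.mlieBracket (𝓡 3) X Y m ∈ plane m := by
  have dX := h.smooth_fst.mdifferentiableAt m
  have dY := h.smooth_snd.mdifferentiableAt m
  have sm : ∀ {f : M → ℝ} {Z : ∀ m : M, TangentSpace (𝓡 3) m},
      MDifferentiableAt (𝓡 3) 𝓘(ℝ, ℝ) f m →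
      MDifferentiableAt (𝓡 3) (𝓡 3).tangent (fun m => (⟨m, Z m⟩ : TangentBundle (𝓡 3) M)) m →
      MDifferentiableAt (𝓡 3) (𝓡 3).tangent (fun m => (⟨m, (f • Z) m⟩ : TangentBundle (𝓡 3) M)) m :=
    fun hf hZ => hf.smul_section hZ
  rw [VectorField.mlieBracket_add_left (sm ha dX) (sm hb dY),
    VectorField.mlieBracket_add_right (sm hc dX) (sm hd dY),
    VectorField.mlieBracket_add_right (sm hc dX) (sm hd dY),
    VectorField.mlieBracket_smul_left ha dX, VectorField.mlieBracket_smul_left ha dX,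
    VectorField.mlieBracket_smul_left hb dY, VectorField.mlieBracket_smul_left hb dY,
    VectorField.mlieBracket_smul_right hc dX, VectorField.mlieBracket_smul_right hc dX,
    VectorField.mlieBracket_smul_right hd dY, VectorField.mlieBracket_smul_right hd dY,
    VectorField.mlieBracket_swap_apply (V := Y) (W := X)]
  simp only [VectorField.mlieBracket_self, Pi.zero_apply, smul_zero, add_zero]
  -- The derivatives of the coefficients in the Leibniz rule only multiply `X` and `Y`, so they
  -- disappear modulo the plane.
  rw [h.mem_iff]
  exact ⟨-(mvfderiv (𝓡 3) a m ((c • X) m)) + a m * (mvfderiv (𝓡 3) c m (X m)) - (mvfderiv (𝓡 3) a m ((d • Y) m)) +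
      b m * (mvfderiv (𝓡 3) c m (Y m)),
    a m * (mvfderiv (𝓡 3) d m (X m)) - (mvfderiv (𝓡 3) b m ((c • X) m)) - (mvfderiv (𝓡 3) b m ((d • Y) m)) + b m * (mvfderiv (𝓡 3) d m (Y m)),
    by module⟩

/-- The change of the frame and its effect on the bracket. -/
lemma IsFrame.exists_change (h : IsFrame plane X Y) (h' : IsFrame plane X' Y') (m : M) :
    ∃ a b c d : ℝ, X' m = a • X m + b • Y m ∧ Y' m = c • X m + d • Y m ∧ a * d - b * c ≠ 0 ∧
      VectorField.mlieBracket (𝓡 3) X' Y' m -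
        (a * d - b * c) • VectorField.mlieBracket (𝓡 3) X Y m ∈ plane m := by
  obtain ⟨a, b, hab⟩ := h.exists_coeff h'.fst_mem
  obtain ⟨c, d, hcd⟩ := h.exists_coeff h'.snd_mem
  obtain ⟨sa, sb⟩ := contMDiffAt_coeff h h'.smooth_fst hab m
  obtain ⟨sc, sd⟩ := contMDiffAt_coeff h h'.smooth_snd hcd m
  refine ⟨a m, b m, c m, d m, hab m, hcd m, fun h0 => ?_, ?_⟩
  · have li := LinearIndependent.pair_iff.1 (h'.linearIndependent m)
    have e1 := li (d m) (-b m) (by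
      rw [hab, hcd]
      linear_combination (norm := module) h0 • X m)
    have e2 := li (c m) (-a m) (by
      rw [hab, hcd]
      linear_combination (norm := module) (-h0) • Y m)
    have := h'.linearIndependent m
    refine (h'.linearIndependent m).ne_zero 0 ?_
    change X' m = 0
    rw [hab, show a m = 0 by linarith [e2.2], show b m = 0 by linarith [e1.2]]
    simp
  · have := h.mlieBracket_combination (sa.mdifferentiableAt (by simp))
      (sb.mdifferentiableAt (by simp)) (sc.mdifferentiableAt (by simp))
      (sd.mdifferentiableAt (by simp))
    rwa [← show X' = a • X + b • Y from funext hab,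
      ← show Y' = c • X + d • Y from funext hcd] at this

/-- The non-integrability does not depend on the frame. -/
lemma ParallelizableContactStructure.mlieBracket_notMem (ξ : ParallelizableContactStructure M)
    (h : IsFrame ξ.plane X Y) (m : M) : VectorField.mlieBracket (𝓡 3) X Y m ∉ ξ.plane m := by
  obtain ⟨X₀, Y₀, h₀, hc⟩ := ξ.exists_frame
  obtain ⟨a, b, c, d, -, -, h0, hm⟩ := h₀.exists_change h m
  intro h1
  refine hc m ?_
  have := (Submodule.sub_mem_iff_right _ h1).1 hm
  exact (Submodule.smul_mem_iff _ h0).1 this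

/-! ### Vector fields in charts -/

/-- The coordinate representation of a vector field in the chart at `x`. -/
def chartField (x : M) (V : ∀ m : M, TangentSpace (𝓡 3) m) :
    EuclideanSpace ℝ (Fin 3) → EuclideanSpace ℝ (Fin 3) :=
  VectorField.mpullbackWithin 𝓘(ℝ, EuclideanSpace ℝ (Fin 3)) (𝓡 3) (extChartAt (𝓡 3) x).symm V
    (Set.range (𝓡 3))

lemma contDiffAt_chartField {V : ∀ m : M, TangentSpace (𝓡 3) m} (hV : IsSmoothField V) (x : M) :
    ContDiffAt ℝ ∞ (chartField x V) (extChartAt (𝓡 3) x x) := by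
  have : IsManifold (𝓡 3) (∞ + 1) M := by simpa
  have h := VectorField.contMDiffWithinAt_mpullbackWithin_extChartAt_symm (n := ∞ + 1) (m := ∞)
    (hV x).contMDiffWithinAt uniqueMDiffOn_univ (Set.mem_univ x) le_rfl
  rw [contMDiffWithinAt_vectorSpace_iff_contDiffWithinAt, Set.preimage_univ, Set.inter_univ] at h
  exact h.contDiffAt ((isOpen_extChartAt_target x).mem_nhds (mem_extChartAt_target x))

lemma chartField_apply (x : M) (V : ∀ m : M, TangentSpace (𝓡 3) m) {y : M}
    (hy : y ∈ (extChartAt (𝓡 3) x).source) :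
    chartField x V (extChartAt (𝓡 3) x y) =
      mfderiv (𝓡 3) 𝓘(ℝ, EuclideanSpace ℝ (Fin 3)) (extChartAt (𝓡 3) x) y (V y) := by
  have e : (V ((extChartAt (𝓡 3) x).symm (extChartAt (𝓡 3) x y)) : EuclideanSpace ℝ (Fin 3)) = V y :=
    congrArg (fun z => (V z : EuclideanSpace ℝ (Fin 3))) ((extChartAt (𝓡 3) x).left_inv hy)
  have h1 := mfderiv_extChartAt_comp_mfderivWithin_extChartAt_symm' hy
  have h2 := mfderivWithin_extChartAt_symm_comp_mfderiv_extChartAt' hy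
  have key : ∀ (T S : EuclideanSpace ℝ (Fin 3) →L[ℝ] EuclideanSpace ℝ (Fin 3))
      (v w : EuclideanSpace ℝ (Fin 3)), T.comp S = .id ℝ _ → S.comp T = .id ℝ _ → v = w →
      T.inverse v = S w := fun T S v w hTS hST hv => by
    rw [ContinuousLinearMap.inverse_eq hTS hST, hv]
  exact key _ _ _ _ h2 h1 e

/-- At the centre of its own chart the derivative of the chart is the identity, so the two brackets
are the same vector without any conversion. -/
lemma mlieBracket_eq_lieBracket_chartField (x : M) (V W : ∀ m : M, TangentSpace (𝓡 3) m) :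
    VectorField.mlieBracket (𝓡 3) V W x =
      VectorField.lieBracket ℝ (chartField x V) (chartField x W) (extChartAt (𝓡 3) x x) := by
  have key : ∀ (T : EuclideanSpace ℝ (Fin 3) →L[ℝ] EuclideanSpace ℝ (Fin 3))
      (v w : EuclideanSpace ℝ (Fin 3)), T = .id ℝ _ → v = w → T.inverse v = w := by
    rintro _ v w rfl rfl
    rw [ContinuousLinearMap.inverse_id]
    rfl
  have hs : (extChartAt (𝓡 3) x).symm ⁻¹' Set.univ ∩ Set.range (𝓡 3) = Set.univ := by
    rw [Set.preimage_univ, ModelWithCorners.range_eq_univ, Set.inter_univ]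
  refine key _ _ _ mfderiv_extChartAt_self ?_
  change VectorField.lieBracketWithin ℝ (chartField x V) (chartField x W) _ _ = _
  rw [hs, VectorField.lieBracketWithin_univ]

lemma LinearIndependent.pair_map_of_injective {E F : Type*} [AddCommGroup E] [Module ℝ E]
    [AddCommGroup F] [Module ℝ F] {u v : E} (h : LinearIndependent ℝ ![u, v]) {T : E →ₗ[ℝ] F}
    (hT : Function.Injective T) : LinearIndependent ℝ ![T u, T v] := by
  have := h.map' T (LinearMap.ker_eq_bot.2 hT)
  rwa [show T ∘ ![u, v] = ![T u, T v] by funext i; fin_cases i <;> rfl] at this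

variable {ξ : ParallelizableContactStructure M}

/-- Suppose that the derivative of `A` maps, at all points near `p`, both the fibre direction and
the Engel direction into a common line of the contact plane, and that it is surjective at `p`. Then
it annihilates the fibre direction and preserves the contact planes. -/
theorem mfderiv_fibre_eq_zero {A : M × ℝ → M} {p : M × ℝ}
    (hA : ContMDiffAt ((𝓡 3).prod 𝓘(ℝ, ℝ)) (𝓡 3) ∞ A p) (h : IsFrame ξ.plane X Y)
    (h' : IsFrame ξ.plane X' Y')
    (surj : Function.Surjective (mfderiv ((𝓡 3).prod 𝓘(ℝ, ℝ)) (𝓡 3) A p))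
    (line : ∀ᶠ q in 𝓝 p, ∃ c s l k : ℝ,
      mfderiv ((𝓡 3).prod 𝓘(ℝ, ℝ)) (𝓡 3) A q ((0, 1) : EuclideanSpace ℝ (Fin 3) × ℝ) =
        l • (c • X' (A q) + s • Y' (A q)) ∧
      mfderiv ((𝓡 3).prod 𝓘(ℝ, ℝ)) (𝓡 3) A q
        ((Real.cos q.2 • X q.1 + Real.sin q.2 • Y q.1, 0) : EuclideanSpace ℝ (Fin 3) × ℝ) =
        k • (c • X' (A q) + s • Y' (A q))) :
    mfderiv ((𝓡 3).prod 𝓘(ℝ, ℝ)) (𝓡 3) A p ((0, 1) : EuclideanSpace ℝ (Fin 3) × ℝ) = 0 ∧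
      mfderiv ((𝓡 3).prod 𝓘(ℝ, ℝ)) (𝓡 3) A p ((X p.1, 0) : EuclideanSpace ℝ (Fin 3) × ℝ) ∈
        ξ.plane (A p) ∧
      mfderiv ((𝓡 3).prod 𝓘(ℝ, ℝ)) (𝓡 3) A p ((Y p.1, 0) : EuclideanSpace ℝ (Fin 3) × ℝ) ∈
        ξ.plane (A p) := by
  set e := extChartAt (𝓡 3) p.1 with he
  set e' := extChartAt (𝓡 3) (A p) with he'
  let B : EuclideanSpace ℝ (Fin 3) × ℝ → EuclideanSpace ℝ (Fin 3) :=
    fun q => e' (A (e.symm q.1, q.2))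
  let lift : EuclideanSpace ℝ (Fin 3) × ℝ → M × ℝ := fun q => (e.symm q.1, q.2)
  let p' : EuclideanSpace ℝ (Fin 3) × ℝ := (e p.1, p.2)
  have lp : lift p' = p := Prod.ext (e.left_inv (mem_extChartAt_source p.1)) rfl
  have lift_smooth : ContMDiffAt 𝓘(ℝ, EuclideanSpace ℝ (Fin 3) × ℝ) ((𝓡 3).prod 𝓘(ℝ, ℝ)) ∞
      lift p' := by
    have h1 : ContMDiffAt 𝓘(ℝ, EuclideanSpace ℝ (Fin 3)) (𝓡 3) ∞ e.symm p'.1 :=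
      (contMDiffOn_extChartAt_symm p.1).contMDiffAt
        ((isOpen_extChartAt_target p.1).mem_nhds (mem_extChartAt_target p.1))
    exact (h1.comp p' contDiff_fst.contMDiff.contMDiffAt).prodMk
      contDiff_snd.contMDiff.contMDiffAt
  have hB : ContDiffAt ℝ ∞ B p' := by
    rw [← contMDiffAt_iff_contDiffAt]
    have h2 : ContMDiffAt (𝓡 3) 𝓘(ℝ, EuclideanSpace ℝ (Fin 3)) ∞ e' (A (lift p')) := by
      rw [lp]; exact contMDiffAt_extChartAt
    have h3 : ContMDiffAt ((𝓡 3).prod 𝓘(ℝ, ℝ)) (𝓡 3) ∞ A (lift p') := by rwa [lp]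
    exact h2.comp p' (h3.comp p' lift_smooth)
  -- the derivative of `B`
  have dB : ∀ {z : M × ℝ}, z.1 ∈ e.source → A z ∈ e'.source →
      MDifferentiableAt ((𝓡 3).prod 𝓘(ℝ, ℝ)) (𝓡 3) A z →
      DifferentiableAt ℝ B (e z.1, z.2) → ∀ (u : EuclideanSpace ℝ (Fin 3)) (t : ℝ),
      fderiv ℝ B (e z.1, z.2)
        ((mfderiv (𝓡 3) 𝓘(ℝ, EuclideanSpace ℝ (Fin 3)) e z.1 u : EuclideanSpace ℝ (Fin 3)), t) =
      mfderiv (𝓡 3) 𝓘(ℝ, EuclideanSpace ℝ (Fin 3)) e' (A z)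
        (mfderiv ((𝓡 3).prod 𝓘(ℝ, ℝ)) (𝓡 3) A z ((u, t) : EuclideanSpace ℝ (Fin 3) × ℝ)) := by
    intro z hz hAz dA dBz u t
    have hz' := hz
    have hAz' := hAz
    rw [he, extChartAt_source] at hz'
    rw [he', extChartAt_source] at hAz'
    have c1 : HasMFDerivAt ((𝓡 3).prod 𝓘(ℝ, ℝ)) 𝓘(ℝ, EuclideanSpace ℝ (Fin 3)) (e' ∘ A) z _ :=
      HasMFDerivAt.comp z (mdifferentiableAt_extChartAt hAz').hasMFDerivAt dA.hasMFDerivAt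
    let D : EuclideanSpace ℝ (Fin 3) →L[ℝ] EuclideanSpace ℝ (Fin 3) :=
      mfderiv (𝓡 3) 𝓘(ℝ, EuclideanSpace ℝ (Fin 3)) e z.1
    have c2 : HasMFDerivAt ((𝓡 3).prod 𝓘(ℝ, ℝ)) 𝓘(ℝ, EuclideanSpace ℝ (Fin 3) × ℝ)
        (fun w : M × ℝ => (e w.1, w.2)) z
        ((D.comp (ContinuousLinearMap.fst ℝ _ ℝ)).prod (ContinuousLinearMap.snd ℝ _ ℝ)) := by
      rw [modelWithCornersSelf_prod, ← chartedSpaceSelf_prod]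
      exact HasMFDerivAt.prodMk (HasMFDerivAt.comp (I' := 𝓡 3) z
        (mdifferentiableAt_extChartAt hz').hasMFDerivAt (hasMFDerivAt_fst z)) (hasMFDerivAt_snd z)
    have c3 : HasMFDerivAt ((𝓡 3).prod 𝓘(ℝ, ℝ)) 𝓘(ℝ, EuclideanSpace ℝ (Fin 3))
        (B ∘ fun w : M × ℝ => (e w.1, w.2)) z _ :=
      HasMFDerivAt.comp z dBz.hasFDerivAt.hasMFDerivAt c2
    -- Differentiating `B ∘ (e × id) = e' ∘ A` on `M × ℝ`, instead of `B` itself, avoids the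
    -- derivative of the inverse chart.
    have ev : (B ∘ fun w : M × ℝ => (e w.1, w.2)) =ᶠ[𝓝 z] e' ∘ A := by
      filter_upwards [continuous_fst.continuousAt.preimage_mem_nhds
        ((isOpen_extChartAt_source p.1).mem_nhds hz)] with w hw
      have : e.symm (e w.1) = w.1 := e.left_inv hw
      simp only [B, Function.comp_apply, this]
    have := hasMFDerivAt_unique (c1.congr_of_eventuallyEq ev) c3
    exact (congrArg (fun T : EuclideanSpace ℝ (Fin 3) × ℝ →L[ℝ] EuclideanSpace ℝ (Fin 3) =>
      T (u, t)) this).symm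
  have inj : ∀ {x y : M}, y ∈ (extChartAt (𝓡 3) x).source →
      Function.Bijective (mfderiv (𝓡 3) 𝓘(ℝ, EuclideanSpace ℝ (Fin 3)) (extChartAt (𝓡 3) x) y) :=
    fun hy => (isInvertible_mfderiv_extChartAt hy).bijective
  have s0 : p.1 ∈ e.source := mem_extChartAt_source p.1
  have s0' : A p ∈ e'.source := mem_extChartAt_source (A p)
  have Bp : B p' = e' (A p) := by
    change e' (A (lift p')) = _
    rw [lp]
  have field : ∀ (V : ∀ m : M, TangentSpace (𝓡 3) m) {x y : M},
      y ∈ (extChartAt (𝓡 3) x).source → chartField x V (extChartAt (𝓡 3) x y) =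
      mfderiv (𝓡 3) 𝓘(ℝ, EuclideanSpace ℝ (Fin 3)) (extChartAt (𝓡 3) x) y (V y) :=
    fun V {x y} hy => chartField_apply x V hy
  have li : ∀ {X Y : ∀ m : M, TangentSpace (𝓡 3) m}, IsFrame ξ.plane X Y → ∀ x : M,
      LinearIndependent ℝ ![chartField x X (extChartAt (𝓡 3) x x),
        chartField x Y (extChartAt (𝓡 3) x x)] := by
    intro X Y h x
    rw [field X (mem_extChartAt_source x), field Y (mem_extChartAt_source x)]
    exact LinearIndependent.pair_map_of_injective (h.linearIndependent x)
      (T := (mfderiv (𝓡 3) 𝓘(ℝ, EuclideanSpace ℝ (Fin 3)) (extChartAt (𝓡 3) x) x).toLinearMap)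
      (inj (mem_extChartAt_source x)).1
  -- at the centre of a chart, the derivative of the chart is the identity
  have self : ∀ (V : ∀ m : M, TangentSpace (𝓡 3) m) (x : M),
      chartField x V (extChartAt (𝓡 3) x x) = V x := by
    intro V x
    rw [field V (mem_extChartAt_source x)]
    exact congrArg (fun T : EuclideanSpace ℝ (Fin 3) →L[ℝ] EuclideanSpace ℝ (Fin 3) => T (V x))
      mfderiv_extChartAt_self
  have dBp : ∀ (u : EuclideanSpace ℝ (Fin 3)) (t : ℝ), fderiv ℝ B p' (u, t) =
      mfderiv ((𝓡 3).prod 𝓘(ℝ, ℝ)) (𝓡 3) A p ((u, t) : EuclideanSpace ℝ (Fin 3) × ℝ) := by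
    intro u t
    have h1 := dB s0 s0' (hA.mdifferentiableAt (by simp)) (hB.differentiableAt (by simp)) u t
    have h2 : (mfderiv (𝓡 3) 𝓘(ℝ, EuclideanSpace ℝ (Fin 3)) e p.1 u : EuclideanSpace ℝ (Fin 3)) = u :=
      congrArg (fun T : EuclideanSpace ℝ (Fin 3) →L[ℝ] EuclideanSpace ℝ (Fin 3) => T u)
        mfderiv_extChartAt_self
    rw [h2] at h1
    refine h1.trans ?_
    exact congrArg (fun T : EuclideanSpace ℝ (Fin 3) →L[ℝ] EuclideanSpace ℝ (Fin 3) => T _)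
        mfderiv_extChartAt_self
  have flat := fderiv_fibre_eq_zero (A := B) (X := chartField p.1 X) (Y := chartField p.1 Y)
    (X' := chartField (A p) X') (Y' := chartField (A p) Y') (p := p') hB
    (contDiffAt_chartField h.smooth_fst _) (contDiffAt_chartField h.smooth_snd _)
    (by rw [Bp]; exact contDiffAt_chartField h'.smooth_fst _)
    (by rw [Bp]; exact contDiffAt_chartField h'.smooth_snd _) (li h _)
    (by rw [Bp]; exact li h' _)
    (by
      rw [Bp, ← mlieBracket_eq_lieBracket_chartField, self, self]
      have := ξ.mlieBracket_notMem h' (A p)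
      rw [← h'.span_eq] at this
      exact this)
    (by
      intro v
      obtain ⟨w, hw⟩ := surj v
      exact ⟨w, (dBp w.1 w.2).trans hw⟩)
    (by
      -- Off the centre the chart derivatives are not the identity. The condition at a nearby point
      -- is the image of the given one under the derivative of the target chart, with the same `c,
      -- s, l, k`.
      have tl : Tendsto lift (𝓝 p') (𝓝 p) := by
        have := lift_smooth.continuousAt.tendsto
        rwa [lp] at this
      have e1 : ∀ᶠ q in 𝓝 p', q.1 ∈ e.target := continuous_fst.continuousAt.preimage_mem_nhds
        ((isOpen_extChartAt_target p.1).mem_nhds (mem_extChartAt_target p.1))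
      have e2 : ∀ᶠ z in 𝓝 p, A z ∈ e'.source := hA.continuousAt.preimage_mem_nhds
        ((isOpen_extChartAt_source (A p)).mem_nhds s0')
      have e3 : ∀ᶠ z in 𝓝 p, ContMDiffAt ((𝓡 3).prod 𝓘(ℝ, ℝ)) (𝓡 3) 1 A z :=
        (contMDiffAt_iff_contMDiffAt_nhds (by simp)).1 (hA.of_le (WithTop.coe_le_coe.2 le_top))
      have e4 : ∀ᶠ q in 𝓝 p', ContDiffAt ℝ 1 B q :=
        (hB.of_le (m := 1) (WithTop.coe_le_coe.2 le_top)).eventually (by simp)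
      filter_upwards [e1, tl.eventually e2, tl.eventually e3, e4, tl.eventually line]
        with q q1 q2 q3 q4 ⟨c, s, l, k, l1, l2⟩
      refine ⟨c, s, l, k, ?_⟩
      have hq : (e (lift q).1, (lift q).2) = q := Prod.ext (e.right_inv q1) rfl
      have sq : (lift q).1 ∈ e.source := e.map_target q1
      have d := dB sq q2 (q3.mdifferentiableAt (by simp))
        (by rw [hq]; exact q4.differentiableAt (by simp))
      rw [hq] at d
      have fX := field X sq
      have fY := field Y sq
      have fX' := field X' q2
      have fY' := field Y' q2
      rw [show extChartAt (𝓡 3) p.1 (lift q).1 = q.1 from e.right_inv q1] at fX fY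
      change chartField (A p) X' (B q) = _ at fX'
      change chartField (A p) Y' (B q) = _ at fY'
      rw [fX', fY', fX, fY]
      have lin : ∀ (T : EuclideanSpace ℝ (Fin 3) →L[ℝ] EuclideanSpace ℝ (Fin 3)) (l c s : ℝ)
          (x y : EuclideanSpace ℝ (Fin 3)), T (l • (c • x + s • y)) = l • (c • T x + s • T y) :=
        fun T l c s x y => by simp
      have lin1 : ∀ (T : EuclideanSpace ℝ (Fin 3) →L[ℝ] EuclideanSpace ℝ (Fin 3)) (c s : ℝ)
          (x y : EuclideanSpace ℝ (Fin 3)), T (c • x + s • y) = c • T x + s • T y :=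
        fun T c s x y => by simp
      constructor
      · have := d 0 1
        refine Eq.trans ?_ ((this.trans (congrArg _ l1)).trans (lin _ _ _ _ _ _))
        exact congrArg (fun v : EuclideanSpace ℝ (Fin 3) => fderiv ℝ B q (v, 1)) (map_zero _).symm
      · have := d (Real.cos q.2 • X (lift q).1 + Real.sin q.2 • Y (lift q).1) 0
        refine Eq.trans ?_ ((this.trans (congrArg _ l2)).trans (lin _ _ _ _ _ _))
        exact congrArg (fun v : EuclideanSpace ℝ (Fin 3) => fderiv ℝ B q (v, 0))
          (lin1 _ _ _ _ _).symm)
  rw [dBp, dBp, dBp, Bp, self, self, self, self] at flat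
  exact ⟨flat.1, (h'.span_eq (A p)).le flat.2.1, (h'.span_eq (A p)).le flat.2.2⟩

end Bracket

/-! ### Angular coordinates on the prolongation -/

section Coordinates

variable {M : Type*} [TopologicalSpace M] [ChartedSpace (EuclideanSpace ℝ (Fin 3)) M]
  [IsManifold (𝓡 3) ∞ M] {ξ : ParallelizableContactStructure M}
  {X Y : ∀ m : M, TangentSpace (𝓡 3) m}

/-- The model of `M × ℝ`. -/
abbrev stripModel : ModelWithCorners ℝ (EuclideanSpace ℝ (Fin 3) × ℝ)
    (ModelProd (EuclideanSpace ℝ (Fin 3)) ℝ) := (𝓡 3).prod 𝓘(ℝ, ℝ)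

/-- The direction of `cos θ • X m + sin θ • Y m`. -/
def IsFrame.direction (h : IsFrame ξ.plane X Y) (p : M × ℝ) : OrientedProlongation ξ :=
  angleDir (h.basis p.1) p.2

/-- The angle of a direction with respect to the frame. -/
def IsFrame.angle (h : IsFrame ξ.plane X Y) (q : OrientedProlongation ξ) : ℝ :=
  Complex.arg ((trivialization h q).2 : ℂ)

lemma IsFrame.direction_eq (h : IsFrame ξ.plane X Y) (p : M × ℝ) :
    h.direction p = (trivialization h).symm (p.1, Circle.exp p.2) := rfl

lemma IsFrame.trivialization_fst (h : IsFrame ξ.plane X Y) (q : OrientedProlongation ξ) :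
    (trivialization h q).1 = q.base := by
  conv_rhs => rw [← (trivialization h).symm_apply_apply q]
  rfl

@[simp]
lemma IsFrame.direction_angle (h : IsFrame ξ.plane X Y) (q : OrientedProlongation ξ) :
    h.direction (q.base, h.angle q) = q := by
  rw [h.direction_eq, Equiv.symm_apply_eq, IsFrame.angle, Circle.exp_arg, ← h.trivialization_fst]

lemma IsFrame.angle_direction (h : IsFrame ξ.plane X Y) {p : M × ℝ}
    (hp : p.2 ∈ Set.Ioc (-Real.pi) Real.pi) : h.angle (h.direction p) = p.2 := by
  rw [h.direction_eq, IsFrame.angle, Equiv.apply_symm_apply, Circle.arg_exp hp.1 hp.2]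

lemma IsFrame.angle_mem (h : IsFrame ξ.plane X Y) (q : OrientedProlongation ξ) :
    h.angle q ∈ Set.Ioc (-Real.pi) Real.pi :=
  ⟨Complex.neg_pi_lt_arg _, Complex.arg_le_pi _⟩

lemma IsFrame.contMDiff_direction (h : IsFrame ξ.plane X Y) :
    ContMDiff stripModel model ∞ h.direction :=
  (contMDiff_trivialization_symm h).comp
    (contMDiff_fst.prodMk (contMDiff_circleExp.comp contMDiff_snd))

lemma contMDiff_base :
    ContMDiff model (𝓡 3) ∞ (OrientedProlongation.base : OrientedProlongation ξ → M) :=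
  contMDiff_fst.comp (contMDiff_someHomeomorph (ξ := ξ)) |>.congr fun q =>
    (IsFrame.trivialization_fst ξ.exists_frame.choose_spec.choose_spec.1 q).symm

lemma contDiffAt_arg {z : ℂ} (hz : z ∈ Complex.slitPlane) : ContDiffAt ℝ ∞ Complex.arg z := by
  have h : ContDiffAt ℝ ∞ Complex.log z := (Complex.contDiffAt_log hz).restrict_scalars ℝ
  refine (Complex.imCLM.contDiff.contDiffAt.comp z h).congr_of_eventuallyEq (.of_forall fun w => ?_)
  exact (Complex.log_im w).symm

/-- `arg` is smooth off its cut, the directions of angle `π`. In an adapted frame the angles of an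
Engel domain lie in `[0, π/2]`, away from the cut. -/
lemma IsFrame.contMDiffAt_angle (h : IsFrame ξ.plane X Y) {q : OrientedProlongation ξ}
    (hq : h.angle q ≠ Real.pi) : ContMDiffAt model 𝓘(ℝ, ℝ) ∞ h.angle q := by
  have := finrank_real_complex_fact'
  have hz : ((trivialization h q).2 : ℂ) ∈ Complex.slitPlane :=
    Complex.mem_slitPlane_iff_arg.2 ⟨hq, Circle.coe_ne_zero _⟩
  have h1 : ContMDiff model 𝓘(ℝ, ℂ) ∞
      (fun q : OrientedProlongation ξ => ((trivialization h q).2 : ℂ)) :=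
    (contMDiff_coe_sphere (E := ℂ) (n := 1)).comp
      (contMDiff_snd.comp (contMDiff_trivialization h))
  exact (contDiffAt_arg hz).contMDiffAt.comp q (h1 q)

/-- The derivative of the angular coordinates. -/
def IsFrame.directionDeriv (h : IsFrame ξ.plane X Y) (p : M × ℝ) :
    EuclideanSpace ℝ (Fin 3) × ℝ →L[ℝ] TangentSpace model (h.direction p) :=
  mfderiv stripModel model h.direction p

/-- The derivative of the angle. -/
def IsFrame.angleDeriv (h : IsFrame ξ.plane X Y) (q : OrientedProlongation ξ) :
    TangentSpace model q →L[ℝ] ℝ :=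
  mfderiv model 𝓘(ℝ, ℝ) h.angle q

lemma IsFrame.hasMFDerivAt_direction (h : IsFrame ξ.plane X Y) (p : M × ℝ) :
    HasMFDerivAt stripModel model h.direction p (h.directionDeriv p) :=
  (h.contMDiff_direction.mdifferentiable (by simp) p).hasMFDerivAt

lemma hasMFDerivAt_base (q : OrientedProlongation ξ) :
    HasMFDerivAt model (𝓡 3) (OrientedProlongation.base : OrientedProlongation ξ → M) q
      (projDeriv q) :=
  (contMDiff_base.mdifferentiable (by simp) q).hasMFDerivAt

lemma IsFrame.hasMFDerivAt_angle (h : IsFrame ξ.plane X Y) {q : OrientedProlongation ξ}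
    (hq : h.angle q ≠ Real.pi) : HasMFDerivAt model 𝓘(ℝ, ℝ) h.angle q (h.angleDeriv q) :=
  ((h.contMDiffAt_angle hq).mdifferentiableAt (by simp)).hasMFDerivAt

lemma IsFrame.projDeriv_directionDeriv (h : IsFrame ξ.plane X Y) (p : M × ℝ)
    (v : EuclideanSpace ℝ (Fin 3) × ℝ) :
    projDeriv (h.direction p) (h.directionDeriv p v) = v.1 := by
  have h1 := (hasMFDerivAt_base (h.direction p)).comp p (h.hasMFDerivAt_direction p)
  have h2 : HasMFDerivAt stripModel (𝓡 3) (Prod.fst : M × ℝ → M) p _ := hasMFDerivAt_fst p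
  exact congrArg (fun T : EuclideanSpace ℝ (Fin 3) × ℝ →L[ℝ] EuclideanSpace ℝ (Fin 3) => T v)
    (hasMFDerivAt_unique h1 h2)

/-- The interval is open because the angle must invert `direction` on a neighbourhood, and it jumps
at `π`. -/
lemma IsFrame.angleDeriv_directionDeriv (h : IsFrame ξ.plane X Y) {p : M × ℝ}
    (hp : p.2 ∈ Set.Ioo (-Real.pi) Real.pi) (v : EuclideanSpace ℝ (Fin 3) × ℝ) :
    h.angleDeriv (h.direction p) (h.directionDeriv p v) = v.2 := by
  have e : h.angle (h.direction p) ≠ Real.pi := by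
    rw [h.angle_direction (Set.Ioo_subset_Ioc_self hp)]; exact hp.2.ne
  have h1 := (h.hasMFDerivAt_angle e).comp p (h.hasMFDerivAt_direction p)
  have h2 : HasMFDerivAt stripModel 𝓘(ℝ, ℝ) (Prod.snd : M × ℝ → ℝ) p _ := hasMFDerivAt_snd p
  have ev : (Prod.snd : M × ℝ → ℝ) =ᶠ[𝓝 p] h.angle ∘ h.direction := by
    filter_upwards [continuous_snd.continuousAt.preimage_mem_nhds (isOpen_Ioo.mem_nhds hp)] with z hz
    exact (h.angle_direction (Set.Ioo_subset_Ioc_self hz)).symm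
  exact congrArg (fun T : EuclideanSpace ℝ (Fin 3) × ℝ →L[ℝ] ℝ => T v)
    (hasMFDerivAt_unique (h1.congr_of_eventuallyEq ev) h2)

/-- The derivatives of the base point and of the angle recover both components of a vector, which
gives injectivity; both spaces have dimension four. -/
lemma IsFrame.directionDeriv_bijective (h : IsFrame ξ.plane X Y) {p : M × ℝ}
    (hp : p.2 ∈ Set.Ioo (-Real.pi) Real.pi) : Function.Bijective (h.directionDeriv p) := by
  have inj : Function.Injective (h.directionDeriv p).toLinearMap := by
    rw [← LinearMap.ker_eq_bot, LinearMap.ker_eq_bot']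
    intro v hv
    change h.directionDeriv p v = 0 at hv
    have h1 := h.projDeriv_directionDeriv p v
    have h2 := h.angleDeriv_directionDeriv hp v
    rw [hv, map_zero] at h1 h2
    exact Prod.ext h1.symm h2.symm
  have : FiniteDimensional ℝ (TangentSpace model (h.direction p)) :=
    inferInstanceAs (FiniteDimensional ℝ (EuclideanSpace ℝ (Fin 3) × EuclideanSpace ℝ (Fin 1)))
  have fr : Module.finrank ℝ (EuclideanSpace ℝ (Fin 3) × ℝ) =
      Module.finrank ℝ (TangentSpace model (h.direction p)) := by
    trans Module.finrank ℝ (EuclideanSpace ℝ (Fin 3) × EuclideanSpace ℝ (Fin 1))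
    · simp
    · rfl
  exact ⟨inj, (LinearMap.injective_iff_surjective_of_finrank_eq_finrank fr).1 inj⟩

/-- Tangent vectors of the prolongation in angular coordinates. -/
lemma IsFrame.directionDeriv_proj_angle (h : IsFrame ξ.plane X Y) {p : M × ℝ}
    (hp : p.2 ∈ Set.Ioo (-Real.pi) Real.pi) (w : TangentSpace model (h.direction p)) :
    h.directionDeriv p ((projDeriv (h.direction p) w : EuclideanSpace ℝ (Fin 3)),
      h.angleDeriv (h.direction p) w) = w := by
  obtain ⟨v, rfl⟩ := (h.directionDeriv_bijective hp).2 w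
  rw [h.angleDeriv_directionDeriv hp]
  exact congrArg (fun u : EuclideanSpace ℝ (Fin 3) => h.directionDeriv p (u, v.2))
    (h.projDeriv_directionDeriv p v)

/-- The vector `cos θ • X m + sin θ • Y m`. -/
def IsFrame.vector (_h : IsFrame ξ.plane X Y) (p : M × ℝ) : TangentSpace (𝓡 3) p.1 :=
  Real.cos p.2 • X p.1 + Real.sin p.2 • Y p.1

lemma IsFrame.complexEquiv_coe (h : IsFrame ξ.plane X Y) (m : M) (z : ℂ) :
    (complexEquiv (h.basis m) z : TangentSpace (𝓡 3) m) = z.re • X m + z.im • Y m := by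
  rw [complexEquiv_apply, Submodule.coe_add, Submodule.coe_smul, Submodule.coe_smul, h.basis_zero,
    h.basis_one]

lemma IsFrame.complexEquiv_exp (h : IsFrame ξ.plane X Y) (p : M × ℝ) :
    (complexEquiv (h.basis p.1) (Circle.exp p.2 : ℂ) : TangentSpace (𝓡 3) p.1) = h.vector p := by
  rw [h.complexEquiv_coe, Circle.coe_exp, Complex.exp_ofReal_mul_I_re, Complex.exp_ofReal_mul_I_im]
  rfl

lemma pointsAlong_iff {m : M} (u : ξ.plane m) (hu : u ≠ 0) (v : TangentSpace (𝓡 3) m) :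
    PointsAlong (rayOfNeZero ℝ u hu) v ↔ ∃ r : ℝ, 0 < r ∧ v = r • (u : TangentSpace (𝓡 3) m) := by
  constructor
  · rintro ⟨hv, h0, e⟩
    rw [ray_eq_iff] at e
    obtain ⟨r, hr, e⟩ := e.symm.exists_pos_left hu h0
    exact ⟨r, hr, (congrArg Subtype.val e).symm⟩
  · rintro ⟨r, hr, rfl⟩
    exact ⟨Submodule.smul_mem _ _ u.2, smul_ne_zero hr.ne' hu,
      (ray_eq_iff _ _).2 (SameRay.sameRay_pos_smul_left u hr)⟩

lemma span_pointsAlong {m : M} (u : ξ.plane m) (hu : u ≠ 0) :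
    Submodule.span ℝ {v | PointsAlong (rayOfNeZero ℝ u hu) v} =
      Submodule.span ℝ {(u : TangentSpace (𝓡 3) m)} := by
  apply le_antisymm
  · rw [Submodule.span_le]
    intro v hv
    obtain ⟨r, -, e⟩ := (pointsAlong_iff u hu v).1 hv
    exact Submodule.mem_span_singleton.2 ⟨r, e.symm⟩
  · rw [Submodule.span_singleton_le_iff_mem]
    exact Submodule.subset_span ((pointsAlong_iff u hu _).2 ⟨1, one_pos, (one_smul _ _).symm⟩)

lemma IsFrame.pointsAlong_direction_iff (h : IsFrame ξ.plane X Y) (p : M × ℝ)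
    (v : TangentSpace (𝓡 3) p.1) :
    PointsAlong (h.direction p).dir v ↔ ∃ r : ℝ, 0 < r ∧ v = r • h.vector p := by
  refine (pointsAlong_iff (complexEquiv (h.basis p.1) (Circle.exp p.2 : ℂ)) _ v).trans ?_
  rw [h.complexEquiv_exp]

/-- The ray spans the line of `h.vector p`, so membership becomes one equation on the projection;
all later work with Engel planes goes through it. -/
lemma IsFrame.mem_engelPlane_iff (h : IsFrame ξ.plane X Y) (p : M × ℝ)
    (w : TangentSpace model (h.direction p)) :
    w ∈ engelPlane (h.direction p) ↔ ∃ r : ℝ, projDeriv (h.direction p) w = r • h.vector p := by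
  have hu := (complexEquiv (h.basis p.1)).map_ne_zero_iff.2 (Circle.exp p.2).coe_ne_zero
  have e := span_pointsAlong _ hu
  rw [h.complexEquiv_exp] at e
  have key : ∀ v : TangentSpace (𝓡 3) p.1, v ∈ Submodule.span ℝ {v | PointsAlong
      (rayOfNeZero ℝ _ hu) v} ↔ ∃ r : ℝ, v = r • h.vector p := fun v => by
    rw [e, Submodule.mem_span_singleton]
    exact exists_congr fun r => eq_comm
  exact key _

/-- The direction of a combination of the frame, with the angle given as an argument. -/
lemma IsFrame.direction_arg (h : IsFrame ξ.plane X Y) (m : M) {z : ℂ} (hz : z ≠ 0) :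
    h.direction (m, Complex.arg z) = ⟨m, rayOfNeZero ℝ (complexEquiv (h.basis m) z)
      ((complexEquiv (h.basis m)).map_ne_zero_iff.2 hz)⟩ := by
  simp only [IsFrame.direction, angleDir, circleDir, OrientedProlongation.mk.injEq, heq_eq_eq,
    true_and]
  rw [ray_eq_iff, SameRay.sameRay_map_iff]
  have : z = (‖z‖ : ℝ) • (Circle.exp (Complex.arg z) : ℂ) := by
    rw [Circle.coe_exp, Complex.real_smul, Complex.norm_mul_exp_arg_mul_I]
  conv_rhs => rw [this]
  exact SameRay.sameRay_nonneg_smul_right _ (norm_nonneg z)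

end Coordinates

/-! ### Frames adapted to a pair of direction fields -/

section Adapted

variable {M : Type*} [TopologicalSpace M] [ChartedSpace (EuclideanSpace ℝ (Fin 3)) M]
  [IsManifold (𝓡 3) ∞ M] {ξ : ParallelizableContactStructure M}
  {X Y : ∀ m : M, TangentSpace (𝓡 3) m} {V₀ V₁ : LegendrianField ξ}

/-- The frame represents the pair of direction fields. -/
def IsFrame.Adapted (h : IsFrame ξ.plane X Y) (V₀ V₁ : LegendrianField ξ) : Prop :=
  ∀ m, V₀.Represented V₁ (h.basis m)

/-- A Legendrian direction field is represented by a smooth vector field. -/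
lemma LegendrianField.exists_field (V : LegendrianField ξ) :
    ∃ Z : ∀ m : M, TangentSpace (𝓡 3) m, IsSmoothField Z ∧
      ∀ m, ∃ (hm : Z m ∈ ξ.plane m) (h0 : (⟨Z m, hm⟩ : ξ.plane m) ≠ 0),
        rayOfNeZero ℝ ⟨Z m, hm⟩ h0 = V.dir m := by
  obtain ⟨X, Y, h, -⟩ := ξ.exists_frame
  have := finrank_real_complex_fact'
  let z : M → ℂ := fun m => ((trivialization h ⟨m, V.dir m⟩).2 : ℂ)
  have hz : ContMDiff (𝓡 3) 𝓘(ℝ, ℂ) ∞ z :=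
    (contMDiff_coe_sphere (E := ℂ) (n := 1)).comp
      (contMDiff_snd.comp ((contMDiff_trivialization h).comp V.smooth))
  have hre : ContMDiff (𝓡 3) 𝓘(ℝ, ℝ) ∞ (fun m => (z m).re) :=
    Complex.reCLM.contDiff.contMDiff.comp hz
  have him : ContMDiff (𝓡 3) 𝓘(ℝ, ℝ) ∞ (fun m => (z m).im) :=
    Complex.imCLM.contDiff.contMDiff.comp hz
  refine ⟨(fun m => (z m).re) • X + (fun m => (z m).im) • Y,
    (hre.smul_section h.smooth_fst).add_section (him.smul_section h.smooth_snd), fun m => ?_⟩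
  have e : ((complexEquiv (h.basis m) (z m) : ξ.plane m) : TangentSpace (𝓡 3) m) =
      ((fun m => (z m).re) • X + (fun m => (z m).im) • Y) m := h.complexEquiv_coe m (z m)
  have hm : ((fun m => (z m).re) • X + (fun m => (z m).im) • Y) m ∈ ξ.plane m := by
    rw [← e]; exact Subtype.coe_prop _
  have e2 : (⟨_, hm⟩ : ξ.plane m) = complexEquiv (h.basis m) (z m) := Subtype.ext e.symm
  have h0 : (⟨_, hm⟩ : ξ.plane m) ≠ 0 := by
    rw [e2]
    exact (complexEquiv (h.basis m)).map_ne_zero_iff.2 (Circle.coe_ne_zero _)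
  refine ⟨hm, h0, ?_⟩
  have e3 : circleDir (h.basis m) (trivialization h ⟨m, V.dir m⟩).2 = ⟨m, V.dir m⟩ := by
    have e4 := (trivialization h).symm_apply_apply ⟨m, V.dir m⟩
    have e5 : trivialization h ⟨m, V.dir m⟩ = (m, (trivialization h ⟨m, V.dir m⟩).2) :=
      Prod.ext (h.trivialization_fst _) rfl
    rw [e5] at e4
    exact e4
  simp only [circleDir, OrientedProlongation.mk.injEq, heq_eq_eq, true_and] at e3
  rw [← e3]
  congr 1

lemma IsFrame.finrank_plane (h : IsFrame ξ.plane X Y) (m : M) : Module.finrank ℝ (ξ.plane m) = 2 := by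
  simpa using Module.finrank_eq_card_basis (h.basis m)

/-- Smooth representatives of nowhere collinear directions are independent and span by dimension. In
such a frame `V₀` and `V₁` have the constant angles `0` and `π/2`. -/
lemma exists_adapted_frame (hV : V₀.NeverCollinear V₁) :
    ∃ (X Y : ∀ m : M, TangentSpace (𝓡 3) m) (h : IsFrame ξ.plane X Y), h.Adapted V₀ V₁ := by
  obtain ⟨X, sX, hX⟩ := V₀.exists_field
  obtain ⟨Y, sY, hY⟩ := V₁.exists_field
  have li : ∀ m, LinearIndependent ℝ ![X m, Y m] := by
    intro m
    obtain ⟨mX, X0, eX⟩ := hX m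
    obtain ⟨mY, Y0, eY⟩ := hY m
    have : LinearIndependent ℝ ![(⟨X m, mX⟩ : ξ.plane m), ⟨Y m, mY⟩] := by
      by_contra hli
      rw [← sameRay_or_sameRay_neg_iff_not_linearIndependent] at hli
      rcases hli with hs | hs
      · exact (hV m).1 (by rw [← eX, ← eY]; exact (ray_eq_iff _ _).2 hs)
      · refine (hV m).2 ?_
        rw [← eX, ← eY, neg_rayOfNeZero]
        exact (ray_eq_iff _ _).2 hs
    exact LinearIndependent.pair_map_of_injective this (T := (ξ.plane m).subtype)
      Subtype.val_injective
  have sp : ∀ m, Submodule.span ℝ {X m, Y m} = ξ.plane m := by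
    intro m
    obtain ⟨X', Y', h', -⟩ := ξ.exists_frame
    have : FiniteDimensional ℝ (ξ.plane m) := (h'.basis m).finiteDimensional_of_finite
    refine Submodule.eq_of_le_of_finrank_eq ?_ ?_
    · rw [Submodule.span_le]
      rintro _ (rfl | rfl)
      exacts [(hX m).1, (hY m).1]
    · rw [h'.finrank_plane, ← Matrix.range_cons_cons_empty (X m) (Y m) ![],
        finrank_span_eq_card (li m), Fintype.card_fin]
  refine ⟨X, Y, ⟨sX, sY, li, sp⟩, fun m => ⟨?_, ?_⟩⟩
  · obtain ⟨mX, X0, eX⟩ := hX m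
    rw [← eX]
    congr 1
    exact Subtype.ext (IsFrame.basis_zero _ m)
  · obtain ⟨mY, Y0, eY⟩ := hY m
    rw [← eY]
    congr 1
    exact Subtype.ext (IsFrame.basis_one _ m)

variable {h : IsFrame ξ.plane X Y}

/-- Vectors on the same ray differ by a positive factor, so a pair that represents the directions is
unique up to two positive scalings. -/
lemma IsFrame.Adapted.exists_scale (ha : h.Adapted V₀ V₁) {m : M}
    {e : Module.Basis (Fin 2) ℝ (ξ.plane m)} (he : V₀.Represented V₁ e) :
    ∃ r s : ℝ, 0 < r ∧ 0 < s ∧ e 0 = r • h.basis m 0 ∧ e 1 = s • h.basis m 1 := by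
  obtain ⟨r, hr, er⟩ := ((ray_eq_iff _ _).1 (he.1.trans (ha m).1.symm)).symm.exists_pos_left
    ((h.basis m).ne_zero 0) (e.ne_zero 0)
  obtain ⟨s, hs, es⟩ := ((ray_eq_iff _ _).1 (he.2.trans (ha m).2.symm)).symm.exists_pos_left
    ((h.basis m).ne_zero 1) (e.ne_zero 1)
  exact ⟨r, s, hr, hs, er.symm, es.symm⟩

/-- The combination `r cos θ + i s sin θ`. -/
def ellipse (r s θ : ℝ) : ℂ := ⟨r * Real.cos θ, s * Real.sin θ⟩

lemma ellipse_ne_zero {r s : ℝ} (hr : 0 < r) (hs : 0 < s) (θ : ℝ) : ellipse r s θ ≠ 0 := by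
  intro h0
  have h1 := congrArg Complex.re h0
  have h2 := congrArg Complex.im h0
  simp only [ellipse, Complex.zero_re, Complex.zero_im, mul_eq_zero, hr.ne', hs.ne', false_or] at h1 h2
  have := Real.cos_sq_add_sin_sq θ
  simp [h1, h2] at this

/-- The unit circle of the scaled basis is an ellipse in the frame, and the new angle is the
argument of its point. -/
lemma angleDir_eq_direction {m : M} {e : Module.Basis (Fin 2) ℝ (ξ.plane m)} {r s : ℝ} (hr : 0 < r)
    (hs : 0 < s) (e0 : e 0 = r • h.basis m 0) (e1 : e 1 = s • h.basis m 1) (θ : ℝ) :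
    angleDir e θ = h.direction (m, Complex.arg (ellipse r s θ)) := by
  rw [h.direction_arg m (ellipse_ne_zero hr hs θ)]
  simp only [angleDir, circleDir, OrientedProlongation.mk.injEq, heq_eq_eq, true_and]
  congr 1
  rw [complexEquiv_apply, complexEquiv_apply, e0, e1, smul_smul, smul_smul, Circle.coe_exp,
    Complex.exp_ofReal_mul_I_re, Complex.exp_ofReal_mul_I_im]
  simp only [ellipse, mul_comm]

lemma arg_mem_Icc_iff {z : ℂ} :
    Complex.arg z ∈ Set.Icc 0 (Real.pi / 2) ↔ 0 ≤ z.re ∧ 0 ≤ z.im := by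
  rw [Set.mem_Icc, Complex.arg_nonneg_iff, and_comm]
  constructor
  · rintro ⟨h1, h2⟩
    refine ⟨Complex.abs_arg_le_pi_div_two_iff.1 (abs_le.2 ⟨?_, h1⟩), h2⟩
    have := Complex.arg_nonneg_iff.2 h2
    linarith [Real.pi_pos]
  · rintro ⟨h1, h2⟩
    exact ⟨(abs_le.1 (Complex.abs_arg_le_pi_div_two_iff.2 h1)).2, h2⟩

lemma Icc_subset_Ioo_pi : Set.Icc 0 (Real.pi / 2) ⊆ Set.Ioo (-Real.pi) Real.pi :=
  fun x hx => ⟨by linarith [hx.1, Real.pi_pos], by linarith [hx.2, Real.pi_pos]⟩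

lemma IsFrame.angle_direction_of_mem_Icc (h : IsFrame ξ.plane X Y) {p : M × ℝ}
    (hp : p.2 ∈ Set.Icc 0 (Real.pi / 2)) : h.angle (h.direction p) = p.2 :=
  h.angle_direction (Set.Ioo_subset_Ioc_self (Icc_subset_Ioo_pi hp))

/-- Positive scalings of the two axes preserve the closed first quadrant, so the representing
vectors do not matter and the domain becomes `M × [0, π/2]`. -/
lemma IsFrame.Adapted.mem_engelDomain_iff (ha : h.Adapted V₀ V₁) {q : OrientedProlongation ξ} :
    q ∈ V₀.engelDomain V₁ ↔ h.angle q ∈ Set.Icc 0 (Real.pi / 2) := by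
  constructor
  · rintro ⟨e, he, θ, hθ, hq⟩
    obtain ⟨r, s, hr, hs, e0, e1⟩ := ha.exists_scale he
    rw [← hq, angleDir_eq_direction hr hs e0 e1, h.angle_direction
      ⟨Complex.neg_pi_lt_arg _, Complex.arg_le_pi _⟩, arg_mem_Icc_iff]
    exact ⟨mul_nonneg hr.le (Real.cos_nonneg_of_mem_Icc ⟨by linarith [hθ.1, Real.pi_pos], hθ.2⟩),
      mul_nonneg hs.le (Real.sin_nonneg_of_mem_Icc ⟨hθ.1, by linarith [hθ.2, Real.pi_pos]⟩)⟩
  · intro hq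
    exact ⟨h.basis q.base, ha _, h.angle q, hq, h.direction_angle q⟩

lemma IsFrame.Adapted.direction_mem (ha : h.Adapted V₀ V₁) {p : M × ℝ}
    (hp : p.2 ∈ Set.Icc 0 (Real.pi / 2)) : h.direction p ∈ V₀.engelDomain V₁ := by
  rw [ha.mem_engelDomain_iff, h.angle_direction_of_mem_Icc hp]
  exact hp

lemma IsFrame.Adapted.exists_eq_direction (ha : h.Adapted V₀ V₁) {q : OrientedProlongation ξ}
    (hq : q ∈ V₀.engelDomain V₁) :
    ∃ p : M × ℝ, p.2 ∈ Set.Icc 0 (Real.pi / 2) ∧ h.direction p = q :=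
  ⟨(q.base, h.angle q), ha.mem_engelDomain_iff.1 hq, h.direction_angle q⟩

lemma IsFrame.Adapted.engelDomain_eq (ha : h.Adapted V₀ V₁) :
    V₀.engelDomain V₁ = h.direction '' (Set.univ ×ˢ Set.Icc 0 (Real.pi / 2)) := by
  ext q
  constructor
  · intro hq
    obtain ⟨p, hp, rfl⟩ := ha.exists_eq_direction hq
    exact ⟨p, ⟨Set.mem_univ _, hp⟩, rfl⟩
  · rintro ⟨p, hp, rfl⟩
    exact ha.direction_mem hp.2

/-- `direction` has surjective derivatives and maps `M × [0, π/2]` onto the domain. Uniqueness of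
derivatives within the domain allows chain rules to be compared at boundary points as well. -/
lemma uniqueMDiffOn_engelDomain (hV : V₀.NeverCollinear V₁) :
    UniqueMDiffOn model (V₀.engelDomain V₁) := by
  obtain ⟨X, Y, h, ha⟩ := exists_adapted_frame hV
  have h1 : UniqueMDiffOn stripModel ((Set.univ : Set M) ×ˢ Set.Icc 0 (Real.pi / 2)) :=
    uniqueMDiffOn_univ.prod (uniqueDiffOn_Icc (by positivity)).uniqueMDiffOn
  rw [ha.engelDomain_eq]
  refine h1.image_denseRange' (fun p _ => (h.hasMFDerivAt_direction p).hasMFDerivWithinAt)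
    fun p hp => ?_
  exact (h.directionDeriv_bijective (Icc_subset_Ioo_pi hp.2)).2.denseRange

/-! ### The vectors that orient the fibres -/

/-- The derivative of `arg z` is the imaginary part of `z' / z`, here `r s / |z|²`. -/
lemma deriv_arg_ellipse {r s : ℝ} (hr : 0 < r) (hs : 0 < s) {θ : ℝ}
    (hθ : ellipse r s θ ∈ Complex.slitPlane) :
    ∃ t : ℝ, 0 < t ∧ HasDerivAt (fun x => Complex.arg (ellipse r s x)) t θ := by
  have h1 : HasDerivAt (fun x : ℝ => ((r * Real.cos x : ℝ) : ℂ) + ((s * Real.sin x : ℝ) : ℂ) * Complex.I)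
      (((r * -Real.sin θ : ℝ) : ℂ) + ((s * Real.cos θ : ℝ) : ℂ) * Complex.I) θ :=
    ((Real.hasDerivAt_cos θ).const_mul r).ofReal_comp.add
      (((Real.hasDerivAt_sin θ).const_mul s).ofReal_comp.mul_const _)
  have eq : ∀ x, ellipse r s x = ((r * Real.cos x : ℝ) : ℂ) + ((s * Real.sin x : ℝ) : ℂ) * Complex.I :=
    fun x => Complex.mk_eq_add_mul_I _ _
  rw [← funext eq] at h1
  have h2 := h1.clog_real hθ
  have h3 := (Complex.imCLM.hasFDerivAt.comp_hasDerivAt θ h2)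
  refine ⟨_, ?_, h3.congr_of_eventuallyEq (.of_forall fun x => (Complex.log_im _).symm)⟩
  have hn : 0 < Complex.normSq (ellipse r s θ) := Complex.normSq_pos.2 (ellipse_ne_zero hr hs θ)
  have hc := Real.cos_sq_add_sin_sq θ
  rw [← Complex.mk_eq_add_mul_I, Complex.imCLM_apply, Complex.div_im, ← sub_div]
  refine div_pos ?_ hn
  simp only [ellipse]
  have : 0 < r * s := mul_pos hr hs
  nlinarith

/-- Rescaling the representing vectors reparametrizes the fibre increasingly, so the definition of
the fibre orientation by arbitrary representatives is consistent. -/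
lemma IsFrame.Adapted.isThetaVector_pos (ha : h.Adapted V₀ V₁)
    {w : TangentBundle model (OrientedProlongation ξ)} (hw : V₀.IsThetaVector V₁ w)
    (hm : w.1 ∈ V₀.engelDomain V₁) : projDeriv w.1 w.2 = 0 ∧ 0 < h.angleDeriv w.1 w.2 := by
  obtain ⟨m, e, θ, he, rfl⟩ := hw
  obtain ⟨r, s, hr, hs, e0, e1⟩ := ha.exists_scale he
  have ed := angleDir_eq_direction hr hs e0 e1
  have an : ∀ x, h.angle (angleDir e x) = Complex.arg (ellipse r s x) := fun x => by
    rw [ed, h.angle_direction ⟨Complex.neg_pi_lt_arg _, Complex.arg_le_pi _⟩]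
  change angleDir e θ ∈ _ at hm
  rw [ha.mem_engelDomain_iff] at hm
  have npi : h.angle (angleDir e θ) ≠ Real.pi := (Icc_subset_Ioo_pi hm).2.ne
  obtain ⟨t, ht, dt⟩ := deriv_arg_ellipse hr hs
    (Complex.mem_slitPlane_iff_arg.2 ⟨by rw [← an]; exact npi, ellipse_ne_zero hr hs θ⟩)
  have dA : MDifferentiableAt 𝓘(ℝ, ℝ) model (angleDir e) θ := by
    have h1 : MDifferentiableAt 𝓘(ℝ, ℝ) stripModel
        (fun x => ((m, Complex.arg (ellipse r s x)) : M × ℝ)) θ :=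
      mdifferentiableAt_const.prodMk dt.differentiableAt.mdifferentiableAt
    have h2 := (h.hasMFDerivAt_direction (m, Complex.arg (ellipse r s θ))).mdifferentiableAt.comp θ h1
    rwa [show h.direction ∘ (fun x => ((m, Complex.arg (ellipse r s x)) : M × ℝ)) = angleDir e from
      (funext ed).symm] at h2
  constructor
  · have h1 := (hasMFDerivAt_base (angleDir e θ)).comp θ dA.hasMFDerivAt
    have h2 : HasMFDerivAt 𝓘(ℝ, ℝ) (𝓡 3) (fun _ : ℝ => m) θ _ := hasMFDerivAt_const m θ
    exact congrArg (fun T : ℝ →L[ℝ] EuclideanSpace ℝ (Fin 3) => T 1) (hasMFDerivAt_unique h1 h2)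
  · have h1 := (h.hasMFDerivAt_angle npi).comp θ dA.hasMFDerivAt
    rw [show h.angle ∘ angleDir e = fun x => Complex.arg (ellipse r s x) from funext an] at h1
    have h2 := hasMFDerivAt_unique h1 dt.hasFDerivAt.hasMFDerivAt
    have h3 := congrArg (fun T : ℝ →L[ℝ] ℝ => T 1) h2
    refine lt_of_lt_of_eq ht (Eq.trans ?_ h3.symm)
    simp

lemma IsFrame.Adapted.isThetaVector_directionDeriv (ha : h.Adapted V₀ V₁) (p : M × ℝ) :
    V₀.IsThetaVector V₁ ⟨h.direction p, h.directionDeriv p (0, 1)⟩ := by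
  refine ⟨p.1, h.basis p.1, p.2, ha p.1, ?_⟩
  have h1 : HasMFDerivAt 𝓘(ℝ, ℝ) stripModel (fun x : ℝ => ((p.1, x) : M × ℝ)) p.2 _ :=
    (hasMFDerivAt_const p.1 p.2).prodMk (hasMFDerivAt_id p.2)
  have h2 := (h.hasMFDerivAt_direction p).comp p.2 h1
  have h3 : mfderiv 𝓘(ℝ, ℝ) model (angleDir (h.basis p.1)) p.2 = _ := h2.mfderiv
  rw [h3]
  rfl

end Adapted

/-! ### Determinants of triangular families -/

section Determinants

variable {E F : Type*} [AddCommGroup E] [Module ℝ E] [AddCommGroup F] [Module ℝ F]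

/-- The matrix of `v` has first column `(t, 0, …, 0)`, and the complementary minor is the matrix of
the projected vectors. -/
lemma det_of_projection {n : ℕ} (e : Module.Basis (Fin (n + 1)) ℝ E) (f : Module.Basis (Fin n) ℝ F)
    (P : E →ₗ[ℝ] F) (h0 : P (e 0) = 0) (hs : ∀ i : Fin n, P (e i.succ) = f i) {v : Fin (n + 1) → E}
    {t : ℝ} (hv : v 0 = t • e 0) : e.det v = t * f.det (fun i => P (v i.succ)) := by
  have key : ∀ (w : E) (i : Fin n), f.repr (P w) i = e.repr w i.succ := by
    intro w i
    have e1 : P w = ∑ j : Fin n, e.repr w j.succ • f j := by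
      conv_lhs => rw [← e.sum_repr w, Fin.sum_univ_succ, map_add, map_smul, h0, smul_zero, zero_add,
        map_sum]
      simp only [map_smul, hs]
    rw [e1, f.repr_sum_self]
  rw [Module.Basis.det_apply, Matrix.det_succ_column_zero, Fin.sum_univ_succ, Module.Basis.det_apply]
  have z : ∀ i : Fin n, e.toMatrix v i.succ 0 = 0 := fun i => by
    simp [Module.Basis.toMatrix_apply, hv, Fin.succ_ne_zero]
  have o : e.toMatrix v 0 0 = t := by simp [Module.Basis.toMatrix_apply, hv]
  simp only [z, o, mul_zero, zero_mul, Finset.sum_const_zero, add_zero, Fin.val_zero, pow_zero, one_mul]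
  congr 2
  ext i j
  simp [Module.Basis.toMatrix_apply, key]

lemma det_fin_two_triangular (e : Module.Basis (Fin 2) ℝ E) {v : Fin 2 → E} {t x y : ℝ}
    (h0 : v 0 = t • e 0) (h1 : v 1 = x • e 0 + y • e 1) : e.det v = t * y := by
  rw [Module.Basis.det_apply, Matrix.det_fin_two]
  simp [Module.Basis.toMatrix_apply, h0, h1]

lemma det_fin_three_block (e : Module.Basis (Fin 3) ℝ E) {v : Fin 3 → E} {a b c d x y z : ℝ}
    (h0 : v 0 = a • e 0 + b • e 1) (h1 : v 1 = c • e 0 + d • e 1)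
    (h2 : v 2 = x • e 0 + y • e 1 + z • e 2) : e.det v = (a * d - b * c) * z := by
  rw [Module.Basis.det_apply, Matrix.det_fin_three]
  simp [Module.Basis.toMatrix_apply, h0, h1, h2]
  ring

end Determinants

section Orientation

variable {M : Type*} [TopologicalSpace M] [ChartedSpace (EuclideanSpace ℝ (Fin 3)) M]
  [IsManifold (𝓡 3) ∞ M] {ξ : ParallelizableContactStructure M}
  {X Y X' Y' : ∀ m : M, TangentSpace (𝓡 3) m} {V₀ V₁ W₀ W₁ : LegendrianField ξ}

/-! ### The contact orientation -/

/-- A relation with a non-zero coefficient at the bracket would put the bracket into the plane. -/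
lemma IsFrame.linearIndependent_contact (h : IsFrame ξ.plane X Y) (m : M) :
    LinearIndependent ℝ ![X m, Y m, VectorField.mlieBracket (𝓡 3) Y X m] := by
  rw [Fintype.linearIndependent_iff]
  intro g hg
  simp only [Fin.sum_univ_three, Matrix.cons_val] at hg
  have g2 : g 2 = 0 := by
    by_contra h2
    refine ξ.mlieBracket_notMem h m ?_
    rw [VectorField.mlieBracket_swap_apply, Submodule.neg_mem_iff, ← Submodule.smul_mem_iff _ h2,
      ← (Submodule.add_mem_iff_right _ (h.combination_mem m (g 0) (g 1))), hg]
    exact Submodule.zero_mem _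
  rw [g2, zero_smul, add_zero] at hg
  have := LinearIndependent.pair_iff.1 (h.linearIndependent m) _ _ hg
  intro i
  fin_cases i
  exacts [this.1, this.2, g2]

/-- The basis `X, Y, [Y, X]`. -/
def IsFrame.contactBasis (h : IsFrame ξ.plane X Y) (m : M) :
    Module.Basis (Fin 3) ℝ (TangentSpace (𝓡 3) m) :=
  basisOfLinearIndependentOfCardEqFinrank (h.linearIndependent_contact m)
    (by
      have : Module.finrank ℝ (EuclideanSpace ℝ (Fin 3)) = 3 := by simp
      exact this.symm)

lemma IsFrame.contactBasis_apply (h : IsFrame ξ.plane X Y) (m : M) :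
    ⇑(h.contactBasis m) = ![X m, Y m, VectorField.mlieBracket (𝓡 3) Y X m] :=
  coe_basisOfLinearIndependentOfCardEqFinrank _ _

lemma IsFrame.contactBasis_zero (h : IsFrame ξ.plane X Y) (m : M) : h.contactBasis m 0 = X m := by
  rw [h.contactBasis_apply]; rfl

lemma IsFrame.contactBasis_one (h : IsFrame ξ.plane X Y) (m : M) : h.contactBasis m 1 = Y m := by
  rw [h.contactBasis_apply]; rfl

lemma IsFrame.contactBasis_two (h : IsFrame ξ.plane X Y) (m : M) :
    h.contactBasis m 2 = VectorField.mlieBracket (𝓡 3) Y X m := by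
  rw [h.contactBasis_apply]; rfl

/-- A change of frame with determinant `δ` also multiplies the bracket by `δ` modulo the plane, so
the total determinant is `δ²`. This is why `ξ` orients `M` even when `δ` is negative. -/
lemma IsFrame.contactBasis_orientation_eq (h : IsFrame ξ.plane X Y) (h' : IsFrame ξ.plane X' Y')
    (m : M) : (h.contactBasis m).orientation = (h'.contactBasis m).orientation := by
  rw [Module.Basis.orientation_eq_iff_det_pos]
  obtain ⟨a, b, c, d, hX, hY, h0, hb⟩ := h.exists_change h' m
  obtain ⟨x, y, hxy⟩ := h.mem_iff.1 hb
  rw [det_fin_three_block (h.contactBasis m) (a := a) (b := b) (c := c) (d := d) (x := -x) (y := -y)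
    (z := a * d - b * c)]
  · exact mul_self_pos.2 h0
  · rw [h'.contactBasis_zero, h.contactBasis_zero, h.contactBasis_one, hX]
  · rw [h'.contactBasis_one, h.contactBasis_zero, h.contactBasis_one, hY]
  · rw [h'.contactBasis_two, h.contactBasis_zero, h.contactBasis_one, h.contactBasis_two,
      VectorField.mlieBracket_swap_apply, VectorField.mlieBracket_swap_apply (V := Y)]
    linear_combination (norm := module) hxy

lemma IsFrame.isContactPositive_iff (h : IsFrame ξ.plane X Y) {m : M}
    (c : Module.Basis (Fin 3) ℝ (TangentSpace (𝓡 3) m)) :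
    IsContactPositive ξ c ↔ c.orientation = (h.contactBasis m).orientation := by
  constructor
  · rintro ⟨X', Y', h', c', h0, h1, h2, hc⟩
    rw [hc, h.contactBasis_orientation_eq h' m]
    congr 1
    refine Module.Basis.eq_of_apply_eq fun i => ?_
    fin_cases i
    · exact h0.trans (h'.contactBasis_zero m).symm
    · exact h1.trans (h'.contactBasis_one m).symm
    · exact h2.trans (h'.contactBasis_two m).symm
  · intro hc
    exact ⟨X, Y, h, h.contactBasis m, h.contactBasis_zero m, h.contactBasis_one m,
      h.contactBasis_two m, hc⟩

/-! ### Images of frames under contact diffeomorphisms -/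

/-- The image of a vector field under a diffeomorphism. -/
def pushField (φ : Diffeomorph (𝓡 3) (𝓡 3) M M ∞) (Z : ∀ m : M, TangentSpace (𝓡 3) m) :
    ∀ m : M, TangentSpace (𝓡 3) m :=
  VectorField.mpullback (𝓡 3) (𝓡 3) φ.symm Z

section Push

variable (φ : Diffeomorph (𝓡 3) (𝓡 3) M M ∞)

omit [IsManifold (𝓡 3) ∞ M] in
lemma mfderiv_comp_symm (m : M) :
    (∀ v : EuclideanSpace ℝ (Fin 3), (mfderiv (𝓡 3) (𝓡 3) φ.symm (φ m)
      (mfderiv (𝓡 3) (𝓡 3) φ m v) : EuclideanSpace ℝ (Fin 3)) = v) ∧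
    ∀ v : EuclideanSpace ℝ (Fin 3), (mfderiv (𝓡 3) (𝓡 3) φ m
      (mfderiv (𝓡 3) (𝓡 3) φ.symm (φ m) v : EuclideanSpace ℝ (Fin 3)) : EuclideanSpace ℝ (Fin 3)) = v := by
  have d1 : HasMFDerivAt (𝓡 3) (𝓡 3) φ m _ := (φ.mdifferentiable (by simp) m).hasMFDerivAt
  have d2 : HasMFDerivAt (𝓡 3) (𝓡 3) φ.symm (φ m) _ :=
    (φ.symm.mdifferentiable (by simp) (φ m)).hasMFDerivAt
  have d1' : HasMFDerivAt (𝓡 3) (𝓡 3) φ (φ.symm (φ m)) (mfderiv (𝓡 3) (𝓡 3) φ (φ.symm (φ m))) :=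
    (φ.mdifferentiable (by simp) _).hasMFDerivAt
  have c1 := d2.comp m d1
  have c2 := d1'.comp (φ m) d2
  have i1 : φ.symm ∘ φ = id := funext φ.symm_apply_apply
  have i2 : φ ∘ φ.symm = id := funext φ.apply_symm_apply
  rw [i1] at c1
  rw [i2] at c2
  have u1 := hasMFDerivAt_unique c1 (hasMFDerivAt_id m)
  have u2 := hasMFDerivAt_unique c2 (hasMFDerivAt_id (φ m))
  -- All tangent spaces are the same model space; `D` forgets their base points, so that `φ.symm (φ
  -- m) = m` can be applied to the derivative.
  let D : M → EuclideanSpace ℝ (Fin 3) →L[ℝ] EuclideanSpace ℝ (Fin 3) :=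
    fun x => mfderiv (𝓡 3) (𝓡 3) φ x
  have e : D (φ.symm (φ m)) = D m := congrArg D (φ.symm_apply_apply m)
  refine ⟨fun v => ?_, fun v => ?_⟩
  · exact congrArg (fun T : EuclideanSpace ℝ (Fin 3) →L[ℝ] EuclideanSpace ℝ (Fin 3) => T v) u1
  · refine Eq.trans ?_
      (congrArg (fun T : EuclideanSpace ℝ (Fin 3) →L[ℝ] EuclideanSpace ℝ (Fin 3) => T v) u2)
    exact congrArg (fun T : EuclideanSpace ℝ (Fin 3) →L[ℝ] EuclideanSpace ℝ (Fin 3) =>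
      T (mfderiv (𝓡 3) (𝓡 3) φ.symm (φ m) v)) e.symm

omit [IsManifold (𝓡 3) ∞ M] in
lemma mfderiv_symm_isInvertible (n : M) : (mfderiv (𝓡 3) (𝓡 3) φ.symm n).IsInvertible := by
  obtain ⟨m, rfl⟩ : ∃ m, φ m = n := ⟨φ.symm n, φ.apply_symm_apply n⟩
  refine ContinuousLinearMap.IsInvertible.of_inverse
    (g := (mfderiv (𝓡 3) (𝓡 3) φ m : EuclideanSpace ℝ (Fin 3) →L[ℝ] EuclideanSpace ℝ (Fin 3))) ?_ ?_
  · exact ContinuousLinearMap.ext (mfderiv_comp_symm φ m).1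
  · exact ContinuousLinearMap.ext (mfderiv_comp_symm φ m).2

omit [IsManifold (𝓡 3) ∞ M] in
lemma pushField_apply (Z : ∀ m : M, TangentSpace (𝓡 3) m) (m : M) :
    pushField φ Z (φ m) = mfderiv (𝓡 3) (𝓡 3) φ m (Z m) := by
  have key : ∀ (T S : EuclideanSpace ℝ (Fin 3) →L[ℝ] EuclideanSpace ℝ (Fin 3))
      (v w : EuclideanSpace ℝ (Fin 3)), (∀ x, S (T x) = x) → (∀ x, T (S x) = x) → v = w →
      T.inverse v = S w := fun T S v w hTS hST hv => by
    rw [ContinuousLinearMap.inverse_eq (ContinuousLinearMap.ext hST) (ContinuousLinearMap.ext hTS), hv]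
  exact key _ _ _ _ (mfderiv_comp_symm φ m).2 (mfderiv_comp_symm φ m).1
    (congrArg (fun x => (Z x : EuclideanSpace ℝ (Fin 3))) (φ.symm_apply_apply m))

lemma isSmoothField_pushField {Z : ∀ m : M, TangentSpace (𝓡 3) m} (hZ : IsSmoothField Z) :
    IsSmoothField (pushField φ Z) := by
  have : IsManifold (𝓡 3) (∞ + 1) M := by simpa
  exact ContMDiff.mpullback_vectorField (n := ∞) (m := ∞) hZ φ.symm.contMDiff
    (mfderiv_symm_isInvertible φ) (by simp)

lemma mlieBracket_pushField {Z W : ∀ m : M, TangentSpace (𝓡 3) m} (hZ : IsSmoothField Z)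
    (hW : IsSmoothField W) (m : M) :
    VectorField.mlieBracket (𝓡 3) (pushField φ Z) (pushField φ W) (φ m) =
      mfderiv (𝓡 3) (𝓡 3) φ m (VectorField.mlieBracket (𝓡 3) Z W m) := by
  have : IsManifold (𝓡 3) (minSmoothness ℝ 3) M := by
    rw [minSmoothness_of_isRCLikeNormedField]
    exact IsManifold.of_le (n := ∞) (WithTop.coe_le_coe.2 le_top)
  rw [← pushField_apply]
  refine (VectorField.mpullback_mlieBracket (n := ∞) (hZ.mdifferentiableAt _) (hW.mdifferentiableAt _)
    φ.symm.contMDiff.contMDiffAt ?_).symm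
  rw [minSmoothness_of_isRCLikeNormedField]
  exact WithTop.coe_le_coe.2 le_top

variable {φ}

omit [IsManifold (𝓡 3) ∞ M] in
lemma mfderiv_diffeo_bijective (φ : Diffeomorph (𝓡 3) (𝓡 3) M M ∞) (m : M) :
    Function.Bijective (mfderiv (𝓡 3) (𝓡 3) φ m) :=
  ⟨Function.LeftInverse.injective (mfderiv_comp_symm φ m).1,
    Function.RightInverse.surjective (mfderiv_comp_symm φ m).2⟩

lemma IsFrame.push (h : IsFrame ξ.plane X Y) (hφ : IsContactDiffeo ξ φ) :
    IsFrame ξ.plane (pushField φ X) (pushField φ Y) where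
  smooth_fst := isSmoothField_pushField φ h.smooth_fst
  smooth_snd := isSmoothField_pushField φ h.smooth_snd
  linearIndependent n := by
    obtain ⟨m, rfl⟩ : ∃ m, φ m = n := ⟨φ.symm n, φ.apply_symm_apply n⟩
    rw [pushField_apply, pushField_apply]
    exact LinearIndependent.pair_map_of_injective (h.linearIndependent m)
      (T := (mfderiv (𝓡 3) (𝓡 3) φ m).toLinearMap) (mfderiv_diffeo_bijective φ m).1
  span_eq n := by
    obtain ⟨m, rfl⟩ : ∃ m, φ m = n := ⟨φ.symm n, φ.apply_symm_apply n⟩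
    rw [pushField_apply, pushField_apply, ← hφ m, ← h.span_eq, Submodule.map_span, Set.image_pair]
    rfl

/-- Contact diffeomorphisms preserve the contact orientation. -/
lemma IsFrame.det_contactBasis_pos (h : IsFrame ξ.plane X Y) (h' : IsFrame ξ.plane X' Y')
    (hφ : IsContactDiffeo ξ φ) (m : M) : 0 < (h'.contactBasis (φ m)).det
      (fun i => mfderiv (𝓡 3) (𝓡 3) φ m (h.contactBasis m i)) := by
  -- Brackets are natural, so `dφ` carries the contact basis of a frame to that of the pushed frame,
  -- and any two frames give the same orientation.
  have e : (fun i => mfderiv (𝓡 3) (𝓡 3) φ m (h.contactBasis m i)) = (h.push hφ).contactBasis (φ m) := by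
    funext i
    rw [IsFrame.contactBasis_apply, IsFrame.contactBasis_apply, pushField_apply, pushField_apply,
      mlieBracket_pushField φ h.smooth_snd h.smooth_fst]
    fin_cases i <;> rfl
  rw [e, ← Module.Basis.orientation_eq_iff_det_pos]
  exact h'.contactBasis_orientation_eq _ _

end Push

end Orientation

section ProlongationOrientation

variable {M : Type*} [TopologicalSpace M] [ChartedSpace (EuclideanSpace ℝ (Fin 3)) M]
  [IsManifold (𝓡 3) ∞ M] {ξ : ParallelizableContactStructure M}
  {X Y X' Y' : ∀ m : M, TangentSpace (𝓡 3) m} {V₀ V₁ W₀ W₁ : LegendrianField ξ}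

/-! ### Bases of the tangent spaces of the prolongation and of the Engel planes -/

/-- The vector `∂/∂θ` together with lifts of the contact basis. -/
def IsFrame.liftedFamily (h : IsFrame ξ.plane X Y) (p : M × ℝ) :
    Fin 4 → TangentSpace model (h.direction p) :=
  Fin.cons (h.directionDeriv p (0, 1)) fun i => h.directionDeriv p (h.contactBasis p.1 i, 0)

lemma IsFrame.linearIndependent_liftedFamily (h : IsFrame ξ.plane X Y) {p : M × ℝ}
    (hp : p.2 ∈ Set.Ioo (-Real.pi) Real.pi) : LinearIndependent ℝ (h.liftedFamily p) := by
  rw [Fintype.linearIndependent_iff]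
  intro g hg
  have hsum : h.directionDeriv p ((∑ i : Fin 3, g i.succ • h.contactBasis p.1 i :
      EuclideanSpace ℝ (Fin 3)), g 0) = 0 := by
    rw [← hg, Fin.sum_univ_succ]
    have e : (((∑ i : Fin 3, g i.succ • h.contactBasis p.1 i : EuclideanSpace ℝ (Fin 3)), g 0) :
        EuclideanSpace ℝ (Fin 3) × ℝ) = g 0 • ((0, 1) : EuclideanSpace ℝ (Fin 3) × ℝ) +
        ∑ i : Fin 3, g i.succ • ((h.contactBasis p.1 i, 0) : EuclideanSpace ℝ (Fin 3) × ℝ) := by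
      ext1
      · rw [Prod.fst_add, Prod.fst_sum]
        simp
        rfl
      · rw [Prod.snd_add, Prod.snd_sum]
        simp
    rw [e, map_add, map_sum, map_smul]
    simp only [map_smul]
    rfl
  have h0 := (h.directionDeriv_bijective hp).1 (hsum.trans (map_zero _).symm)
  have h1 := Fintype.linearIndependent_iff.1 (h.contactBasis p.1).linearIndependent
    (fun i => g i.succ) (congrArg Prod.fst h0)
  intro i
  induction i using Fin.cases with
  | zero => exact congrArg Prod.snd h0
  | succ i => exact h1 i

/-- The basis of the tangent space of the prolongation that consists of `∂/∂θ` and of lifts of the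
contact basis. -/
def IsFrame.liftedBasis (h : IsFrame ξ.plane X Y) {p : M × ℝ}
    (hp : p.2 ∈ Set.Ioo (-Real.pi) Real.pi) :
    Module.Basis (Fin 4) ℝ (TangentSpace model (h.direction p)) :=
  basisOfLinearIndependentOfCardEqFinrank (h.linearIndependent_liftedFamily hp)
    (by
      have : Module.finrank ℝ (EuclideanSpace ℝ (Fin 3) × EuclideanSpace ℝ (Fin 1)) = 4 := by simp
      exact this.symm)

lemma IsFrame.liftedBasis_zero (h : IsFrame ξ.plane X Y) {p : M × ℝ}
    (hp : p.2 ∈ Set.Ioo (-Real.pi) Real.pi) :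
    h.liftedBasis hp 0 = h.directionDeriv p (0, 1) :=
  congrFun (coe_basisOfLinearIndependentOfCardEqFinrank _ _) 0

lemma IsFrame.liftedBasis_succ (h : IsFrame ξ.plane X Y) {p : M × ℝ}
    (hp : p.2 ∈ Set.Ioo (-Real.pi) Real.pi) (i : Fin 3) :
    h.liftedBasis hp i.succ = h.directionDeriv p (h.contactBasis p.1 i, 0) :=
  congrFun (coe_basisOfLinearIndependentOfCardEqFinrank _ _) i.succ

lemma IsFrame.projDeriv_liftedBasis_zero (h : IsFrame ξ.plane X Y) {p : M × ℝ}
    (hp : p.2 ∈ Set.Ioo (-Real.pi) Real.pi) :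
    projDeriv (h.direction p) (h.liftedBasis hp 0) = 0 := by
  rw [h.liftedBasis_zero]
  exact h.projDeriv_directionDeriv p _

lemma IsFrame.projDeriv_liftedBasis_succ (h : IsFrame ξ.plane X Y) {p : M × ℝ}
    (hp : p.2 ∈ Set.Ioo (-Real.pi) Real.pi) (i : Fin 3) :
    projDeriv (h.direction p) (h.liftedBasis hp i.succ) = h.contactBasis p.1 i := by
  rw [h.liftedBasis_succ]
  exact h.projDeriv_directionDeriv p _

/-- A family whose first member is `t • ∂/∂θ` has `t` times the determinant of its projection. -/
lemma IsFrame.det_liftedBasis (h : IsFrame ξ.plane X Y) {p : M × ℝ}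
    (hp : p.2 ∈ Set.Ioo (-Real.pi) Real.pi) {v : Fin 4 → TangentSpace model (h.direction p)} {t : ℝ}
    (hv : v 0 = t • h.directionDeriv p (0, 1)) : (h.liftedBasis hp).det v =
      t * (h.contactBasis p.1).det (fun i => projDeriv (h.direction p) (v i.succ)) :=
  det_of_projection (h.liftedBasis hp) (h.contactBasis p.1) (projDeriv (h.direction p)).toLinearMap
    (h.projDeriv_liftedBasis_zero hp) (h.projDeriv_liftedBasis_succ hp)
    (by rw [h.liftedBasis_zero]; exact hv)

/-- A vector tangent to the fibre is a multiple of `∂/∂θ`. -/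
lemma IsFrame.eq_smul_of_projDeriv_eq_zero (h : IsFrame ξ.plane X Y) {p : M × ℝ}
    (hp : p.2 ∈ Set.Ioo (-Real.pi) Real.pi) {w : TangentSpace model (h.direction p)}
    (hw : projDeriv (h.direction p) w = 0) :
    w = h.angleDeriv (h.direction p) w • h.directionDeriv p (0, 1) := by
  have e := h.directionDeriv_proj_angle hp w
  rw [← map_smul]
  conv_lhs => rw [← e]
  have e2 : (projDeriv (h.direction p) w : EuclideanSpace ℝ (Fin 3)) = 0 := hw
  rw [e2]
  congr 1
  ext1
  · simp
    rfl
  · simp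

/-- Relative to the lifted basis, the determinant of a basis as in the definition is a positive
fibre factor times a positive determinant on the base. -/
lemma IsFrame.Adapted.isPositiveBasis_iff {h : IsFrame ξ.plane X Y} (ha : h.Adapted V₀ V₁)
    {p : M × ℝ} (hp : p.2 ∈ Set.Icc 0 (Real.pi / 2))
    (b : Module.Basis (Fin 4) ℝ (TangentSpace model (h.direction p))) :
    V₀.IsPositiveBasis V₁ (h.direction p) b ↔
      b.orientation = (h.liftedBasis (Icc_subset_Ioo_pi hp)).orientation := by
  have hp' := Icc_subset_Ioo_pi hp
  constructor
  · rintro ⟨b', c, h0, hs, hc, hb⟩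
    rw [hb, eq_comm, Module.Basis.orientation_eq_iff_det_pos]
    obtain ⟨z0, z1⟩ := ha.isThetaVector_pos h0 (ha.direction_mem hp)
    rw [h.det_liftedBasis hp' (h.eq_smul_of_projDeriv_eq_zero hp' z0)]
    refine mul_pos z1 ?_
    rw [funext hs]
    exact (Module.Basis.orientation_eq_iff_det_pos _ _).1 ((h.isContactPositive_iff c).1 hc).symm
  · intro hb
    refine ⟨h.liftedBasis hp', h.contactBasis p.1, ?_, h.projDeriv_liftedBasis_succ hp', ?_, hb⟩
    · rw [h.liftedBasis_zero]
      exact ha.isThetaVector_directionDeriv p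
    · exact (h.isContactPositive_iff _).2 rfl

/-- The basis of the Engel plane that consists of `∂/∂θ` and of a lift of the direction. -/
lemma IsFrame.exists_engelBasis (h : IsFrame ξ.plane X Y) {p : M × ℝ}
    (hp : p.2 ∈ Set.Ioo (-Real.pi) Real.pi) :
    ∃ b : Module.Basis (Fin 2) ℝ (engelPlane (h.direction p)),
      (b 0 : TangentSpace model (h.direction p)) = h.directionDeriv p (0, 1) ∧
      (b 1 : TangentSpace model (h.direction p)) = h.directionDeriv p (h.vector p, 0) := by
  have m0 : h.directionDeriv p (0, 1) ∈ engelPlane (h.direction p) :=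
    (h.mem_engelPlane_iff p _).2 ⟨0, by
      rw [zero_smul]; exact h.projDeriv_directionDeriv p _⟩
  have m1 : h.directionDeriv p (h.vector p, 0) ∈ engelPlane (h.direction p) :=
    (h.mem_engelPlane_iff p _).2 ⟨1, by
      rw [one_smul]; exact h.projDeriv_directionDeriv p _⟩
  have vec0 : h.vector p ≠ 0 := by
    intro h0
    have := LinearIndependent.pair_iff.1 (h.linearIndependent p.1) _ _ h0
    have hc := Real.cos_sq_add_sin_sq p.2
    simp [this.1, this.2] at hc
  let v : Fin 2 → engelPlane (h.direction p) := ![⟨_, m0⟩, ⟨_, m1⟩]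
  have li : LinearIndependent ℝ v := by
    rw [LinearIndependent.pair_iff]
    intro s t hst
    have e := congrArg Subtype.val hst
    rw [Submodule.coe_add, Submodule.coe_smul, Submodule.coe_smul, ← map_smul, ← map_smul,
      ← map_add] at e
    have e0 := (h.directionDeriv_bijective hp).1 (e.trans (map_zero _).symm)
    have e1 := congrArg Prod.fst e0
    have e2 := congrArg Prod.snd e0
    simp at e1 e2
    exact ⟨e2, (smul_eq_zero.1 e1).resolve_right vec0⟩
  have sp : ⊤ ≤ Submodule.span ℝ (Set.range v) := by
    rintro ⟨w, hw⟩ -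
    obtain ⟨r, hr⟩ := (h.mem_engelPlane_iff p w).1 hw
    rw [Matrix.range_cons_cons_empty, Submodule.mem_span_pair]
    refine ⟨h.angleDeriv (h.direction p) w, r, Subtype.ext ?_⟩
    rw [Submodule.coe_add, Submodule.coe_smul, Submodule.coe_smul, ← map_smul, ← map_smul, ← map_add]
    refine Eq.trans ?_ (h.directionDeriv_proj_angle hp w)
    have hr' : (projDeriv (h.direction p) w : EuclideanSpace ℝ (Fin 3)) = r • h.vector p := hr
    rw [hr']
    congr 1
    ext1
    · simp
      rfl
    · simp
  refine ⟨Module.Basis.mk li sp, ?_, ?_⟩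
  · rw [Module.Basis.mk_apply]; rfl
  · rw [Module.Basis.mk_apply]; rfl

/-- The basis of the Engel plane that consists of `∂/∂θ` and of a lift of the direction. -/
def IsFrame.engelBasis (h : IsFrame ξ.plane X Y) {p : M × ℝ}
    (hp : p.2 ∈ Set.Ioo (-Real.pi) Real.pi) :
    Module.Basis (Fin 2) ℝ (engelPlane (h.direction p)) :=
  (h.exists_engelBasis hp).choose

lemma IsFrame.engelBasis_zero (h : IsFrame ξ.plane X Y) {p : M × ℝ}
    (hp : p.2 ∈ Set.Ioo (-Real.pi) Real.pi) :
    (h.engelBasis hp 0 : TangentSpace model (h.direction p)) = h.directionDeriv p (0, 1) :=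
  (h.exists_engelBasis hp).choose_spec.1

lemma IsFrame.engelBasis_one (h : IsFrame ξ.plane X Y) {p : M × ℝ}
    (hp : p.2 ∈ Set.Ioo (-Real.pi) Real.pi) :
    (h.engelBasis hp 1 : TangentSpace model (h.direction p)) = h.directionDeriv p (h.vector p, 0) :=
  (h.exists_engelBasis hp).choose_spec.2

/-- A basis of the Engel plane whose first member is `t • ∂/∂θ` and whose second member projects to
the multiple by `r` of the direction has the determinant `t * r`. -/
lemma IsFrame.det_engelBasis (h : IsFrame ξ.plane X Y) {p : M × ℝ}
    (hp : p.2 ∈ Set.Ioo (-Real.pi) Real.pi) {v : Fin 2 → engelPlane (h.direction p)} {t r : ℝ}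
    (h0 : (v 0 : TangentSpace model (h.direction p)) = t • h.directionDeriv p (0, 1))
    (h1 : projDeriv (h.direction p) (v 1 : TangentSpace model (h.direction p)) = r • h.vector p) :
    (h.engelBasis hp).det v = t * r := by
  refine det_fin_two_triangular (h.engelBasis hp) (t := t)
    (x := h.angleDeriv (h.direction p) (v 1 : TangentSpace model (h.direction p))) (y := r)
    (Subtype.ext ?_) (Subtype.ext ?_)
  · rw [Submodule.coe_smul, h.engelBasis_zero, h0]
  · rw [Submodule.coe_add, Submodule.coe_smul, Submodule.coe_smul, h.engelBasis_zero,
      h.engelBasis_one, ← map_smul, ← map_smul, ← map_add]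
    refine (h.directionDeriv_proj_angle hp _).symm.trans ?_
    have h1' : (projDeriv (h.direction p) (v 1 : TangentSpace model (h.direction p)) :
      EuclideanSpace ℝ (Fin 3)) = r • h.vector p := h1
    rw [h1']
    congr 1
    ext1
    · simp
      rfl
    · simp

/-- A basis as in the definition is triangular relative to `engelBasis`, with positive diagonal
entries. -/
lemma IsFrame.Adapted.isPositiveEngelBasis_iff {h : IsFrame ξ.plane X Y} (ha : h.Adapted V₀ V₁)
    {p : M × ℝ} (hp : p.2 ∈ Set.Icc 0 (Real.pi / 2))
    (b : Module.Basis (Fin 2) ℝ (engelPlane (h.direction p))) :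
    V₀.IsPositiveEngelBasis V₁ (h.direction p) b ↔
      b.orientation = (h.engelBasis (Icc_subset_Ioo_pi hp)).orientation := by
  have hp' := Icc_subset_Ioo_pi hp
  constructor
  · rintro ⟨b', h0, h1, hb⟩
    rw [hb, eq_comm, Module.Basis.orientation_eq_iff_det_pos]
    obtain ⟨z0, z1⟩ := ha.isThetaVector_pos h0 (ha.direction_mem hp)
    obtain ⟨r, hr, er⟩ := (h.pointsAlong_direction_iff p _).1 h1
    rw [h.det_engelBasis hp' (h.eq_smul_of_projDeriv_eq_zero hp' z0) er]
    exact mul_pos z1 hr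
  · intro hb
    refine ⟨h.engelBasis hp', ?_, ?_, hb⟩
    · rw [h.engelBasis_zero]
      exact ha.isThetaVector_directionDeriv p
    · refine (h.pointsAlong_direction_iff p _).2 ⟨1, one_pos, ?_⟩
      rw [h.engelBasis_one, one_smul]
      exact h.projDeriv_directionDeriv p _

end ProlongationOrientation

section Transport

variable {M : Type*} [TopologicalSpace M] [ChartedSpace (EuclideanSpace ℝ (Fin 3)) M]
  [IsManifold (𝓡 3) ∞ M] {ξ : ParallelizableContactStructure M}
  {X Y X' Y' : ∀ m : M, TangentSpace (𝓡 3) m} {V₀ V₁ W₀ W₁ : LegendrianField ξ}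
  {h : IsFrame ξ.plane X Y} {h' : IsFrame ξ.plane X' Y'} {q q' : OrientedProlongation ξ}
  {L : TangentSpace model q →L[ℝ] TangentSpace model q'}
  {K : TangentSpace (𝓡 3) q.base →L[ℝ] TangentSpace (𝓡 3) q'.base} {t : ℝ}

/-! ### The effect of a fibred linear map on the orientations -/

/-- For use with `L` the derivative of a map of the prolongation and `K = dφ`: `L` covers `K` and
scales the fibre by `t`, so its determinant is a product. The bases are existential so that `q` and
`q'` may be arbitrary points of the domains. -/
lemma IsFrame.Adapted.liftedBasis_map (ha : h.Adapted V₀ V₁) (ha' : h'.Adapted W₀ W₁)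
    (hq : q ∈ V₀.engelDomain V₁) (hq' : q' ∈ W₀.engelDomain W₁)
    (proj : ∀ v, projDeriv q' (L v) = K (projDeriv q v))
    (fibre : ∀ v, projDeriv q v = 0 → h'.angleDeriv q' (L v) = t * h.angleDeriv q v) :
    ∃ (e : Module.Basis (Fin 4) ℝ (TangentSpace model q))
      (e' : Module.Basis (Fin 4) ℝ (TangentSpace model q')),
      (∀ b, V₀.IsPositiveBasis V₁ q b ↔ b.orientation = e.orientation) ∧
      (∀ b, W₀.IsPositiveBasis W₁ q' b ↔ b.orientation = e'.orientation) ∧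
      e'.det (fun i => L (e i)) =
        t * (h'.contactBasis q'.base).det (fun i => K (h.contactBasis q.base i)) := by
  obtain ⟨p, hp, rfl⟩ := ha.exists_eq_direction hq
  obtain ⟨p', hp', rfl⟩ := ha'.exists_eq_direction hq'
  have ip := Icc_subset_Ioo_pi hp
  have ip' := Icc_subset_Ioo_pi hp'
  refine ⟨h.liftedBasis ip, h'.liftedBasis ip', ha.isPositiveBasis_iff hp,
    ha'.isPositiveBasis_iff hp', ?_⟩
  have z := h.projDeriv_liftedBasis_zero ip
  have z' : projDeriv (h'.direction p') (L (h.liftedBasis ip 0)) = 0 := by rw [proj, z, map_zero]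
  have a0 : h.angleDeriv (h.direction p) (h.liftedBasis ip 0) = 1 := by
    rw [h.liftedBasis_zero, h.angleDeriv_directionDeriv ip]
  rw [h'.det_liftedBasis ip' (h'.eq_smul_of_projDeriv_eq_zero ip' z'), fibre _ z, a0, mul_one]
  congr 2
  funext i
  rw [proj, h.projDeriv_liftedBasis_succ]
  rfl

/-- The sign of `det L` is that of `t` times that of `det K`; two of the three signs are known. -/
lemma IsFrame.Adapted.fibre_pos (ha : h.Adapted V₀ V₁) (ha' : h'.Adapted W₀ W₁)
    (hq : q ∈ V₀.engelDomain V₁) (hq' : q' ∈ W₀.engelDomain W₁)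
    (proj : ∀ v, projDeriv q' (L v) = K (projDeriv q v))
    (fibre : ∀ v, projDeriv q v = 0 → h'.angleDeriv q' (L v) = t * h.angleDeriv q v)
    (det_pos : 0 < (h'.contactBasis q'.base).det (fun i => K (h.contactBasis q.base i)))
    (pos : ∀ b, V₀.IsPositiveBasis V₁ q b → ∃ b', W₀.IsPositiveBasis W₁ q' b' ∧
      ∀ i, b' i = L (b i)) : 0 < t := by
  obtain ⟨e, e', he, he', hdet⟩ := ha.liftedBasis_map ha' hq hq' proj fibre
  obtain ⟨b', hb', hi⟩ := pos e ((he e).2 rfl)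
  have h1 := (Module.Basis.orientation_eq_iff_det_pos _ _).1 ((he' b').1 hb').symm
  rw [funext hi, hdet] at h1
  exact (pos_iff_pos_of_mul_pos h1).2 det_pos

lemma IsFrame.Adapted.isPositiveBasis_map (ha : h.Adapted V₀ V₁) (ha' : h'.Adapted W₀ W₁)
    (hq : q ∈ V₀.engelDomain V₁) (hq' : q' ∈ W₀.engelDomain W₁)
    (proj : ∀ v, projDeriv q' (L v) = K (projDeriv q v))
    (fibre : ∀ v, projDeriv q v = 0 → h'.angleDeriv q' (L v) = t * h.angleDeriv q v)
    (det_pos : 0 < (h'.contactBasis q'.base).det (fun i => K (h.contactBasis q.base i)))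
    (bij : Function.Bijective L) (ht : 0 < t)
    (b : Module.Basis (Fin 4) ℝ (TangentSpace model q)) (hb : V₀.IsPositiveBasis V₁ q b) :
    ∃ b', W₀.IsPositiveBasis W₁ q' b' ∧ ∀ i, b' i = L (b i) := by
  obtain ⟨e, e', he, he', hdet⟩ := ha.liftedBasis_map ha' hq hq' proj fibre
  let T : TangentSpace model q ≃ₗ[ℝ] TangentSpace model q' :=
    LinearEquiv.ofBijective L.toLinearMap bij
  refine ⟨b.map T, (he' _).2 ?_, fun i => rfl⟩
  have h1 : e'.orientation = (e.map T).orientation := by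
    rw [Module.Basis.orientation_eq_iff_det_pos]
    refine lt_of_lt_of_eq (mul_pos ht det_pos) (hdet.symm.trans ?_)
    congr 1
  rw [h1, Module.Basis.orientation_map, Module.Basis.orientation_map, (he b).1 hb]

variable {r : ℝ}

/-- On the Engel plane `L` is triangular, with `t` on the fibre and `r` on the direction. -/
lemma IsFrame.Adapted.engelBasis_map (ha : h.Adapted V₀ V₁) (ha' : h'.Adapted W₀ W₁)
    (hq : q ∈ V₀.engelDomain V₁) (hq' : q' ∈ W₀.engelDomain W₁)
    (proj : ∀ v, projDeriv q' (L v) = K (projDeriv q v))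
    (fibre : ∀ v, projDeriv q v = 0 → h'.angleDeriv q' (L v) = t * h.angleDeriv q v)
    (dir : K (h.vector (q.base, h.angle q)) = r • h'.vector (q'.base, h'.angle q')) :
    ∃ (e : Module.Basis (Fin 2) ℝ (engelPlane q)) (e' : Module.Basis (Fin 2) ℝ (engelPlane q')),
      (∀ b, V₀.IsPositiveEngelBasis V₁ q b ↔ b.orientation = e.orientation) ∧
      (∀ b, W₀.IsPositiveEngelBasis W₁ q' b ↔ b.orientation = e'.orientation) ∧
      ∀ b' : Fin 2 → engelPlane q', (∀ i, (b' i : TangentSpace model q') = L (e i)) →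
        e'.det b' = t * r := by
  obtain ⟨p, hp, rfl⟩ := ha.exists_eq_direction hq
  obtain ⟨p', hp', rfl⟩ := ha'.exists_eq_direction hq'
  have ip := Icc_subset_Ioo_pi hp
  have ip' := Icc_subset_Ioo_pi hp'
  refine ⟨h.engelBasis ip, h'.engelBasis ip', ha.isPositiveEngelBasis_iff hp,
    ha'.isPositiveEngelBasis_iff hp', fun b' hb' => ?_⟩
  have z : projDeriv (h.direction p) (h.engelBasis ip 0 : TangentSpace model (h.direction p)) = 0 := by
    rw [h.engelBasis_zero]
    exact h.projDeriv_directionDeriv p _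
  have z' : projDeriv (h'.direction p') (L (h.engelBasis ip 0)) = 0 := by rw [proj, z, map_zero]
  have a0 : h.angleDeriv (h.direction p)
      (h.engelBasis ip 0 : TangentSpace model (h.direction p)) = 1 := by
    rw [h.engelBasis_zero, h.angleDeriv_directionDeriv ip]
  refine h'.det_engelBasis ip' ?_ ?_
  · rw [hb', h'.eq_smul_of_projDeriv_eq_zero ip' z', fibre _ z, a0, mul_one]
  · rw [h.angle_direction_of_mem_Icc hp, h'.angle_direction_of_mem_Icc hp'] at dir
    rw [hb', proj, h.engelBasis_one]
    refine Eq.trans (congrArg K ?_) dir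
    exact h.projDeriv_directionDeriv p _

lemma IsFrame.Adapted.direction_pos (ha : h.Adapted V₀ V₁) (ha' : h'.Adapted W₀ W₁)
    (hq : q ∈ V₀.engelDomain V₁) (hq' : q' ∈ W₀.engelDomain W₁)
    (proj : ∀ v, projDeriv q' (L v) = K (projDeriv q v))
    (fibre : ∀ v, projDeriv q v = 0 → h'.angleDeriv q' (L v) = t * h.angleDeriv q v)
    (dir : K (h.vector (q.base, h.angle q)) = r • h'.vector (q'.base, h'.angle q'))
    (pos : ∀ b, V₀.IsPositiveEngelBasis V₁ q b → ∃ b', W₀.IsPositiveEngelBasis W₁ q' b' ∧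
      ∀ i, (b' i : TangentSpace model q') = L (b i : TangentSpace model q)) (ht : 0 < t) : 0 < r := by
  obtain ⟨e, e', he, he', hdet⟩ := ha.engelBasis_map ha' hq hq' proj fibre dir
  obtain ⟨b', hb', hi⟩ := pos e ((he e).2 rfl)
  have h1 := (Module.Basis.orientation_eq_iff_det_pos _ _).1 ((he' b').1 hb').symm
  rw [hdet b' hi] at h1
  exact (pos_iff_pos_of_mul_pos h1).1 ht

lemma IsFrame.Adapted.map_engelPlane (ha : h.Adapted V₀ V₁) (ha' : h'.Adapted W₀ W₁)
    (hq : q ∈ V₀.engelDomain V₁) (hq' : q' ∈ W₀.engelDomain W₁)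
    (proj : ∀ v, projDeriv q' (L v) = K (projDeriv q v))
    (dir : K (h.vector (q.base, h.angle q)) = r • h'.vector (q'.base, h'.angle q'))
    (surj : Function.Surjective L) (inj : Function.Injective K) (hr : r ≠ 0) :
    (engelPlane q).map L.toLinearMap = engelPlane q' := by
  obtain ⟨p, hp, rfl⟩ := ha.exists_eq_direction hq
  obtain ⟨p', hp', rfl⟩ := ha'.exists_eq_direction hq'
  rw [h.angle_direction_of_mem_Icc hp, h'.angle_direction_of_mem_Icc hp'] at dir
  change K (h.vector p) = r • h'.vector p' at dir
  ext w
  rw [Submodule.mem_map, h'.mem_engelPlane_iff]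
  constructor
  · rintro ⟨v, hv, rfl⟩
    obtain ⟨s, hs⟩ := (h.mem_engelPlane_iff p v).1 hv
    refine ⟨s * r, ?_⟩
    refine (proj v).trans ?_
    rw [hs, mul_smul, ← dir]
    exact map_smul K s _
  · rintro ⟨s, hs⟩
    obtain ⟨v, rfl⟩ := surj w
    refine ⟨v, (h.mem_engelPlane_iff p v).2 ⟨s / r, inj ?_⟩, rfl⟩
    rw [← proj, hs]
    refine Eq.trans ?_ (map_smul K (s / r) _).symm
    have key : ∀ x : TangentSpace (𝓡 3) p'.1, s • x = (s / r) • r • x := fun x => by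
      rw [smul_smul, div_mul_cancel₀ _ hr]
    rw [dir]
    exact key _

lemma IsFrame.Adapted.isPositiveEngelBasis_map (ha : h.Adapted V₀ V₁) (ha' : h'.Adapted W₀ W₁)
    (hq : q ∈ V₀.engelDomain V₁) (hq' : q' ∈ W₀.engelDomain W₁)
    (proj : ∀ v, projDeriv q' (L v) = K (projDeriv q v))
    (fibre : ∀ v, projDeriv q v = 0 → h'.angleDeriv q' (L v) = t * h.angleDeriv q v)
    (dir : K (h.vector (q.base, h.angle q)) = r • h'.vector (q'.base, h'.angle q'))
    (bij : Function.Bijective L) (inj : Function.Injective K) (ht : 0 < t) (hr : 0 < r)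
    (b : Module.Basis (Fin 2) ℝ (engelPlane q)) (hb : V₀.IsPositiveEngelBasis V₁ q b) :
    ∃ b', W₀.IsPositiveEngelBasis W₁ q' b' ∧
      ∀ i, (b' i : TangentSpace model q') = L (b i : TangentSpace model q) := by
  obtain ⟨e, e', he, he', hdet⟩ := ha.engelBasis_map ha' hq hq' proj fibre dir
  let T : engelPlane q ≃ₗ[ℝ] engelPlane q' :=
    ((LinearEquiv.ofBijective L.toLinearMap bij).submoduleMap (engelPlane q)).trans
      (LinearEquiv.ofEq _ _ (ha.map_engelPlane ha' hq hq' proj dir bij.2 inj hr.ne'))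
  have hT : ∀ v, (T v : TangentSpace model q') = L (v : TangentSpace model q) := fun v => rfl
  refine ⟨b.map T, (he' _).2 ?_, fun i => hT (b i)⟩
  have h1 : e'.orientation = (e.map T).orientation := by
    rw [Module.Basis.orientation_eq_iff_det_pos, hdet (e.map T) fun i => hT (e i)]
    exact mul_pos ht hr
  rw [h1, Module.Basis.orientation_map, Module.Basis.orientation_map, (he b).1 hb]

end Transport

/-! ### The lift of a contact diffeomorphism -/

section Lift

variable {M : Type*} [TopologicalSpace M] [ChartedSpace (EuclideanSpace ℝ (Fin 3)) M]
  [IsManifold (𝓡 3) ∞ M] {ξ : ParallelizableContactStructure M}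
  {X Y X' Y' : ∀ m : M, TangentSpace (𝓡 3) m} {V₀ V₁ W₀ W₁ : LegendrianField ξ}

/-- The lift of a diffeomorphism of the base that preserves the angle. -/
def liftMap (h : IsFrame ξ.plane X Y) (h' : IsFrame ξ.plane X' Y')
    (φ : Diffeomorph (𝓡 3) (𝓡 3) M M ∞) (q : OrientedProlongation ξ) : OrientedProlongation ξ :=
  h'.direction (φ q.base, h.angle q)

variable (h : IsFrame ξ.plane X Y) (h' : IsFrame ξ.plane X' Y')
  (φ : Diffeomorph (𝓡 3) (𝓡 3) M M ∞)

lemma angle_liftMap (q : OrientedProlongation ξ) : h'.angle (liftMap h h' φ q) = h.angle q :=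
  h'.angle_direction (h.angle_mem q)

/-- The angle is discontinuous at the cut, but the map depends only on the point of the circle,
which is smooth everywhere. -/
lemma contMDiff_liftMap : ContMDiff model model ∞ (liftMap h h' φ) := by
  have h1 : ContMDiff model model ∞ (fun q : OrientedProlongation ξ =>
      (trivialization h').symm (φ q.base, (trivialization h q).2)) :=
    (contMDiff_trivialization_symm h').comp ((φ.contMDiff.comp contMDiff_base).prodMk
      (contMDiff_snd.comp (contMDiff_trivialization h)))
  refine h1.congr fun q => ?_
  rw [liftMap, h'.direction_eq, IsFrame.angle, Circle.exp_arg]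

lemma liftMap_symm_liftMap (q : OrientedProlongation ξ) :
    liftMap h' h φ.symm (liftMap h h' φ q) = q := by
  conv_rhs => rw [← h.direction_angle q]
  rw [liftMap, angle_liftMap]
  congr 2
  exact φ.symm_apply_apply q.base

lemma isDiffeoOn_liftMap (ha : h.Adapted V₀ V₁) (ha' : h'.Adapted W₀ W₁) :
    IsDiffeoOn (liftMap h h' φ) (liftMap h' h φ.symm) (V₀.engelDomain V₁) (W₀.engelDomain W₁) where
  smooth := (contMDiff_liftMap h h' φ).contMDiffOn
  smooth_inv := (contMDiff_liftMap h' h φ.symm).contMDiffOn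
  mapsTo q hq := by
    rw [ha'.mem_engelDomain_iff, angle_liftMap]
    exact ha.mem_engelDomain_iff.1 hq
  mapsTo_inv q hq := by
    rw [ha.mem_engelDomain_iff, angle_liftMap]
    exact ha'.mem_engelDomain_iff.1 hq
  invOn := ⟨fun q _ => liftMap_symm_liftMap h h' φ q, fun q _ => liftMap_symm_liftMap h' h φ.symm q⟩

lemma hasMFDerivAt_liftMap (q : OrientedProlongation ξ) :
    HasMFDerivAt model model (liftMap h h' φ) q (mfderiv model model (liftMap h h' φ) q) :=
  ((contMDiff_liftMap h h' φ).mdifferentiable (by simp) q).hasMFDerivAt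

lemma projDeriv_liftMap (q : OrientedProlongation ξ) (v : TangentSpace model q) :
    projDeriv (liftMap h h' φ q) (mfderiv model model (liftMap h h' φ) q v) =
      mfderiv (𝓡 3) (𝓡 3) φ q.base (projDeriv q v) := by
  have c1 := (hasMFDerivAt_base (liftMap h h' φ q)).comp q (hasMFDerivAt_liftMap h h' φ q)
  have c2 := ((φ.mdifferentiable (by simp) q.base).hasMFDerivAt).comp q (hasMFDerivAt_base q)
  exact congrArg (fun T : EuclideanSpace ℝ (Fin 3) × EuclideanSpace ℝ (Fin 1) →L[ℝ]
    EuclideanSpace ℝ (Fin 3) => T v) (hasMFDerivAt_unique c1 c2)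

lemma hasMFDerivAt_real_comp_apply {F : OrientedProlongation ξ → OrientedProlongation ξ}
    {a a' : OrientedProlongation ξ → ℝ} (ha : a' ∘ F = a) {q : OrientedProlongation ξ}
    {T : TangentSpace model q →L[ℝ] TangentSpace model (F q)}
    {D : TangentSpace model q →L[ℝ] ℝ} {D' : TangentSpace model (F q) →L[ℝ] ℝ}
    (hF : HasMFDerivAt model model F q T) (hD : HasMFDerivAt model 𝓘(ℝ, ℝ) a q D)
    (hD' : HasMFDerivAt model 𝓘(ℝ, ℝ) a' (F q) D') (v : TangentSpace model q) :
    D' (T v) = D v := by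
  subst ha
  have u := hasMFDerivAt_unique (hD'.comp q hF) hD
  exact congrArg (fun S : EuclideanSpace ℝ (Fin 3) × EuclideanSpace ℝ (Fin 1) →L[ℝ] ℝ => S v) u

lemma angleDeriv_liftMap {q : OrientedProlongation ξ} (hq : h.angle q ≠ Real.pi)
    (v : TangentSpace model q) :
    h'.angleDeriv (liftMap h h' φ q) (mfderiv model model (liftMap h h' φ) q v) =
      h.angleDeriv q v :=
  hasMFDerivAt_real_comp_apply (funext (angle_liftMap h h' φ)) (hasMFDerivAt_liftMap h h' φ q)
    (h.hasMFDerivAt_angle hq) (h'.hasMFDerivAt_angle (by rwa [angle_liftMap])) v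

lemma bijective_of_injective {q q' : OrientedProlongation ξ}
    {L : TangentSpace model q →L[ℝ] TangentSpace model q'} (hL : Function.Injective L) :
    Function.Bijective L := by
  have : FiniteDimensional ℝ (TangentSpace model q) :=
    inferInstanceAs (FiniteDimensional ℝ (EuclideanSpace ℝ (Fin 3) × EuclideanSpace ℝ (Fin 1)))
  have : FiniteDimensional ℝ (TangentSpace model q') :=
    inferInstanceAs (FiniteDimensional ℝ (EuclideanSpace ℝ (Fin 3) × EuclideanSpace ℝ (Fin 1)))
  have e : Module.finrank ℝ (TangentSpace model q) = Module.finrank ℝ (TangentSpace model q') :=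
    (rfl : Module.finrank ℝ (EuclideanSpace ℝ (Fin 3) × EuclideanSpace ℝ (Fin 1)) = _)
  exact ⟨hL, (LinearMap.injective_iff_surjective_of_finrank_eq_finrank (f := L.toLinearMap) e).1 hL⟩

lemma mfderiv_liftMap_bijective (q : OrientedProlongation ξ) :
    Function.Bijective (mfderiv model model (liftMap h h' φ) q) := by
  refine bijective_of_injective fun v w hvw => ?_
  have c1 := (hasMFDerivAt_liftMap h' h φ.symm (liftMap h h' φ q)).comp q
    (hasMFDerivAt_liftMap h h' φ q)
  rw [show liftMap h' h φ.symm ∘ liftMap h h' φ = id from funext (liftMap_symm_liftMap h h' φ)] at c1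
  have u := hasMFDerivAt_unique c1 (hasMFDerivAt_id q)
  have e : ∀ v, mfderiv model model (liftMap h' h φ.symm) (liftMap h h' φ q)
      (mfderiv model model (liftMap h h' φ) q v) = v := fun v =>
    congrArg (fun T : EuclideanSpace ℝ (Fin 3) × EuclideanSpace ℝ (Fin 1) →L[ℝ]
      EuclideanSpace ℝ (Fin 3) × EuclideanSpace ℝ (Fin 1) => T v) u
  exact (e v).symm.trans ((congrArg _ hvw).trans (e w))

variable {h φ}

/-- The vectors of the pushed frame are the images of representatives of `V₀` and `V₁`, so they lie
on the rays of `W₀` and `W₁`. -/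
lemma IsFrame.Adapted.push (ha : h.Adapted V₀ V₁) (hφ : IsContactDiffeo ξ φ)
    (h0 : TakesField φ V₀ W₀) (h1 : TakesField φ V₁ W₁) : (h.push hφ).Adapted W₀ W₁ := by
  intro n
  obtain ⟨m, rfl⟩ : ∃ m, φ m = n := ⟨φ.symm n, φ.apply_symm_apply n⟩
  constructor
  · obtain ⟨hv, hn, e⟩ := h0 m (X m) ⟨h.fst_mem m, fun h0 =>
      (h.linearIndependent m).ne_zero 0 (congrArg Subtype.val h0), by
        rw [← (ha m).1]
        congr 1
        exact Subtype.ext (h.basis_zero m).symm⟩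
    rw [← e]
    congr 1
    exact Subtype.ext (((h.push hφ).basis_zero (φ m)).trans (pushField_apply φ X m))
  · obtain ⟨hv, hn, e⟩ := h1 m (Y m) ⟨h.snd_mem m, fun h0 =>
      (h.linearIndependent m).ne_zero 1 (congrArg Subtype.val h0), by
        rw [← (ha m).2]
        congr 1
        exact Subtype.ext (h.basis_one m).symm⟩
    rw [← e]
    congr 1
    exact Subtype.ext (((h.push hφ).basis_one (φ m)).trans (pushField_apply φ Y m))

/-- A contact diffeomorphism that takes one pair of direction fields to another lifts to an Engel
diffeomorphism of the Engel domains. -/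
theorem exists_orientedEngelDiffeo (hV : V₀.NeverCollinear V₁) (hφ : IsContactDiffeo ξ φ)
    (h0 : TakesField φ V₀ W₀) (h1 : TakesField φ V₁ W₁) :
    ∃ f : OrientedProlongation ξ → OrientedProlongation ξ,
      IsOrientedEngelDiffeo V₀ V₁ W₀ W₁ f := by
  obtain ⟨X, Y, h, ha⟩ := exists_adapted_frame hV
  have ha' := ha.push hφ h0 h1
  have hd := isDiffeoOn_liftMap h (h.push hφ) φ ha ha'
  have within : ∀ q ∈ V₀.engelDomain V₁,
      mfderivWithin model model (liftMap h (h.push hφ) φ) (V₀.engelDomain V₁) q =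
        mfderiv model model (liftMap h (h.push hφ) φ) q := fun q hq =>
    mfderivWithin_eq_mfderiv (uniqueMDiffOn_engelDomain hV q hq)
      (hasMFDerivAt_liftMap h (h.push hφ) φ q).mdifferentiableAt
  -- The lift keeps the angle, so the fibre factor is `1`. In `dir` the factor is `1` because `dφ`
  -- takes the frame to the pushed frame.
  have fibre : ∀ q ∈ V₀.engelDomain V₁, ∀ v, projDeriv q v = 0 →
      (h.push hφ).angleDeriv (liftMap h (h.push hφ) φ q)
        (mfderiv model model (liftMap h (h.push hφ) φ) q v) = 1 * h.angleDeriv q v := fun q hq v _ => by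
    rw [angleDeriv_liftMap h (h.push hφ) φ
      (Icc_subset_Ioo_pi (ha.mem_engelDomain_iff.1 hq)).2.ne, one_mul]
  have dir : ∀ q, mfderiv (𝓡 3) (𝓡 3) φ q.base (h.vector (q.base, h.angle q)) =
      (1 : ℝ) • (h.push hφ).vector (φ q.base, (h.push hφ).angle (liftMap h (h.push hφ) φ q)) := by
    intro q
    rw [one_smul, angle_liftMap]
    change _ = Real.cos _ • pushField φ X (φ q.base) + Real.sin _ • pushField φ Y (φ q.base)
    rw [pushField_apply, pushField_apply, IsFrame.vector, map_add, map_smul, map_smul]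
  refine ⟨liftMap h (h.push hφ) φ, ⟨_, hd⟩, fun q hq => ?_, fun q hq b hb => ?_,
    fun q hq b hb => ?_⟩
  · rw [within q hq]
    exact ha.map_engelPlane ha' hq (hd.mapsTo hq) (projDeriv_liftMap h (h.push hφ) φ q) (dir q)
      (mfderiv_liftMap_bijective h (h.push hφ) φ q).2 (mfderiv_diffeo_bijective φ q.base).1 one_ne_zero
  · rw [within q hq]
    exact ha.isPositiveBasis_map ha' hq (hd.mapsTo hq) (projDeriv_liftMap h (h.push hφ) φ q)
      (fibre q hq) (h.det_contactBasis_pos (h.push hφ) hφ q.base)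
      (mfderiv_liftMap_bijective h (h.push hφ) φ q) one_pos b hb
  · rw [within q hq]
    exact ha.isPositiveEngelBasis_map ha' hq (hd.mapsTo hq) (projDeriv_liftMap h (h.push hφ) φ q)
      (fibre q hq) (dir q) (mfderiv_liftMap_bijective h (h.push hφ) φ q)
      (mfderiv_diffeo_bijective φ q.base).1 one_pos one_pos b hb

end Lift

section Descent

variable {M : Type*} [TopologicalSpace M] [ChartedSpace (EuclideanSpace ℝ (Fin 3)) M]
  [IsManifold (𝓡 3) ∞ M] {ξ : ParallelizableContactStructure M}
  {X Y X' Y' : ∀ m : M, TangentSpace (𝓡 3) m} {V₀ V₁ W₀ W₁ : LegendrianField ξ}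
  {h : IsFrame ξ.plane X Y} {h' : IsFrame ξ.plane X' Y'}
  {f g F : OrientedProlongation ξ → OrientedProlongation ξ}

/-! ### Maps of Engel domains descend to the base -/

lemma IsFrame.mem_engelPlane_iff_angle (h : IsFrame ξ.plane X Y) {q : OrientedProlongation ξ}
    (w : TangentSpace model q) :
    w ∈ engelPlane q ↔ ∃ r : ℝ, projDeriv q w = r • h.vector (q.base, h.angle q) := by
  obtain ⟨p, hp, rfl⟩ : ∃ p : M × ℝ, p.2 ∈ Set.Ioc (-Real.pi) Real.pi ∧ h.direction p = q :=
    ⟨(q.base, h.angle q), h.angle_mem q, h.direction_angle q⟩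
  rw [h.angle_direction hp]
  exact h.mem_engelPlane_iff p w

lemma IsFrame.Adapted.engelDomain_mem_nhds (ha : h.Adapted V₀ V₁) {q : OrientedProlongation ξ}
    (hq : h.angle q ∈ Set.Ioo 0 (Real.pi / 2)) : V₀.engelDomain V₁ ∈ 𝓝 q := by
  have hc : ContinuousAt h.angle q :=
    (h.contMDiffAt_angle (Icc_subset_Ioo_pi (Set.Ioo_subset_Icc_self hq)).2.ne).continuousAt
  filter_upwards [hc.preimage_mem_nhds (Icc_mem_nhds hq.1 hq.2)] with x hx
  exact ha.mem_engelDomain_iff.2 hx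

/-- Such a curve and the constant one are both integral curves of the zero field, so they agree on
the open interval, and by continuity on the closed one. -/
lemma eqOn_of_hasMFDerivAt_zero [T2Space M] {γ : ℝ → M} {a b : ℝ}
    (hγ : ContinuousOn γ (Set.Icc a b))
    (hd : ∀ t ∈ Set.Ioo a b, HasMFDerivAt 𝓘(ℝ, ℝ) (𝓡 3) γ t
      (0 : ℝ →L[ℝ] EuclideanSpace ℝ (Fin 3))) {s t : ℝ} (hs : s ∈ Set.Ioo a b)
    (ht : t ∈ Set.Icc a b) : γ t = γ s := by
  have h1 : IsManifold (𝓡 3) 1 M := IsManifold.of_le (n := ∞) (by simp)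
  have zero : ContMDiff (𝓡 3) (𝓡 3).tangent 1
      (fun x : M => (⟨x, 0⟩ : TangentBundle (𝓡 3) M)) :=
    Bundle.contMDiff_zeroSection ℝ (TangentSpace (𝓡 3) : M → Type _)
  have e : Set.EqOn γ (fun _ => γ s) (Set.Ioo a b) := by
    refine isMIntegralCurveOn_Ioo_eqOn_of_contMDiff_boundaryless (I := 𝓡 3) (v := fun _ => 0) hs zero
      (fun t ht => ?_) (fun t ht => ?_) rfl
    · rw [show ((1 : ℝ →L[ℝ] ℝ).smulRight (0 : TangentSpace (𝓡 3) (γ t))) = 0 by ext; simp]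
      exact (hd t ht).hasMFDerivWithinAt
    · rw [show ((1 : ℝ →L[ℝ] ℝ).smulRight (0 : TangentSpace (𝓡 3) (γ s))) = 0 by ext; simp]
      exact hasMFDerivWithinAt_const _ _ _
  refine e.of_subset_closure hγ continuousOn_const Set.Ioo_subset_Icc_self ?_ ht
  rw [closure_Ioo (hs.1.trans hs.2).ne]

/-- A map of an Engel domain that preserves the Engel distribution descends to the base. -/
theorem IsFrame.Adapted.exists_base_map [T2Space M] (ha : h.Adapted V₀ V₁)
    (h' : IsFrame ξ.plane X' Y')
    (hF : ContMDiffOn model model ∞ F (V₀.engelDomain V₁))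
    (surj : ∀ q ∈ V₀.engelDomain V₁,
      Function.Surjective (mfderivWithin model model F (V₀.engelDomain V₁) q))
    (engel : ∀ q ∈ V₀.engelDomain V₁, ∀ v ∈ engelPlane q,
      mfderivWithin model model F (V₀.engelDomain V₁) q v ∈ engelPlane (F q)) :
    ∃ φ : M → M, ContMDiff (𝓡 3) (𝓡 3) ∞ φ ∧ (∀ q ∈ V₀.engelDomain V₁, (F q).base = φ q.base) ∧
      ∀ m, ∀ v ∈ ξ.plane m, mfderiv (𝓡 3) (𝓡 3) φ m v ∈ ξ.plane (φ m) := by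
  set Ω := V₀.engelDomain V₁ with hΩ
  -- The domain is a neighbourhood only at interior angles, so the fibre argument is made there;
  -- boundary angles are reached by continuity.
  let A : M × ℝ → M := fun p => (F (h.direction p)).base
  have inner : ∀ p : M × ℝ, p.2 ∈ Set.Ioo 0 (Real.pi / 2) → Ω ∈ 𝓝 (h.direction p) := fun p hp =>
    ha.engelDomain_mem_nhds
      (by rwa [h.angle_direction_of_mem_Icc (Set.Ioo_subset_Icc_self hp)])
  have mem : ∀ p : M × ℝ, p.2 ∈ Set.Ioo 0 (Real.pi / 2) → h.direction p ∈ Ω := fun p hp =>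
    ha.direction_mem (Set.Ioo_subset_Icc_self hp)
  have hA : ∀ p : M × ℝ, p.2 ∈ Set.Ioo 0 (Real.pi / 2) → ContMDiffAt stripModel (𝓡 3) ∞ A p :=
    fun p hp => contMDiff_base.contMDiffAt.comp p
      ((hF.contMDiffAt (inner p hp)).comp p h.contMDiff_direction.contMDiffAt)
  have dA : ∀ p : M × ℝ, p.2 ∈ Set.Ioo 0 (Real.pi / 2) → ∀ v : EuclideanSpace ℝ (Fin 3) × ℝ,
      mfderiv stripModel (𝓡 3) A p v = projDeriv (F (h.direction p))
        (mfderivWithin model model F Ω (h.direction p) (h.directionDeriv p v)) := by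
    intro p hp v
    have d1 : HasMFDerivAt model model F (h.direction p)
        (mfderivWithin model model F Ω (h.direction p)) := by
      rw [mfderivWithin_of_mem_nhds (inner p hp)]
      exact ((hF.contMDiffAt (inner p hp)).mdifferentiableAt (by simp)).hasMFDerivAt
    have c := ((hasMFDerivAt_base (F (h.direction p))).comp _ d1).comp p (h.hasMFDerivAt_direction p)
    exact congrArg (fun T : EuclideanSpace ℝ (Fin 3) × ℝ →L[ℝ] EuclideanSpace ℝ (Fin 3) => T v)
      c.mfderiv
  have flat : ∀ p : M × ℝ, p.2 ∈ Set.Ioo 0 (Real.pi / 2) →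
      mfderiv stripModel (𝓡 3) A p ((0, 1) : EuclideanSpace ℝ (Fin 3) × ℝ) = 0 ∧
      mfderiv stripModel (𝓡 3) A p ((X p.1, 0) : EuclideanSpace ℝ (Fin 3) × ℝ) ∈ ξ.plane (A p) ∧
      mfderiv stripModel (𝓡 3) A p ((Y p.1, 0) : EuclideanSpace ℝ (Fin 3) × ℝ) ∈ ξ.plane (A p) := by
    intro p hp
    refine mfderiv_fibre_eq_zero (hA p hp) h h' ?_ ?_
    · intro w
      have sp : Function.Surjective (projDeriv (F (h.direction p))) := by
        rw [← h'.direction_angle (F (h.direction p))]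
        exact fun u => ⟨_, h'.projDeriv_directionDeriv _ (u, 0)⟩
      obtain ⟨w1, rfl⟩ := sp w
      obtain ⟨w2, rfl⟩ := surj _ (mem p hp) w1
      obtain ⟨w3, rfl⟩ := (h.directionDeriv_bijective
        (Icc_subset_Ioo_pi (Set.Ioo_subset_Icc_self hp))).2 w2
      exact ⟨w3, dA p hp w3⟩
    · have ev : ∀ᶠ q : M × ℝ in 𝓝 p, q.2 ∈ Set.Ioo 0 (Real.pi / 2) :=
        continuous_snd.continuousAt.preimage_mem_nhds (isOpen_Ioo.mem_nhds hp)
      filter_upwards [ev] with q hq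
      -- Vectors with base part along `h.vector q` are the Engel vectors at `q`; their images
      -- project to one line, whose coordinates `c, s` are the cosine and sine of the angle of the
      -- image point.
      have key : ∀ v : EuclideanSpace ℝ (Fin 3) × ℝ, (∃ r : ℝ, v.1 = r • h.vector q) →
          ∃ l : ℝ, mfderiv stripModel (𝓡 3) A q v =
            l • h'.vector (A q, h'.angle (F (h.direction q))) := by
        rintro v ⟨r, hr⟩
        obtain ⟨l, hl⟩ := (h'.mem_engelPlane_iff_angle _).1 (engel _ (mem q hq) _
          ((h.mem_engelPlane_iff q (h.directionDeriv q v)).2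
            ⟨r, (h.projDeriv_directionDeriv q v).trans hr⟩))
        exact ⟨l, (dA q hq v).trans hl⟩
      obtain ⟨l, hl⟩ := key (0, 1) ⟨0, (zero_smul ℝ (h.vector q)).symm⟩
      obtain ⟨k, hk⟩ := key (h.vector q, 0) ⟨1, (one_smul ℝ (h.vector q)).symm⟩
      exact ⟨_, _, l, k, hl, hk⟩
  -- Any interior angle would serve as the section that defines `φ`.
  have mid : Real.pi / 4 ∈ Set.Ioo 0 (Real.pi / 2) := ⟨by positivity, by linarith [Real.pi_pos]⟩
  have sec : ∀ m : M, HasMFDerivAt (𝓡 3) stripModel (fun x : M => ((x, Real.pi / 4) : M × ℝ)) m _ :=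
    fun m => (hasMFDerivAt_id m).prodMk (hasMFDerivAt_const (Real.pi / 4) m)
  have smooth : ContMDiff (𝓡 3) (𝓡 3) ∞ (fun m : M => A (m, Real.pi / 4)) := fun m =>
    ContMDiffAt.comp (I' := stripModel) (g := A) m (hA (m, Real.pi / 4) mid)
      (contMDiffAt_id.prodMk contMDiffAt_const)
  refine ⟨fun m => A (m, Real.pi / 4), smooth, fun q hq => ?_, fun m v hv => ?_⟩
  · obtain ⟨p, hp, rfl⟩ := ha.exists_eq_direction hq
    have lift : ∀ t : ℝ, HasMFDerivAt 𝓘(ℝ, ℝ) stripModel (fun t : ℝ => ((p.1, t) : M × ℝ)) t _ :=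
      fun t => (hasMFDerivAt_const p.1 t).prodMk (hasMFDerivAt_id t)
    refine eqOn_of_hasMFDerivAt_zero (γ := fun t => A (p.1, t)) ?_ (fun t ht => ?_) mid hp
    · have c1 : Continuous (OrientedProlongation.base : OrientedProlongation ξ → M) :=
        contMDiff_base.continuous
      refine c1.comp_continuousOn (hF.continuousOn.comp ?_ fun t ht => ha.direction_mem ht)
      exact (h.contMDiff_direction.continuous.comp (Continuous.prodMk_right p.1)).continuousOn
    · have c := (((hA (p.1, t) ht).mdifferentiableAt (by simp)).hasMFDerivAt).comp t (lift t)
      have key : ∀ T : EuclideanSpace ℝ (Fin 3) × ℝ →L[ℝ] EuclideanSpace ℝ (Fin 3), T (0, 1) = 0 →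
          ∀ x : ℝ, T (0, x) = 0 := fun T hT x => by
        rw [show ((0, x) : EuclideanSpace ℝ (Fin 3) × ℝ) = x • (0, 1) by simp, map_smul, hT, smul_zero]
      exact c.congr_mfderiv (ContinuousLinearMap.ext (key _ (flat (p.1, t) ht).1))
  · have c := (((hA (m, Real.pi / 4) mid).mdifferentiableAt (by simp)).hasMFDerivAt).comp m (sec m)
    have d : ∀ u : EuclideanSpace ℝ (Fin 3), mfderiv (𝓡 3) (𝓡 3) (fun m : M => A (m, Real.pi / 4)) m u =
        mfderiv stripModel (𝓡 3) A (m, Real.pi / 4) ((u, 0) : EuclideanSpace ℝ (Fin 3) × ℝ) := fun u =>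
      congrArg (fun T : EuclideanSpace ℝ (Fin 3) →L[ℝ] EuclideanSpace ℝ (Fin 3) => T u) c.mfderiv
    obtain ⟨-, fX, fY⟩ := flat (m, Real.pi / 4) mid
    have gX : mfderiv (𝓡 3) (𝓡 3) (fun m : M => A (m, Real.pi / 4)) m (X m) ∈
        ξ.plane (A (m, Real.pi / 4)) := by
      refine Set.mem_of_eq_of_mem (d (X m)) fX
    have gY : mfderiv (𝓡 3) (𝓡 3) (fun m : M => A (m, Real.pi / 4)) m (Y m) ∈
        ξ.plane (A (m, Real.pi / 4)) := by
      refine Set.mem_of_eq_of_mem (d (Y m)) fY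
    obtain ⟨a, b, rfl⟩ := h.mem_iff.1 hv
    rw [map_add, map_smul, map_smul]
    exact add_mem (Submodule.smul_mem _ a gX) (Submodule.smul_mem _ b gY)

end Descent

section Inverse

variable {M : Type*} [TopologicalSpace M] [ChartedSpace (EuclideanSpace ℝ (Fin 3)) M]
  [IsManifold (𝓡 3) ∞ M] {ξ : ParallelizableContactStructure M}
  {X Y X' Y' : ∀ m : M, TangentSpace (𝓡 3) m} {V₀ V₁ W₀ W₁ : LegendrianField ξ}
  {h : IsFrame ξ.plane X Y} {h' : IsFrame ξ.plane X' Y'}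
  {f g : OrientedProlongation ξ → OrientedProlongation ξ} {Ω Ω' : Set (OrientedProlongation ξ)}

/-! ### Engel diffeomorphisms induce contact diffeomorphisms -/

lemma IsDiffeoOn.symm (hd : IsDiffeoOn f g Ω Ω') : IsDiffeoOn g f Ω' Ω :=
  ⟨hd.smooth_inv, hd.smooth, hd.mapsTo_inv, hd.mapsTo, hd.invOn.symm⟩

lemma IsDiffeoOn.hasMFDerivWithinAt (hd : IsDiffeoOn f g Ω Ω') {q : OrientedProlongation ξ}
    (hq : q ∈ Ω) : HasMFDerivWithinAt model model f Ω q (mfderivWithin model model f Ω q) :=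
  ((hd.smooth q hq).mdifferentiableWithinAt (by simp)).hasMFDerivWithinAt

lemma IsDiffeoOn.mfderivWithin_inv_apply (hd : IsDiffeoOn f g Ω Ω') (u : UniqueMDiffOn model Ω)
    {q : OrientedProlongation ξ} (hq : q ∈ Ω) (v : TangentSpace model q) :
    mfderivWithin model model g Ω' (f q) (mfderivWithin model model f Ω q v) = v := by
  have c := (hd.symm.hasMFDerivWithinAt (hd.mapsTo hq)).comp q (hd.hasMFDerivWithinAt hq) hd.mapsTo
  have i := (hasMFDerivWithinAt_id (I := model) Ω q).congr_of_eventuallyEq (f₁ := g ∘ f)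
    (eventually_nhdsWithin_of_forall fun x hx => hd.invOn.1 hx) (hd.invOn.1 hq)
  exact congrArg (fun T : EuclideanSpace ℝ (Fin 3) × EuclideanSpace ℝ (Fin 1) →L[ℝ]
      EuclideanSpace ℝ (Fin 3) × EuclideanSpace ℝ (Fin 1) => T v) (u.eq hq c i)

lemma IsDiffeoOn.mfderivWithin_bijective (hd : IsDiffeoOn f g Ω Ω') (u : UniqueMDiffOn model Ω)
    {q : OrientedProlongation ξ} (hq : q ∈ Ω) :
    Function.Bijective (mfderivWithin model model f Ω q) :=
  bijective_of_injective fun v w hvw => (hd.mfderivWithin_inv_apply u hq v).symm.trans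
    ((congrArg (mfderivWithin model model g Ω' (f q)) hvw).trans (hd.mfderivWithin_inv_apply u hq w))

/-- The hypothesis is an equality of planes, so every Engel vector of the target is the image of one
of the source, which the derivative of `g` returns. -/
lemma IsDiffeoOn.mfderivWithin_inv_mem_engelPlane (hd : IsDiffeoOn f g Ω Ω')
    (u : UniqueMDiffOn model Ω)
    (engel : ∀ q ∈ Ω, (engelPlane q).map (mfderivWithin model model f Ω q).toLinearMap =
      engelPlane (f q)) {q : OrientedProlongation ξ} (hq : q ∈ Ω') {v : TangentSpace model q}
    (hv : v ∈ engelPlane q) : mfderivWithin model model g Ω' q v ∈ engelPlane (g q) := by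
  have transport : ∀ {q₁ q₂ : OrientedProlongation ξ}, q₁ = q₂ →
      ∀ w : EuclideanSpace ℝ (Fin 3) × EuclideanSpace ℝ (Fin 1),
        (w : TangentSpace model q₁) ∈ engelPlane q₁ →
          (w : TangentSpace model q₂) ∈ engelPlane q₂ := by
    rintro q₁ _ rfl w hw
    exact hw
  obtain ⟨x, hx, rfl⟩ : ∃ x ∈ Ω, f x = q := ⟨g q, hd.mapsTo_inv hq, hd.invOn.2 hq⟩
  rw [← engel x hx] at hv
  obtain ⟨w, hw, rfl⟩ := hv
  refine transport (hd.invOn.1 hx).symm _ ?_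
  exact Set.mem_of_eq_of_mem (hd.mfderivWithin_inv_apply u hx w) hw

/-- An Engel diffeomorphism of Engel domains covers a contact diffeomorphism. -/
theorem IsDiffeoOn.exists_contactDiffeo [T2Space M]
    (hd : IsDiffeoOn f g (V₀.engelDomain V₁) (W₀.engelDomain W₁))
    (hV : V₀.NeverCollinear V₁) (hW : W₀.NeverCollinear W₁)
    (engel : ∀ q ∈ V₀.engelDomain V₁, (engelPlane q).map
      (mfderivWithin model model f (V₀.engelDomain V₁) q).toLinearMap = engelPlane (f q)) :
    ∃ φ : Diffeomorph (𝓡 3) (𝓡 3) M M ∞, IsContactDiffeo ξ φ ∧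
      ∀ q ∈ V₀.engelDomain V₁, (f q).base = φ q.base := by
  obtain ⟨X, Y, h, ha⟩ := exists_adapted_frame hV
  obtain ⟨X', Y', h', ha'⟩ := exists_adapted_frame hW
  have uV := uniqueMDiffOn_engelDomain hV
  have uW := uniqueMDiffOn_engelDomain hW
  obtain ⟨φ, sφ, bφ, cφ⟩ := ha.exists_base_map h' hd.smooth
    (fun q hq => (hd.mfderivWithin_bijective uV hq).2) fun q hq v hv => by
      rw [← engel q hq]
      exact ⟨v, hv, rfl⟩
  obtain ⟨ψ, sψ, bψ, -⟩ := ha'.exists_base_map h hd.smooth_inv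
    (fun q hq => (hd.symm.mfderivWithin_bijective uW hq).2) fun q hq v hv =>
      hd.mfderivWithin_inv_mem_engelPlane uV engel hq hv
  -- The two base maps are checked to be inverse on a single point of each fibre.
  have zero : (0 : ℝ) ∈ Set.Icc 0 (Real.pi / 2) := ⟨le_rfl, by positivity⟩
  have left : ∀ m, ψ (φ m) = m := fun m => by
    have hq := ha.direction_mem (p := (m, 0)) zero
    have e := bψ _ (hd.mapsTo hq)
    rw [bφ _ hq, hd.invOn.1 hq] at e
    exact e.symm
  have right : ∀ m, φ (ψ m) = m := fun m => by
    have hq := ha'.direction_mem (p := (m, 0)) zero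
    have e := bφ _ (hd.mapsTo_inv hq)
    rw [bψ _ hq, hd.invOn.2 hq] at e
    exact e.symm
  let Φ : Diffeomorph (𝓡 3) (𝓡 3) M M ∞ := ⟨⟨φ, ψ, left, right⟩, sφ, sψ⟩
  refine ⟨Φ, fun m => ?_, bφ⟩
  have fin : FiniteDimensional ℝ (TangentSpace (𝓡 3) (Φ m)) :=
    inferInstanceAs (FiniteDimensional ℝ (EuclideanSpace ℝ (Fin 3)))
  -- The descent gives only an inclusion of planes; `dφ` is injective, so dimensions make it an
  -- equality.
  refine Submodule.eq_of_le_of_finrank_eq ?_ ?_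
  · rintro _ ⟨v, hv, rfl⟩
    exact cφ m v hv
  · rw [h.finrank_plane, ← h.finrank_plane m]
    exact (Submodule.equivMapOfInjective (mfderiv (𝓡 3) (𝓡 3) Φ m).toLinearMap
      (mfderiv_diffeo_bijective Φ m).1 (ξ.plane m)).finrank_eq.symm

end Inverse

/-! ### Signs of the derivative along the fibres and along the directions -/

section Endpoints

variable {M : Type*} [TopologicalSpace M] [ChartedSpace (EuclideanSpace ℝ (Fin 3)) M]
  [IsManifold (𝓡 3) ∞ M] {ξ : ParallelizableContactStructure M}
  {X Y X' Y' : ∀ m : M, TangentSpace (𝓡 3) m} {V₀ V₁ W₀ W₁ : LegendrianField ξ}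
  {h : IsFrame ξ.plane X Y} {h' : IsFrame ξ.plane X' Y'}
  {f : OrientedProlongation ξ → OrientedProlongation ξ}
  {φ : Diffeomorph (𝓡 3) (𝓡 3) M M ∞}

lemma IsOrientedEngelDiffeo.hasMFDerivWithinAt (hf : IsOrientedEngelDiffeo V₀ V₁ W₀ W₁ f)
    {q : OrientedProlongation ξ} (hq : q ∈ V₀.engelDomain V₁) :
    HasMFDerivWithinAt model model f (V₀.engelDomain V₁) q
      (mfderivWithin model model f (V₀.engelDomain V₁) q) := by
  obtain ⟨g, hd⟩ := hf.diffeo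
  exact hd.hasMFDerivWithinAt hq

/-- The relation `π ∘ f = φ ∘ π` holds only on the domain, so derivatives within it are compared;
they are unique even at the boundary. -/
lemma IsOrientedEngelDiffeo.projDeriv_apply (hf : IsOrientedEngelDiffeo V₀ V₁ W₀ W₁ f)
    (hV : V₀.NeverCollinear V₁) (base : ∀ q ∈ V₀.engelDomain V₁, (f q).base = φ q.base)
    {q : OrientedProlongation ξ} (hq : q ∈ V₀.engelDomain V₁) (v : TangentSpace model q) :
    projDeriv (f q) (mfderivWithin model model f (V₀.engelDomain V₁) q v) =
      mfderiv (𝓡 3) (𝓡 3) φ q.base (projDeriv q v) := by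
  have c1 := (hasMFDerivAt_base (f q)).comp_hasMFDerivWithinAt q (hf.hasMFDerivWithinAt hq)
  have c2 := (((φ.mdifferentiable (by simp) q.base).hasMFDerivAt).comp q
    (hasMFDerivAt_base q)).hasMFDerivWithinAt (s := V₀.engelDomain V₁)
  have c3 := c2.congr_of_eventuallyEq (f₁ := OrientedProlongation.base ∘ f)
    (eventually_nhdsWithin_of_forall base) (base q hq)
  exact congrArg (fun T : EuclideanSpace ℝ (Fin 3) × EuclideanSpace ℝ (Fin 1) →L[ℝ]
    EuclideanSpace ℝ (Fin 3) => T v) ((uniqueMDiffOn_engelDomain hV).eq hq c1 c3)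

/-- The derivative of an oriented Engel diffeomorphism is positive along the fibres and along the
directions. -/
theorem IsOrientedEngelDiffeo.positive (hf : IsOrientedEngelDiffeo V₀ V₁ W₀ W₁ f)
    (hV : V₀.NeverCollinear V₁) (ha : h.Adapted V₀ V₁) (ha' : h'.Adapted W₀ W₁)
    (hφ : IsContactDiffeo ξ φ) (base : ∀ q ∈ V₀.engelDomain V₁, (f q).base = φ q.base)
    {p : M × ℝ} (hp : p.2 ∈ Set.Icc 0 (Real.pi / 2)) :
    0 < h'.angleDeriv (f (h.direction p)) (mfderivWithin model model f (V₀.engelDomain V₁)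
      (h.direction p) (h.directionDeriv p (0, 1))) ∧
    ∃ r : ℝ, 0 < r ∧ mfderiv (𝓡 3) (𝓡 3) φ p.1 (h.vector p) =
      r • h'.vector (φ p.1, h'.angle (f (h.direction p))) := by
  have ip := Icc_subset_Ioo_pi hp
  have hq := ha.direction_mem hp
  have hq' : f (h.direction p) ∈ W₀.engelDomain W₁ := by
    obtain ⟨g, hd⟩ := hf.diffeo
    exact hd.mapsTo hq
  have proj := fun v => hf.projDeriv_apply hV base hq v
  set L := mfderivWithin model model f (V₀.engelDomain V₁) (h.direction p) with hL
  have fibre : ∀ v, projDeriv (h.direction p) v = 0 → h'.angleDeriv (f (h.direction p)) (L v) =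
      h'.angleDeriv (f (h.direction p)) (L (h.directionDeriv p (0, 1))) *
        h.angleDeriv (h.direction p) v := by
    intro v hv
    conv_lhs => rw [h.eq_smul_of_projDeriv_eq_zero ip hv]
    rw [map_smul, map_smul, smul_eq_mul, mul_comm]
  -- The base of `f q` equals `φ p.1` only propositionally; stating the facts for a general `n` lets
  -- the equality be substituted.
  have transport : ∀ {n : M}, n = φ p.1 → ∀ (a : ℝ) (w : EuclideanSpace ℝ (Fin 3)) (r : ℝ),
      (w : TangentSpace (𝓡 3) n) = r • h'.vector (n, a) →
        (w : TangentSpace (𝓡 3) (φ p.1)) = r • h'.vector (φ p.1, a) := by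
    rintro _ rfl a w r e
    exact e
  have det_pos : ∀ {n : M}, n = φ p.1 → 0 < (h'.contactBasis n).det (fun i =>
      (mfderiv (𝓡 3) (𝓡 3) φ p.1 (h.contactBasis p.1 i) : EuclideanSpace ℝ (Fin 3))) := by
    rintro _ rfl
    exact h.det_contactBasis_pos h' hφ p.1
  have eb : (f (h.direction p)).base = φ p.1 := base _ hq
  have t_pos := ha.fibre_pos ha' hq hq' (K := mfderiv (𝓡 3) (𝓡 3) φ p.1) proj fibre (det_pos eb)
    (hf.orientation _ hq)
  -- Preservation of the Engel planes gives a factor `r` of unknown sign; `direction_pos` then uses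
  -- `t > 0` and the orientation of the planes.
  have mem : L (h.directionDeriv p (h.vector p, 0)) ∈ engelPlane (f (h.direction p)) := by
    rw [← hf.engel _ hq]
    exact ⟨_, (h.mem_engelPlane_iff p _).2 ⟨1, (h.projDeriv_directionDeriv p _).trans
      (one_smul ℝ (h.vector p)).symm⟩, rfl⟩
  obtain ⟨r, hr⟩ := (h'.mem_engelPlane_iff_angle _).1 mem
  have dir : (mfderiv (𝓡 3) (𝓡 3) φ p.1 (h.vector p) : EuclideanSpace ℝ (Fin 3)) =
      r • h'.vector ((f (h.direction p)).base, h'.angle (f (h.direction p))) := by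
    refine Eq.trans (Eq.trans ?_ (proj _).symm) hr
    exact congrArg (mfderiv (𝓡 3) (𝓡 3) φ p.1) (h.projDeriv_directionDeriv p (h.vector p, 0)).symm
  refine ⟨t_pos, r, ha.direction_pos ha' hq hq' (K := mfderiv (𝓡 3) (𝓡 3) φ p.1) proj fibre ?_
    (hf.engel_orientation _ hq) t_pos, transport eb _ _ r dir⟩
  rw [h.angle_direction_of_mem_Icc hp]
  exact dir

end Endpoints

/-! ### Boundary components and the contact diffeomorphism they determine -/

section Boundary

variable {M : Type*} [TopologicalSpace M] [ChartedSpace (EuclideanSpace ℝ (Fin 3)) M]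
  [IsManifold (𝓡 3) ∞ M] {ξ : ParallelizableContactStructure M}
  {X Y X' Y' : ∀ m : M, TangentSpace (𝓡 3) m} {V₀ V₁ W₀ W₁ : LegendrianField ξ}
  {h : IsFrame ξ.plane X Y} {h' : IsFrame ξ.plane X' Y'}
  {f : OrientedProlongation ξ → OrientedProlongation ξ}
  {φ : Diffeomorph (𝓡 3) (𝓡 3) M M ∞}

lemma IsFrame.hasDerivAt_fibre (h : IsFrame ξ.plane X Y) {a : OrientedProlongation ξ → ℝ}
    {p : M × ℝ} {T : TangentSpace model (h.direction p) →L[ℝ] TangentSpace model (f (h.direction p))}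
    {D : TangentSpace model (f (h.direction p)) →L[ℝ] ℝ}
    (hf : HasMFDerivAt model model f (h.direction p) T)
    (hD : HasMFDerivAt model 𝓘(ℝ, ℝ) a (f (h.direction p)) D) :
    HasDerivAt (fun θ => a (f (h.direction (p.1, θ)))) (D (T (h.directionDeriv p (0, 1)))) p.2 := by
  have h1 : HasMFDerivAt 𝓘(ℝ, ℝ) stripModel (fun x : ℝ => ((p.1, x) : M × ℝ)) p.2 _ :=
    (hasMFDerivAt_const p.1 p.2).prodMk (hasMFDerivAt_id p.2)
  have h2 := ((hD.comp _ hf).comp p (h.hasMFDerivAt_direction p)).comp p.2 h1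
  have h3 : HasFDerivAt (𝕜 := ℝ) (E := ℝ) (F := ℝ) (fun θ => a (f (h.direction (p.1, θ)))) _ p.2 :=
    hasMFDerivAt_iff_hasFDerivAt.1 h2
  exact HasFDerivAt.hasDerivAt (F := ℝ) h3

/-- An oriented Engel diffeomorphism preserves the two boundary components. -/
theorem IsOrientedEngelDiffeo.angle_boundary (hf : IsOrientedEngelDiffeo V₀ V₁ W₀ W₁ f)
    (hV : V₀.NeverCollinear V₁) (ha : h.Adapted V₀ V₁) (ha' : h'.Adapted W₀ W₁)
    (hφ : IsContactDiffeo ξ φ) (base : ∀ q ∈ V₀.engelDomain V₁, (f q).base = φ q.base) (m : M) :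
    h'.angle (f (h.direction (m, 0))) = 0 ∧
      h'.angle (f (h.direction (m, Real.pi / 2))) = Real.pi / 2 := by
  obtain ⟨g, hd⟩ := hf.diffeo
  -- The action of `f` on the fibre over `m`, in angles: an increasing map of `[0, π/2]` onto
  -- itself, which must fix both ends.
  let B : ℝ → ℝ := fun θ => h'.angle (f (h.direction (m, θ)))
  have mem : ∀ θ ∈ Set.Icc 0 (Real.pi / 2), B θ ∈ Set.Icc 0 (Real.pi / 2) := fun θ hθ =>
    ha'.mem_engelDomain_iff.1 (hd.mapsTo (ha.direction_mem (p := (m, θ)) hθ))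
  have angle_ne : ∀ θ ∈ Set.Icc 0 (Real.pi / 2), B θ ≠ Real.pi := fun θ hθ =>
    (Icc_subset_Ioo_pi (mem θ hθ)).2.ne
  have cont : ContinuousOn B (Set.Icc 0 (Real.pi / 2)) := by
    intro θ hθ
    refine (h'.contMDiffAt_angle (angle_ne θ hθ)).continuousAt.comp_continuousWithinAt
      (f := fun t => f (h.direction (m, t))) ?_
    refine ContinuousWithinAt.comp (g := f) (f := fun t : ℝ => h.direction (m, t))
      (hd.smooth.continuousOn _ (ha.direction_mem (p := (m, θ)) hθ)) ?_
      fun t ht => ha.direction_mem (p := (m, t)) ht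
    exact (h.contMDiff_direction.continuous.comp (Continuous.prodMk_right m)).continuousWithinAt
  have mono : StrictMonoOn B (Set.Icc 0 (Real.pi / 2)) := by
    refine strictMonoOn_of_deriv_pos (convex_Icc _ _) cont fun θ hθ => ?_
    rw [interior_Icc] at hθ
    have hθ' := Set.Ioo_subset_Icc_self hθ
    have nhds : V₀.engelDomain V₁ ∈ 𝓝 (h.direction (m, θ)) := ha.engelDomain_mem_nhds
      (by rwa [h.angle_direction_of_mem_Icc hθ'])
    have d := h.hasDerivAt_fibre (p := (m, θ)) ((hf.hasMFDerivWithinAt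
      (ha.direction_mem hθ')).hasMFDerivAt nhds) (h'.hasMFDerivAt_angle (angle_ne θ hθ'))
    exact lt_of_lt_of_eq (hf.positive hV ha ha' hφ base (p := (m, θ)) hθ').1 d.deriv.symm
  -- A preimage under `f` lies over the same `m` because `φ` is injective.
  have surj : ∀ t ∈ Set.Icc 0 (Real.pi / 2), ∃ θ ∈ Set.Icc 0 (Real.pi / 2), B θ = t := by
    intro t ht
    have hq := ha'.direction_mem (p := (φ m, t)) ht
    obtain ⟨p, hp, hpe⟩ := ha.exists_eq_direction (hd.mapsTo_inv hq)
    have e : f (h.direction p) = h'.direction (φ m, t) := by rw [hpe, hd.invOn.2 hq]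
    have hm : p.1 = m := φ.injective ((base _ (ha.direction_mem hp)).symm.trans
      (congrArg OrientedProlongation.base e))
    refine ⟨p.2, hp, ?_⟩
    change h'.angle (f (h.direction (m, p.2))) = t
    rw [← hm, Prod.mk.eta, e, h'.angle_direction_of_mem_Icc ht]
  have zero : (0 : ℝ) ∈ Set.Icc 0 (Real.pi / 2) := ⟨le_rfl, by positivity⟩
  have top : Real.pi / 2 ∈ Set.Icc 0 (Real.pi / 2) := ⟨by positivity, le_rfl⟩
  constructor
  · obtain ⟨θ, hθ, e⟩ := surj 0 zero
    exact le_antisymm ((mono.monotoneOn zero hθ hθ.1).trans e.le) (mem 0 zero).1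
  · obtain ⟨θ, hθ, e⟩ := surj (Real.pi / 2) top
    exact le_antisymm (mem _ top).2 (e.ge.trans (mono.monotoneOn hθ top hθ.2))

lemma IsFrame.Adapted.pointsAlong_fst_iff (ha : h.Adapted V₀ V₁) {m : M}
    (v : TangentSpace (𝓡 3) m) : PointsAlong (V₀.dir m) v ↔ ∃ r : ℝ, 0 < r ∧ v = r • X m := by
  rw [← (ha m).1, pointsAlong_iff, h.basis_zero]

lemma IsFrame.Adapted.pointsAlong_snd_iff (ha : h.Adapted V₀ V₁) {m : M}
    (v : TangentSpace (𝓡 3) m) : PointsAlong (V₁.dir m) v ↔ ∃ r : ℝ, 0 < r ∧ v = r • Y m := by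
  rw [← (ha m).2, pointsAlong_iff, h.basis_one]

lemma IsFrame.vector_zero (h : IsFrame ξ.plane X Y) (m : M) : h.vector (m, 0) = X m := by
  simp [IsFrame.vector]

lemma IsFrame.vector_pi_div_two (h : IsFrame ξ.plane X Y) (m : M) :
    h.vector (m, Real.pi / 2) = Y m := by
  simp [IsFrame.vector]

/-- An oriented Engel diffeomorphism of Engel domains induces a contact diffeomorphism that takes
the direction fields to each other. -/
theorem IsOrientedEngelDiffeo.exists_contactDiffeo [T2Space M]
    (hf : IsOrientedEngelDiffeo V₀ V₁ W₀ W₁ f) (hV : V₀.NeverCollinear V₁)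
    (hW : W₀.NeverCollinear W₁) :
    ∃ φ : Diffeomorph (𝓡 3) (𝓡 3) M M ∞, IsContactDiffeo ξ φ ∧
      TakesField φ V₀ W₀ ∧ TakesField φ V₁ W₁ := by
  obtain ⟨X, Y, h, ha⟩ := exists_adapted_frame hV
  obtain ⟨X', Y', h', ha'⟩ := exists_adapted_frame hW
  obtain ⟨g, hd⟩ := hf.diffeo
  obtain ⟨φ, hφ, base⟩ := hd.exists_contactDiffeo hV hW hf.engel
  -- At the angles `0` and `π/2` the vectors of adapted frames represent the given direction fields,
  -- so the positive factor `r` at these two angles is the claim.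
  have bd := hf.angle_boundary hV ha ha' hφ base
  refine ⟨φ, hφ, fun m v hv => ?_, fun m v hv => ?_⟩
  · obtain ⟨s, hs, rfl⟩ := (ha.pointsAlong_fst_iff v).1 hv
    obtain ⟨r, hr, e⟩ := (hf.positive hV ha ha' hφ base (p := (m, 0))
      ⟨le_rfl, by positivity⟩).2
    rw [(bd m).1, h.vector_zero, h'.vector_zero] at e
    refine (ha'.pointsAlong_fst_iff _).2 ⟨s * r, mul_pos hs hr, ?_⟩
    rw [map_smul, e, smul_smul]
  · obtain ⟨s, hs, rfl⟩ := (ha.pointsAlong_snd_iff v).1 hv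
    obtain ⟨r, hr, e⟩ := (hf.positive hV ha ha' hφ base (p := (m, Real.pi / 2))
      ⟨by positivity, le_rfl⟩).2
    rw [(bd m).2, h.vector_pi_div_two, h'.vector_pi_div_two] at e
    refine (ha'.pointsAlong_snd_iff _).2 ⟨s * r, mul_pos hs hr, ?_⟩
    rw [map_smul, e, smul_smul]

end Boundary

end EngelDomain

end

theorem theorem2 {M : Type*} [TopologicalSpace M] [T2Space M] [SecondCountableTopology M]
    [ChartedSpace (EuclideanSpace ℝ (Fin 3)) M] [IsManifold (𝓡 3) ∞ M]
    (ξ : EngelDomain.ParallelizableContactStructure M)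
    (V₀ V₁ W₀ W₁ : EngelDomain.LegendrianField ξ)
    (hV : V₀.NeverCollinear V₁) (hW : W₀.NeverCollinear W₁) :
    (∃ f : EngelDomain.OrientedProlongation ξ → EngelDomain.OrientedProlongation ξ,
      EngelDomain.IsOrientedEngelDiffeo V₀ V₁ W₀ W₁ f) ↔
    ∃ φ : Diffeomorph (𝓡 3) (𝓡 3) M M ∞, EngelDomain.IsContactDiffeo ξ φ ∧
      EngelDomain.TakesField φ V₀ W₀ ∧ EngelDomain.TakesField φ V₁ W₁ :=
  ⟨fun ⟨_, hf⟩ => hf.exists_contactDiffeo hV hW,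
    fun ⟨_, hφ, h0, h1⟩ => EngelDomain.exists_orientedEngelDiffeo hV hφ h0 h1⟩
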